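/- Let $\Omega\subset\mathbb R^3$ be a bounded polyhedral domain with a conforming tetrahedral mesh $\mathcal T_h$, i.e. a finite simplicial complex, all of whose simplices are faces of its tetrahedra, that triangulates $\overline\Omega$, where $\Omega$ is the interior of $\overline\Omega$. Let $\mathcal F_h$ and $\mathring{\mathcal F}_h$ be the sets of all faces and of the interior faces, fix a unit normal $\boldsymbol n_F$ for each face $F$ and a unit tangent $\boldsymbol t_e$ for each edge $e$, and let $\boldsymbol n$ be the outward unit normal on $\partial T$ for $T\in\mathcal T_h$. Let $\ell\in\{0,1\}$, let $\boldsymbol x_T$ be a fixed point for each $T\in\mathcal T_h$ (for instance its barycentre), and let $\mathbb T$ be the space of traceless $3\times3$ matrices. The gradient of a vector field has the gradients of the components as rows, the divergence of a matrix field is taken row-wise, $(\cdot,\cdot)$ denotes $L^2$ inner products, and $\mathrm{grad}_{\mathcal T_h},\mathrm{curl}_{\mathcal T_h}$ are taken elementwise. Set - $\mathring{\mathbb V}_h^{\rm grad}=\{\psi\in H_0^1(\Omega):\psi|_T\in\mathbb P_{\ell+1}(T)\ \forall T\in\mathcal T_h\}$; - $\mathring{\mathbb V}_h^{\rm curl}$: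 all $\boldsymbol v\in H_0(\mathrm{curl},\Omega)$ with $\boldsymbol v|_T\in \boldsymbol x\times\mathbb P_0(T;\mathbb R^3)+\mathrm{grad}\,\mathbb P_{\ell+1}(T)$ for all $T$ and single-valued degrees of freedom $\int_e(\boldsymbol v\cdot\boldsymbol t_e)q\,ds$, $q\in\mathbb P_\ell(e)$, on the edges $e$; - $\Sigma_{0,h}^{-1}=\{\boldsymbol\tau\in L^2(\Omega;\mathbb T):\boldsymbol\tau|_T\in\mathbb P_0(T;\mathbb T)\ \forall T\in\mathcal T_h\}$; - $\Lambda_h$: all $\boldsymbol\mu\in L^2(\mathcal F_h;\mathbb R^3)$ that are constant on each face, satisfy $\boldsymbol\mu\cdot\boldsymbol n_F=0$ on interior faces and vanish on boundary faces; - $W_h$: all $\boldsymbol v\in L^2(\Omega;\mathbb R^3)$ with $\boldsymbol v|_T\in\mathrm{grad}\,\mathbb P_{\ell+1}(T)\oplus(\boldsymbol x-\boldsymbol x_T)\times\mathbb P_1(T;\mathbb R^3)$ for all $T$ such that the degrees of freedom $\int_e(\boldsymbol v\cdot\boldsymbol t_e)q\,ds$, $q\in\mathbb P_\ell(e)$,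 on the edges and $\int_F(\mathrm{curl}\,\boldsymbol v)\times\boldsymbol n_F\,dS$ on the faces are single-valued and vanish on boundary edges and boundary faces. Let $I_h^{\rm curl}\boldsymbol v$ be the piecewise function with $(I_h^{\rm curl}\boldsymbol v)|_T\in \boldsymbol x\times\mathbb P_0(T;\mathbb R^3)+\mathrm{grad}\,\mathbb P_{\ell+1}(T)$ that has on each $T$ the same edge degrees of freedom as $\boldsymbol v|_T$, let $Q_{\mathcal F_h}$ be the facewise $L^2$ projection onto constant vectors, and put $$b_h(\boldsymbol\tau,\psi;\boldsymbol v)=\sum_{T\in\mathcal T_h}(\mathrm{div}\,\boldsymbol\tau,\mathrm{curl}\,\boldsymbol v)_T-\sum_{F\in\mathring{\mathcal F}_h}([\![\boldsymbol n^{\intercal}\boldsymbol\tau\boldsymbol n]\!],\boldsymbol n_F\cdot\mathrm{curl}\,\boldsymbol v)_F+(\mathrm{grad}\,\psi,\boldsymbol v),$$ $$c_h(\boldsymbol\tau,\boldsymbol\mu)=-\sum_{T\in\mathcal T_h}(\boldsymbol n\times\boldsymbol\tau\boldsymbol n_F,\boldsymbol\mu)_{\partial T},$$ where $[\![\boldsymbol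 n^{\intercal}\boldsymbol\tau\boldsymbol n]\!]$ on $F$ is the sum of $(\boldsymbol n\cdot\boldsymbol n_F)\,\boldsymbol n^{\intercal}\boldsymbol\tau|_T\boldsymbol n$ over the tetrahedra $T$ that share $F$. Let $\langle\boldsymbol f,\cdot\rangle$ be a linear functional on $\mathring{\mathbb V}_h^{\rm curl}$, for instance the restriction of an element of $H^{-1}(\mathrm{div},\Omega)=(H_0(\mathrm{curl},\Omega))'$ with vanishing divergence. Nonconforming method: find $(\boldsymbol w_h,\phi_h)\in W_h\times\mathring{\mathbb V}_h^{\rm grad}$ such that for all $\boldsymbol v_h\in W_h$ and $\psi_h\in\mathring{\mathbb V}_h^{\rm grad}$ $$(\mathrm{grad}_{\mathcal T_h}\mathrm{curl}_{\mathcal T_h}\boldsymbol w_h,\mathrm{grad}_{\mathcal T_h}\mathrm{curl}_{\mathcal T_h}\boldsymbol v_h)-(I_h^{\rm curl}\boldsymbol v_h,\mathrm{grad}\,\phi_h)=\langle\boldsymbol f,I_h^{\rm curl}\boldsymbol v_h\rangle,\qquad (I_h^{\rm curl}\boldsymbol w_h,\mathrm{grad}\,\psi_h)=0.$$ Hybridized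 mixed method ($k=1$): find $(\boldsymbol\sigma_h,\boldsymbol u_h,\phi_h,\boldsymbol\lambda_h)\in\Sigma_{0,h}^{-1}\times\mathring{\mathbb V}_h^{\rm curl}\times\mathring{\mathbb V}_h^{\rm grad}\times\Lambda_h$ such that $$(\boldsymbol\sigma_h,\boldsymbol\tau_h)+b_h(\boldsymbol\tau_h,\psi_h;\boldsymbol u_h)+c_h(\boldsymbol\tau_h,\boldsymbol\lambda_h)=0,\qquad \boldsymbol\tau_h\in\Sigma_{0,h}^{-1},\ \psi_h\in\mathring{\mathbb V}_h^{\rm grad},$$ $$b_h(\boldsymbol\sigma_h,\phi_h;\boldsymbol v_h)+c_h(\boldsymbol\sigma_h,\boldsymbol\mu_h)=-\langle\boldsymbol f,\boldsymbol v_h\rangle,\qquad \boldsymbol v_h\in\mathring{\mathbb V}_h^{\rm curl},\ \boldsymbol\mu_h\in\Lambda_h.$$ Theorem. If $(\boldsymbol w_h,\phi_h)$ solves the nonconforming method, then $Q_{\mathcal F_h}(\boldsymbol n_F\times\mathrm{curl}\,\boldsymbol w_h)$ is single-valued on every face and $$\big(\mathrm{grad}_{\mathcal T_h}\mathrm{curl}_{\mathcal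 T_h}\boldsymbol w_h,\ I_h^{\rm curl}\boldsymbol w_h,\ \phi_h,\ Q_{\mathcal F_h}(\boldsymbol n_F\times\mathrm{curl}\,\boldsymbol w_h)\big)\in\Sigma_{0,h}^{-1}\times\mathring{\mathbb V}_h^{\rm curl}\times\mathring{\mathbb V}_h^{\rm grad}\times\Lambda_h$$ solves the hybridized mixed method. Moreover the two methods are equivalent: every solution $(\boldsymbol\sigma_h,\boldsymbol u_h,\phi_h,\boldsymbol\lambda_h)$ of the hybridized method is obtained in this way from exactly one solution $(\boldsymbol w_h,\phi_h)$ of the nonconforming method. In particular one method is uniquely solvable if and only if the other is. -/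

import Mathlib

open MeasureTheory
open scoped ContDiff

noncomputable section

namespace QuadCurl

/-! ### Vector calculus in `ℝ³` -/

/-- Euclidean three-space. -/
abbrev E3 : Type := EuclideanSpace ℝ (Fin 3)

/-- Real `3 × 3` matrices. -/
abbrev Mat3 : Type := Matrix (Fin 3) (Fin 3) ℝ

/-- The cross product `a × b`. -/
def cross (a b : E3) : E3 := WithLp.toLp 2 (crossProduct (WithLp.ofLp a) (WithLp.ofLp b))

/-- The matrix-vector product `A a`. -/
def matVec (A : Mat3) (a : E3) : E3 := WithLp.toLp 2 (A.mulVec (WithLp.ofLp a))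

/-- The Frobenius product `A : B`. -/
def frob (A B : Mat3) : ℝ := ∑ i, ∑ j, A i j * B i j

/-- The partial derivative `∂_j f`. -/
def pd (j : Fin 3) (f : E3 → ℝ) (x : E3) : ℝ := fderiv ℝ f x (EuclideanSpace.single j 1)

/-- `curl v`. -/
def curl (v : E3 → E3) (x : E3) : E3 :=
  !₂[pd 1 (fun y => v y 2) x - pd 2 (fun y => v y 1) x,
     pd 2 (fun y => v y 0) x - pd 0 (fun y => v y 2) x,
     pd 0 (fun y => v y 1) x - pd 1 (fun y => v y 0) x]

/-- `div v` for a vector field. -/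
def divVec (v : E3 → E3) (x : E3) : ℝ := ∑ i, pd i (fun y => v y i) x

/-- `grad v` for a vector field: row `i` is the gradient of the component `v_i`. -/
def gradVec (v : E3 → E3) (x : E3) : Mat3 := Matrix.of fun i j => pd j (fun y => v y i) x

/-- The row-wise divergence of a matrix field. -/
def divMat (τ : E3 → Mat3) (x : E3) : E3 := WithLp.toLp 2 fun i => ∑ j, pd j (fun y => τ y i j) x

/-! ### Polynomials and local shape functions -/

/-- `f` is a polynomial function of total degree at most `k`. -/
def IsPoly (k : ℕ) (f : E3 → ℝ) : Prop :=
  ∃ p : MvPolynomial (Fin 3) ℝ, p.totalDegree ≤ k ∧ ∀ x, f x = MvPolynomial.eval (fun i => x i) p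

/-- `v` is a vector field with components in `ℙ_k`. -/
def IsPolyVec (k : ℕ) (v : E3 → E3) : Prop := ∀ i, IsPoly k (fun x => v x i)

/-- The Nédélec shape functions `x × ℙ_{k-1}(ℝ³) + grad ℙ_{ℓ+1}` with `k = 1`. -/
def IsNedelec (ℓ : ℕ) (v : E3 → E3) : Prop :=
  ∃ q : E3 → E3, ∃ p : E3 → ℝ, IsPolyVec 0 q ∧ IsPoly (ℓ + 1) p ∧
    ∀ x, v x = cross x (q x) + gradient p x

/-- The shape functions `grad ℙ_{ℓ+1} ⊕ (x - c) × ℙ_1(ℝ³)` of the `H(grad curl)`-nonconforming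
element. -/
def IsGradCurlShape (ℓ : ℕ) (c : E3) (v : E3 → E3) : Prop :=
  ∃ p : E3 → ℝ, ∃ q : E3 → E3, IsPoly (ℓ + 1) p ∧ IsPolyVec 1 q ∧
    ∀ x, v x = gradient p x + cross (x - c) (q x)

/-! ### Sobolev spaces with vanishing trace -/

/-- `u ∈ H₀¹(Ω)`: `u ∈ L²(Ω)` has a weak gradient `g ∈ L²(Ω; ℝ³)` and vanishing trace. Testing with
all `θ ∈ C_c^∞(ℝ³; ℝ³)`, not only with those supported in `Ω`, expresses through Green's formula
that the trace of `u` on `∂Ω` is zero. -/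
def MemH01 (Ω : Set E3) (u : E3 → ℝ) : Prop :=
  MemLp u 2 (volume.restrict Ω) ∧ ∃ g : E3 → E3, MemLp g 2 (volume.restrict Ω) ∧
    ∀ θ : E3 → E3, ContDiff ℝ ∞ θ → HasCompactSupport θ →
      ∫ x in Ω, u x * divVec θ x = -∫ x in Ω, inner ℝ (g x) (θ x)

/-- `u ∈ H₀(curl, Ω)`: `u ∈ L²(Ω; ℝ³)` has a weak curl `g ∈ L²(Ω; ℝ³)` and vanishing tangential
trace `n × u` on `∂Ω`, the latter again through Green's formula with `θ ∈ C_c^∞(ℝ³; ℝ³)`. -/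
def MemH0Curl (Ω : Set E3) (u : E3 → E3) : Prop :=
  MemLp u 2 (volume.restrict Ω) ∧ ∃ g : E3 → E3, MemLp g 2 (volume.restrict Ω) ∧
    ∀ θ : E3 → E3, ContDiff ℝ ∞ θ → HasCompactSupport θ →
      ∫ x in Ω, inner ℝ (u x) (curl θ x) = ∫ x in Ω, inner ℝ (g x) (θ x)

/-! ### Tetrahedral meshes -/

/-- A conforming tetrahedral mesh of `Ω`: a finite simplicial complex, every simplex of which is a
face of a tetrahedron, that triangulates the closure of `Ω`; together with the choice of a unit
normal `n_F` of every triangle `F` and of a unit tangent `t_e` of every edge `e`. Simplices are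
given by their vertex sets. -/
structure TetMesh (Ω : Set E3) where
  /-- the simplicial complex -/
  cplx : Geometry.SimplicialComplex ℝ E3
  finite_faces : cplx.faces.Finite
  pure : ∀ s ∈ cplx.faces, ∃ t ∈ cplx.faces, s ⊆ t ∧ t.card = 4
  space_eq : cplx.space = closure Ω
  interior_space : interior cplx.space = Ω
  /-- the chosen normals `n_F` -/
  normal : Finset E3 → E3
  norm_normal : ∀ F ∈ cplx.faces, F.card = 3 → ‖normal F‖ = 1
  normal_orth : ∀ F ∈ cplx.faces, F.card = 3 → ∀ x ∈ F, ∀ y ∈ F, inner ℝ (normal F) (x - y) = 0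
  /-- the chosen tangents `t_e` -/
  tangent : Finset E3 → E3
  norm_tangent : ∀ e ∈ cplx.faces, e.card = 2 → ‖tangent e‖ = 1
  tangent_parallel : ∀ e ∈ cplx.faces, e.card = 2 → ∀ x ∈ e, ∀ y ∈ e, ∃ r : ℝ, x - y = r • tangent e

namespace TetMesh

variable {Ω : Set E3} (M : TetMesh Ω)

/-- The simplices of the mesh with `n` vertices. -/
def Simp (n : ℕ) : Type := {s : Finset E3 // s ∈ M.cplx.faces ∧ s.card = n}

/-- The tetrahedra `𝒯_h`. -/
abbrev Cell : Type := M.Simp 4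

/-- The triangular faces `ℱ_h`. -/
abbrev Face : Type := M.Simp 3

/-- The edges `ℰ_h`. -/
abbrev Edge : Type := M.Simp 2

instance (n : ℕ) : Finite (M.Simp n) :=
  (M.finite_faces.subset fun _ h => h.1 : {s : Finset E3 | s ∈ M.cplx.faces ∧ s.card = n}.Finite)

instance (n : ℕ) : Fintype (M.Simp n) := Fintype.ofFinite _

variable {M}

/-- The closed simplex as a point set. -/
def Simp.hull {n : ℕ} (s : M.Simp n) : Set E3 := convexHull ℝ (s.1 : Set E3)

/-- `s` is a subsimplex of `t`. -/
def Simp.IsSub {m n : ℕ} (s : M.Simp m) (t : M.Simp n) : Prop := s.1 ⊆ t.1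

/-- A boundary face belongs to exactly one tetrahedron. -/
def IsBdryFace (F : M.Face) : Prop := ∃! T : M.Cell, F.IsSub T

/-- A boundary edge is an edge of a boundary face. -/
def IsBdryEdge (e : M.Edge) : Prop := ∃ F : M.Face, IsBdryFace F ∧ e.IsSub F

/-- The unit normal `n_F`. -/
def nF (F : M.Face) : E3 := M.normal F.1

/-- The unit tangent `t_e`. -/
def tE (e : M.Edge) : E3 := M.tangent e.1

open scoped Classical in
/-- The sign `n_T · n_F`, where `n_T` is the unit normal of the face `F` of `T` exterior to `T`:
it is `1` if `T` lies on the side of `F` opposite to `n_F`, and `-1` otherwise. -/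
def sgn (T : M.Cell) (F : M.Face) : ℝ :=
  if ∀ x ∈ T.1, ∀ y ∈ F.1, inner ℝ (nF F) (x - y) ≤ 0 then 1 else -1

/-- The unit normal `n` of `F ⊂ ∂T` exterior to `T`. -/
def nOut (T : M.Cell) (F : M.Face) : E3 := sgn T F • nF F

/-! ### Piecewise polynomial functions

A function on `Ω` whose restriction to each tetrahedron `T` is a polynomial is given by the family
of these polynomials, indexed by the tetrahedra. -/

variable (M) in
/-- Families of functions indexed by the tetrahedra. -/
abbrev Broken (X : Type) : Type := M.Cell → E3 → X

/-- The function (defined almost everywhere) on `Ω` that equals `v T` inside each `T`. -/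
def glue {X : Type} [AddCommMonoid X] (v : M.Broken X) : E3 → X := fun x =>
  ∑ T : M.Cell, (interior T.hull).indicator (v T) x

/-- Elementwise `grad` of a scalar function. -/
def gradH (ψ : M.Broken ℝ) : M.Broken E3 := fun T => gradient (ψ T)

/-- Elementwise `curl`. -/
def curlH (v : M.Broken E3) : M.Broken E3 := fun T => curl (v T)

/-- Elementwise `grad` of a vector function. -/
def gradVecH (v : M.Broken E3) : M.Broken Mat3 := fun T => gradVec (v T)

/-- The `L²(Ω; ℝ³)` inner product of piecewise functions. -/
def ipVec (u v : M.Broken E3) : ℝ := ∑ T : M.Cell, ∫ x in T.hull, inner ℝ (u T x) (v T x)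

/-- The `L²(Ω; 𝕄)` inner product of piecewise functions. -/
def ipMat (σ τ : M.Broken Mat3) : ℝ := ∑ T : M.Cell, ∫ x in T.hull, frob (σ T x) (τ T x)

/-! ### Degrees of freedom -/

/-- The edge moment `∫_e (v · t_e) q ds`. -/
def edgeDof (e : M.Edge) (v : E3 → E3) (q : E3 → ℝ) : ℝ :=
  ∫ x in e.hull, inner ℝ (v x) (tE e) * q x ∂μHE[1]

/-- The face moment `∫_F (curl v) × n_F dS`. -/
def faceDof (F : M.Face) (v : E3 → E3) : E3 :=
  ∫ x in F.hull, cross (curl v x) (nF F) ∂μHE[2]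

/-- All edge moments with weights in `ℙ_ℓ(e)` are single-valued. -/
def EdgeDofsSingleValued (ℓ : ℕ) (v : M.Broken E3) : Prop :=
  ∀ (e : M.Edge) (T T' : M.Cell), e.IsSub T → e.IsSub T' →
    ∀ q, IsPoly ℓ q → edgeDof e (v T) q = edgeDof e (v T') q

/-! ### Finite element spaces -/

/-- Lagrange elements of degree `ℓ + 1` in `H₀¹(Ω)`. -/
def lagrange0 (ℓ : ℕ) : Set (M.Broken ℝ) :=
  {ψ | (∀ T, IsPoly (ℓ + 1) (ψ T)) ∧ MemH01 Ω (glue ψ)}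

/-- Nédélec elements in `H₀(curl, Ω)` with `k = 1`. For `k = 1` and `ℓ ≤ 1` the edge moments are the
only degrees of freedom. -/
def nedelec0 (ℓ : ℕ) : Set (M.Broken E3) :=
  {v | (∀ T, IsNedelec ℓ (v T)) ∧ EdgeDofsSingleValued ℓ v ∧ MemH0Curl Ω (glue v)}

/-- `Σ_{k-1,h}^{-1}` with `k = 1`: piecewise constant traceless matrices. -/
def sigma0 : Set (M.Broken Mat3) :=
  {τ | ∀ T, (∀ i j, IsPoly 0 (fun x => τ T x i j)) ∧ ∀ x, (τ T x).trace = 0}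

/-- `Λ_{k-1,h}` with `k = 1`: a constant vector on each face, tangential to the interior faces and
zero on the boundary faces. -/
def lambda0 : Set (M.Face → E3) :=
  {μ | (∀ F, ¬ IsBdryFace F → inner ℝ (μ F) (nF F) = 0) ∧ ∀ F, IsBdryFace F → μ F = 0}

/-- The `H(grad curl)`-nonconforming space `W_h`, where `c T` is the point `x_T` of the shape
functions: the edge and face moments are single-valued and vanish on the boundary. -/
def wSpace (ℓ : ℕ) (c : M.Cell → E3) : Set (M.Broken E3) :=
  {v | (∀ T, IsGradCurlShape ℓ (c T) (v T)) ∧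
    EdgeDofsSingleValued ℓ v ∧
    (∀ (F : M.Face) (T T' : M.Cell), F.IsSub T → F.IsSub T' → faceDof F (v T) = faceDof F (v T')) ∧
    (∀ (e : M.Edge) (T : M.Cell), IsBdryEdge e → e.IsSub T →
      ∀ q, IsPoly ℓ q → edgeDof e (v T) q = 0) ∧
    (∀ (F : M.Face) (T : M.Cell), IsBdryFace F → F.IsSub T → faceDof F (v T) = 0)}

/-- The interpolation operator `I_h^curl`: on each `T` it is the Nédélec shape function that has the
same degrees of freedom as the given function on `T`. -/
def interp (ℓ : ℕ) (v : M.Broken E3) : M.Broken E3 := fun T =>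
  Classical.epsilon fun u : E3 → E3 => IsNedelec ℓ u ∧
    ∀ e : M.Edge, e.IsSub T → ∀ q, IsPoly ℓ q → edgeDof e u q = edgeDof e (v T) q

/-- The `L²(F)`-orthogonal projection of `g` onto the constant vectors on the face `F`. -/
def projF (F : M.Face) (g : E3 → E3) : E3 := ⨍ x in F.hull, g x ∂μHE[2]

/-- `μ = Q_{ℱ_h}(n_F × curl w)`: on each face, from whichever adjacent tetrahedron the trace of the
discontinuous function `curl w` is taken, its projection is `μ`. -/
def IsProjNCurl (w : M.Broken E3) (μ : M.Face → E3) : Prop :=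
  ∀ (F : M.Face) (T : M.Cell), F.IsSub T →
    μ F = projF F (fun x => cross (nF F) (curl (w T) x))

/-! ### Bilinear forms -/

open scoped Classical in
/-- `⟨(curl div)_w τ, v⟩`, that is
`∑_T (div τ, curl v)_T - ∑_F (⟦nᵀ τ n⟧, n_F · curl v)_F` over the tetrahedra `T` and the interior
faces `F`. The jump is the sum of `(n_T · n_F) nᵀ τ n` over the tetrahedra that share `F`; the factor
`n_F · curl v` is single-valued on `F` because `v` is in `H(curl, Ω)`. -/
def curlDivW (τ : M.Broken Mat3) (v : M.Broken E3) : ℝ :=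
  (∑ T : M.Cell, ∫ x in T.hull, inner ℝ (divMat (τ T) x) (curl (v T) x)) -
  ∑ F : M.Face with ¬ IsBdryFace F, ∑ T : M.Cell with F.IsSub T,
    ∫ x in F.hull, sgn T F * inner ℝ (nOut T F) (matVec (τ T x) (nOut T F)) *
      inner ℝ (nF F) (curl (v T) x) ∂μHE[2]

/-- `b_h(τ, ψ; v) = ⟨(curl div)_w τ, v⟩ + (grad ψ, v)`. -/
def bForm (τ : M.Broken Mat3) (ψ : M.Broken ℝ) (v : M.Broken E3) : ℝ :=
  curlDivW τ v + ipVec (gradH ψ) v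

open scoped Classical in
/-- `c_h(τ, μ) = -∑_T (n × τ n_F, μ)_{∂T}`. -/
def cForm (τ : M.Broken Mat3) (μ : M.Face → E3) : ℝ :=
  -∑ T : M.Cell, ∑ F : M.Face with F.IsSub T,
    ∫ x in F.hull, inner ℝ (cross (nOut T F) (matVec (τ T x) (nF F))) (μ F) ∂μHE[2]

/-! ### The two methods -/

/-- `(w, φ)` solves the `H(grad curl)`-nonconforming method with right-hand side `⟨f, ·⟩`. Only the
values of `f` on `nedelec0 ℓ` are relevant; every bounded functional on `H₀(curl, Ω)` induces such
a linear functional. -/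
def IsNonconformingSol (ℓ : ℕ) (c : M.Cell → E3) (f : M.Broken E3 →ₗ[ℝ] ℝ)
    (w : M.Broken E3) (φ : M.Broken ℝ) : Prop :=
  w ∈ wSpace ℓ c ∧ φ ∈ lagrange0 (M := M) ℓ ∧
  (∀ v ∈ wSpace ℓ c,
    ipMat (gradVecH (curlH w)) (gradVecH (curlH v)) - ipVec (interp ℓ v) (gradH φ)
      = f (interp ℓ v)) ∧
  ∀ ψ ∈ lagrange0 (M := M) ℓ, ipVec (interp ℓ w) (gradH ψ) = 0

/-- `(σ, u, φ, μ)` solves the hybridized mixed method with `k = 1` and right-hand side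
`-⟨f, ·⟩`. -/
def IsHybridSol (ℓ : ℕ) (f : M.Broken E3 →ₗ[ℝ] ℝ)
    (σ : M.Broken Mat3) (u : M.Broken E3) (φ : M.Broken ℝ) (μ : M.Face → E3) : Prop :=
  σ ∈ sigma0 (M := M) ∧ u ∈ nedelec0 (M := M) ℓ ∧ φ ∈ lagrange0 (M := M) ℓ ∧
    μ ∈ lambda0 (M := M) ∧
  (∀ τ ∈ sigma0 (M := M), ∀ ψ ∈ lagrange0 (M := M) ℓ,
    ipMat σ τ + bForm τ ψ u + cForm τ μ = 0) ∧
  ∀ v ∈ nedelec0 (M := M) ℓ, ∀ η ∈ lambda0 (M := M),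
    bForm σ φ v + cForm σ η = -f v

end TetMesh

end QuadCurl

end

/-! The hybridized method separates the degrees of freedom of `W_h` into two independent unknowns,
and two facts make this an equivalence.

Unisolvence (`exists_mem_wSpace`, `wSpace_unique`): w ↦ (I_h w, Q(n_F × curl w)) is a bijection from
`W_h` onto the product of the Nédélec space and Λ_h. On a cell, the curl of a shape function is
affine and divergence-free, so it is determined by its values at the barycentres of the four faces,
and these are its face means. By Stokes' theorem the edge moments give the normal part of each mean;
the face moments give the tangential part. If all moments vanish, the field is curl-free, hence a
Nédélec field without edge moments, hence zero. For existence the only constraint on the four values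
is zero total flux, and it holds because the normal parts are those of the constant field curl u.

Integration by parts (`ipMat_gradCurl`): for piecewise constant τ, (grad curl w, τ) = -⟨(curl div)_w
τ, I_h w⟩ - c_h(τ, Q(n_F × curl w)). On each face τn · curl w splits into a normal-normal part,
which sees only the mean of n · curl w and hence does not distinguish w from I_h w, and a tangential
part, which sees only the projected n_F × curl w.

The first hybrid equation therefore says that σ = grad curl w and that I_h w is orthogonal to
discrete gradients. The second one, tested with (I_h v, Q(n_F × curl v)), is the nonconforming
equation tested with v, and by the bijection such pairs exhaust the test space (`isHybridSol_iff`).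

The space H_0(curl) is given by weak curls, so it has to be compared with edge moments
(`mem_nedelec0_iff`). Green's formula is applied on each cell; contributions of interior faces
cancel because adjacent cells lie on opposite sides. Conversely, test fields concentrated near a
point of a boundary face show that the tangential trace vanishes there. The divergence theorem and
Stokes' theorem come from one-dimensional integration on the corner simplex; the outward area
vectors of a cell are -3|T| grad λ_i. -/

noncomputable section

namespace QuadCurl

/-! ### Parametrized simplices -/

/-- The corner simplex `{y ≥ 0, ∑ y ≤ 1}` of `ℝⁿ`. -/
def corner (n : ℕ) : Set (Fin n → ℝ) := {y | (∀ i, 0 ≤ y i) ∧ ∑ i, y i ≤ 1}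

/-- The affine parametrization of the simplex with vertices `p` over the corner simplex. -/
def simplexMap {n : ℕ} (p : Fin (n + 1) → E3) (y : Fin n → ℝ) : E3 :=
  p 0 + ∑ i, y i • (p i.succ - p 0)

/-- The integral over the corner simplex of the pull-back of `φ`. -/
def cornerInt {n : ℕ} {G : Type*} [NormedAddCommGroup G] [NormedSpace ℝ G]
    (p : Fin (n + 1) → E3) (φ : E3 → G) : G :=
  ∫ y in corner n, φ (simplexMap p y)

theorem isClosed_corner (n : ℕ) : IsClosed (corner n) := by
  have h : corner n = (⋂ i, {y : Fin n → ℝ | 0 ≤ y i}) ∩ {y | ∑ i, y i ≤ 1} := by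
    ext y; simp [corner]
  rw [h]
  refine (isClosed_iInter fun i => ?_).inter ?_
  · exact isClosed_le continuous_const (continuous_apply i)
  · exact isClosed_le (by fun_prop) continuous_const

theorem measurableSet_corner (n : ℕ) : MeasurableSet (corner n) :=
  (isClosed_corner n).measurableSet

theorem corner_subset_Icc (n : ℕ) : corner n ⊆ Set.Icc 0 1 := by
  intro y hy
  refine ⟨fun i => hy.1 i, fun i => ?_⟩
  exact (Finset.single_le_sum (fun j _ => hy.1 j) (Finset.mem_univ i)).trans hy.2

theorem isCompact_corner (n : ℕ) : IsCompact (corner n) :=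
  isCompact_Icc.of_isClosed_subset (isClosed_corner n) (corner_subset_Icc n)

theorem convex_corner (n : ℕ) : Convex ℝ (corner n) := by
  intro x hx y hy a b ha hb hab
  refine ⟨fun i => ?_, ?_⟩
  · have := hx.1 i; have := hy.1 i
    simp only [Pi.add_apply, Pi.smul_apply, smul_eq_mul]; positivity
  · simp only [Pi.add_apply, Pi.smul_apply, smul_eq_mul, Finset.sum_add_distrib, ← Finset.mul_sum]
    nlinarith [hx.2, hy.2]

theorem continuous_simplexMap {n : ℕ} (p : Fin (n + 1) → E3) : Continuous (simplexMap p) := by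
  unfold simplexMap; fun_prop

theorem contDiff_simplexMap {n : ℕ} (p : Fin (n + 1) → E3) : ContDiff ℝ ∞ (simplexMap p) := by
  unfold simplexMap; fun_prop

theorem simplexMap_image {n : ℕ} (p : Fin (n + 1) → E3) :
    simplexMap p '' corner n = convexHull ℝ (Set.range p) := by
  apply subset_antisymm
  · rintro _ ⟨y, hy, rfl⟩
    -- Barycentric weights: the slack 1 - ∑ y belongs to vertex 0.
    refine mem_convexHull_of_exists_fintype (Fin.cons (1 - ∑ i, y i) y) p ?_ ?_ ?_ ?_
    · intro i
      refine Fin.cases ?_ (fun j => ?_) i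
      · simpa using hy.2
      · simpa using hy.1 j
    · simp [Fin.sum_univ_succ]
    · intro i; exact ⟨i, rfl⟩
    · simp only [Fin.sum_univ_succ, Fin.cons_zero, Fin.cons_succ, simplexMap, smul_sub,
        Finset.sum_sub_distrib, ← Finset.sum_smul, sub_smul, one_smul]
      abel
  · refine convexHull_min ?_ ?_
    · rintro _ ⟨i, rfl⟩
      refine Fin.cases ⟨0, ⟨by simp, by simp⟩, by simp [simplexMap]⟩ (fun j => ?_) i
      refine ⟨Pi.single j 1, ⟨fun i => ?_, by simp⟩, ?_⟩
      · by_cases h : i = j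
        · subst h; simp
        · simp [h]
      · simp [simplexMap, Pi.single_apply]
    · rintro _ ⟨x, hx, rfl⟩ _ ⟨y, hy, rfl⟩ a b ha hb hab
      refine ⟨a • x + b • y, convex_corner n hx hy ha hb hab, ?_⟩
      simp only [simplexMap, Pi.add_apply, Pi.smul_apply, smul_eq_mul, add_smul,
        Finset.sum_add_distrib, mul_smul, ← Finset.smul_sum, smul_add]
      have : p 0 = a • p 0 + b • p 0 := by rw [← add_smul, hab, one_smul]
      rw [add_add_add_comm, ← this]

/-! ### Hausdorff integrals over simplices -/

/-- Change of variables for an injective affine map into a Euclidean space. -/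
theorem setIntegral_image_euclideanHausdorff {n : ℕ} {V G : Type*} [NormedAddCommGroup V]
    [InnerProductSpace ℝ V] [MeasurableSpace V] [BorelSpace V]
    [NormedAddCommGroup G] [NormedSpace ℝ G]
    (a : V) (A : EuclideanSpace ℝ (Fin n) →ₗ[ℝ] V) (hA : Function.Injective A) (φ : V → G)
    (s : Set (EuclideanSpace ℝ (Fin n))) :
    ∫ x in (fun u => a + A u) '' s, φ x ∂μHE[n] =
      A.normDet • ∫ u in s, φ (a + A u) := by
  have hemb : MeasurableEmbedding (fun u => a + A u) := by
    refine Topology.IsClosedEmbedding.measurableEmbedding ?_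
    exact (Homeomorph.addLeft a).isClosedEmbedding.comp
      (LinearMap.isClosedEmbedding_of_injective (LinearMap.ker_eq_bot.2 hA))
  -- On the image plane the Hausdorff measure is the push-forward of Lebesgue measure, scaled by the
  -- determinant factor of the linear part; the translation is an isometry and does not contribute.
  have hmap : ENNReal.ofReal A.normDet • (volume.map fun u => a + A u) =
      (μHE[n] : Measure V).restrict (Set.range fun u => a + A u) := by
    ext t ht
    have h1 : t ∩ Set.range (fun u => a + A u) =
        (fun x => a + x) '' (A '' ((fun u => a + A u) ⁻¹' t)) := by
      rw [Set.image_image, Set.image_preimage_eq_inter_range]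
    have h2 := A.euclideanHausdorffMeasure_image_eq_normDet_mul_volume ((fun u => a + A u) ⁻¹' t)
    rw [finrank_euclideanSpace_fin] at h2
    rw [Measure.restrict_apply ht, h1, (isometry_add_left a).euclideanHausdorffMeasure_image, h2,
      Measure.smul_apply, hemb.map_apply, smul_eq_mul]
  have h3 : (μHE[n] : Measure V).restrict ((fun u => a + A u) '' s) =
      ((μHE[n] : Measure V).restrict (Set.range fun u => a + A u)).restrict
        ((fun u => a + A u) '' s) := by
    rw [Measure.restrict_restrict_of_subset (Set.image_subset_range _ _)]
  rw [h3, ← hmap, Measure.restrict_smul, integral_smul_measure, hemb.setIntegral_map,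
    hemb.injective.preimage_image, ENNReal.toReal_ofReal A.normDet_nonneg]

/-- The linear part of `simplexMap`. -/
def simplexLin {n : ℕ} (p : Fin (n + 1) → E3) : EuclideanSpace ℝ (Fin n) →ₗ[ℝ] E3 where
  toFun u := ∑ i, u i • (p i.succ - p 0)
  map_add' u v := by simp [add_smul, Finset.sum_add_distrib]
  map_smul' c u := by simp [mul_smul, Finset.smul_sum]

/-- The factor between the Euclidean Hausdorff measure of a simplex and the corner simplex. -/
def simplexVol {n : ℕ} (p : Fin (n + 1) → E3) : ℝ := (simplexLin p).normDet

theorem simplexLin_injective {n : ℕ} {p : Fin (n + 1) → E3} (hp : AffineIndependent ℝ p) :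
    Function.Injective (simplexLin p) := by
  rw [affineIndependent_iff_linearIndependent_vsub ℝ p 0] at hp
  have h2 : LinearIndependent ℝ (fun i : Fin n => p i.succ - p 0) :=
    hp.comp (fun i : Fin n => (⟨i.succ, Fin.succ_ne_zero i⟩ : {x : Fin (n + 1) // x ≠ 0}))
      (fun i j h => by simpa using h)
  rw [injective_iff_map_eq_zero]
  intro u hu
  have := Fintype.linearIndependent_iff.1 h2 (fun i => u i) hu
  ext i; simpa using this i

theorem simplexVol_pos {n : ℕ} {p : Fin (n + 1) → E3} (hp : AffineIndependent ℝ p) :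
    0 < simplexVol p := by
  refine lt_of_le_of_ne (LinearMap.normDet_nonneg _) (Ne.symm ?_)
  exact ((simplexLin p).normDet_ne_zero_tfae.out 0 4).2 (simplexLin_injective hp)

/-- The Gram determinant makes the factor computable: it becomes a length, the norm of a cross
product or a triple product in dimension one, two or three. -/
theorem simplexVol_sq {n : ℕ} (p : Fin (n + 1) → E3) :
    simplexVol p ^ 2 = (Matrix.gram ℝ fun i : Fin n => p i.succ - p 0).det := by
  have := (simplexLin p).normDet_sq_eq_det_gram (EuclideanSpace.basisFun (Fin n) ℝ)
  have h2 : (fun i => simplexLin p (EuclideanSpace.basisFun (Fin n) ℝ i)) =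
      fun i : Fin n => p i.succ - p 0 := by
    ext i : 1
    simp [simplexLin]
  rw [h2] at this
  exact this

/-- Integrals over a simplex in terms of its parametrization. -/
theorem setIntegral_convexHull {n : ℕ} {G : Type*} [NormedAddCommGroup G] [NormedSpace ℝ G]
    {p : Fin (n + 1) → E3} (hp : AffineIndependent ℝ p) (φ : E3 → G) :
    ∫ x in convexHull ℝ (Set.range p), φ x ∂μHE[n] = simplexVol p • cornerInt p φ := by
  have h1 : convexHull ℝ (Set.range p) = (fun u => p 0 + simplexLin p u) ''
      (WithLp.toLp 2 '' corner n) := by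
    rw [Set.image_image, ← simplexMap_image]; rfl
  rw [h1, setIntegral_image_euclideanHausdorff _ _ (simplexLin_injective hp)]
  congr 1
  have h2 := (PiLp.volume_preserving_toLp (Fin n)).setIntegral_image_emb
    (MeasurableEquiv.toLp 2 (Fin n → ℝ)).measurableEmbedding
    (fun u => φ (p 0 + simplexLin p u)) (corner n)
  exact h2

/-! ### Derivatives integrated over simplices -/

/-- The fundamental theorem of calculus in the first coordinate of the corner simplex. -/
theorem setIntegral_corner_fderiv {n : ℕ} {φ : (Fin (n + 1) → ℝ) → ℝ} (hφ : ContDiff ℝ 1 φ) :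
    ∫ y in corner (n + 1), fderiv ℝ φ y (Pi.single 0 1) =
      ∫ y in corner n, (φ (Fin.cons (1 - ∑ i, y i) y) - φ (Fin.cons 0 y)) := by
  set ψ : (Fin (n + 1) → ℝ) → ℝ := fun y => fderiv ℝ φ y (Pi.single 0 1) with hψ
  have hψc : Continuous ψ := (hφ.continuous_fderiv one_ne_zero).clm_apply continuous_const
  have hmp := (volume_preserving_piFinSuccAbove (fun _ : Fin (n + 1) => ℝ) 0).symm
  have hcons : ∀ z : ℝ × (Fin n → ℝ),
      (MeasurableEquiv.piFinSuccAbove (fun _ : Fin (n + 1) => ℝ) 0).symm z = Fin.cons z.1 z.2 := by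
    intro z
    simp [MeasurableEquiv.piFinSuccAbove_symm_apply]
    rfl
  have hfint : IntegrableOn ψ (corner (n + 1)) :=
    hψc.continuousOn.integrableOn_compact (isCompact_corner _)
  -- Fubini with the first coordinate as inner variable. The slice over y is the interval [0, 1 - ∑
  -- y] if y lies in the lower-dimensional corner, and is empty otherwise.
  rw [← hmp.setIntegral_preimage_emb (MeasurableEquiv.measurableEmbedding _),
    ← integral_indicator ((MeasurableEquiv.measurable _) (measurableSet_corner _))]
  have hfint' : Integrable (((MeasurableEquiv.piFinSuccAbove (fun _ : Fin (n + 1) => ℝ) 0).symm ⁻¹'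
      corner (n + 1)).indicator fun z =>
        ψ ((MeasurableEquiv.piFinSuccAbove (fun _ : Fin (n + 1) => ℝ) 0).symm z)) := by
    rw [integrable_indicator_iff ((MeasurableEquiv.measurable _) (measurableSet_corner _))]
    exact (hmp.integrableOn_comp_preimage (MeasurableEquiv.measurableEmbedding _)).2 hfint
  rw [Measure.volume_eq_prod, integral_prod_symm _ (by rwa [← Measure.volume_eq_prod]),
    ← integral_indicator (measurableSet_corner n)]
  congr 1
  ext y
  by_cases hy : y ∈ corner n
  · rw [Set.indicator_of_mem hy]
    have hy0 : 0 ≤ 1 - ∑ i, y i := by linarith [hy.2]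
    have h1 : (fun s : ℝ => ((MeasurableEquiv.piFinSuccAbove (fun _ : Fin (n + 1) => ℝ) 0).symm ⁻¹'
        corner (n + 1)).indicator (fun z =>
        ψ ((MeasurableEquiv.piFinSuccAbove (fun _ : Fin (n + 1) => ℝ) 0).symm z)) (s, y)) =
        (Set.Icc 0 (1 - ∑ i, y i)).indicator fun s => ψ (Fin.cons s y) := by
      ext s
      by_cases hs : s ∈ Set.Icc 0 (1 - ∑ i, y i)
      · rw [Set.indicator_of_mem hs, Set.indicator_of_mem, hcons]
        rw [Set.mem_preimage, hcons]
        refine ⟨fun i => ?_, ?_⟩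
        · refine Fin.cases ?_ (fun j => ?_) i
          · simpa using hs.1
          · simpa using hy.1 j
        · have := hs.2
          simp [Fin.sum_univ_succ]; linarith
      · rw [Set.indicator_of_notMem hs, Set.indicator_of_notMem]
        rw [Set.mem_preimage, hcons]
        rintro ⟨ha, hb⟩
        apply hs
        have := ha 0
        simp [Fin.sum_univ_succ] at hb this
        exact ⟨this, by linarith⟩
    rw [h1, integral_indicator measurableSet_Icc, integral_Icc_eq_integral_Ioc,
      ← intervalIntegral.integral_of_le hy0]
    refine intervalIntegral.integral_eq_sub_of_hasDerivAt (f := fun s => φ (Fin.cons s y)) ?_ ?_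
    · intro s _
      have hc : HasDerivAt (fun s : ℝ => (Fin.cons s y : Fin (n + 1) → ℝ)) (Pi.single 0 1) s := by
        rw [hasDerivAt_pi]
        intro i
        refine Fin.cases ?_ (fun j => ?_) i
        · simpa using hasDerivAt_id' s
        · simpa using hasDerivAt_const s (y j)
      exact ((hφ.differentiable one_ne_zero) _).hasFDerivAt.comp_hasDerivAt s hc
    · refine Continuous.intervalIntegrable ?_ _ _
      refine hψc.comp ?_
      refine continuous_pi fun i => ?_
      refine Fin.cases ?_ (fun j => ?_) i
      · simpa using continuous_id'
      · simpa using continuous_const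
  · rw [Set.indicator_of_notMem hy]
    have h1 : (fun s : ℝ => ((MeasurableEquiv.piFinSuccAbove (fun _ : Fin (n + 1) => ℝ) 0).symm ⁻¹'
        corner (n + 1)).indicator (fun z =>
        ψ ((MeasurableEquiv.piFinSuccAbove (fun _ : Fin (n + 1) => ℝ) 0).symm z)) (s, y)) =
        fun _ => 0 := by
      ext s
      rw [Set.indicator_of_notMem]
      rw [Set.mem_preimage, hcons]
      rintro ⟨ha, hb⟩
      apply hy
      have h0 := ha 0
      simp [Fin.sum_univ_succ] at hb h0
      exact ⟨fun i => by simpa using ha i.succ, by linarith⟩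
    rw [h1, integral_zero]

/-- The integral of a directional derivative over a simplex, along the edge from vertex `0` to
vertex `1`. -/
theorem cornerInt_fderiv {n : ℕ} (p : Fin (n + 2) → E3) {φ : E3 → ℝ} (hφ : ContDiff ℝ 1 φ) :
    cornerInt p (fun x => fderiv ℝ φ x (p 1 - p 0)) =
      cornerInt (fun i => p i.succ) φ - cornerInt (fun i => p ((1 : Fin (n + 2)).succAbove i)) φ := by
  have hs : ContDiff ℝ 1 (simplexMap p) := (contDiff_simplexMap p).of_le (by exact_mod_cast le_top)
  have h := setIntegral_corner_fderiv (hφ.comp hs)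
  have h1 : ∀ y, fderiv ℝ (φ ∘ simplexMap p) y (Pi.single 0 1) =
      fderiv ℝ φ (simplexMap p y) (p 1 - p 0) := by
    intro y
    have hd : HasFDerivAt (simplexMap p)
        (∑ i, (ContinuousLinearMap.proj (R := ℝ) (φ := fun _ : Fin (n + 1) => ℝ) i).smulRight
          (p i.succ - p 0)) y := by
      unfold simplexMap
      refine (HasFDerivAt.fun_sum fun i _ => ?_).const_add _
      exact (ContinuousLinearMap.proj (R := ℝ) (φ := fun _ : Fin (n + 1) => ℝ) i).hasFDerivAt.smul_const
        (p i.succ - p 0)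
    rw [((hφ.differentiable one_ne_zero _).hasFDerivAt.comp y hd).fderiv]
    simp [Pi.single_apply, ite_smul]
  simp only [h1] at h
  unfold cornerInt
  rw [h]
  have hcont : ∀ q : Fin (n + 1) → E3, IntegrableOn (fun y => φ (simplexMap q y)) (corner n) :=
    fun q => (hφ.continuous.comp (continuous_simplexMap q)).continuousOn.integrableOn_compact
      (isCompact_corner _)
  rw [← integral_sub (hcont _) (hcont _)]
  congr 1
  ext y
  simp only [Function.comp]
  -- At the upper end of a slice the weight of vertex 0 vanishes, at the lower end that of vertex 1.
  -- The two end points thus run through the faces opposite to these vertices.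
  have e1 : simplexMap p (Fin.cons (1 - ∑ i, y i) y) = simplexMap (fun i => p i.succ) y := by
    simp only [simplexMap, Fin.sum_univ_succ, Fin.cons_zero, Fin.cons_succ, smul_sub,
      Finset.sum_sub_distrib, ← Finset.sum_smul, Fin.succ_zero_eq_one]
    module
  have e2 : simplexMap p (Fin.cons 0 y) =
      simplexMap (fun i => p ((1 : Fin (n + 2)).succAbove i)) y := by
    simp [simplexMap, Fin.sum_univ_succ]
  rw [e1, e2]

end QuadCurl
end

noncomputable section

namespace QuadCurl

/-! ### The cross product -/

theorem inner_eq (a b : E3) : inner ℝ a b = a 0 * b 0 + a 1 * b 1 + a 2 * b 2 := by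
  simp [PiLp.inner_apply, Fin.sum_univ_three, mul_comm]

@[simp] theorem cross_zero_apply (a b : E3) : cross a b 0 = a 1 * b 2 - a 2 * b 1 := by
  simp [cross, crossProduct]

@[simp] theorem cross_one_apply (a b : E3) : cross a b 1 = a 2 * b 0 - a 0 * b 2 := by
  simp [cross, crossProduct]

@[simp] theorem cross_two_apply (a b : E3) : cross a b 2 = a 0 * b 1 - a 1 * b 0 := by
  simp [cross, crossProduct]

theorem E3_ext {a b : E3} (h0 : a 0 = b 0) (h1 : a 1 = b 1) (h2 : a 2 = b 2) : a = b := by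
  ext i; fin_cases i <;> assumption

theorem inner_cross_left (a b : E3) : inner ℝ (cross a b) a = 0 := by
  simp [inner_eq]; ring

theorem inner_cross_right (a b : E3) : inner ℝ (cross a b) b = 0 := by
  simp [inner_eq]; ring

theorem inner_cross_cross (a b c d : E3) : inner ℝ (cross a b) (cross c d) =
    inner ℝ a c * inner ℝ b d - inner ℝ a d * inner ℝ b c := by
  simp [inner_eq]; ring

theorem cross_cross_eq (a b c : E3) :
    cross a (cross b c) = inner ℝ a c • b - inner ℝ a b • c := by
  apply E3_ext <;> simp [inner_eq] <;> ring

theorem norm_cross_sq (a b : E3) : ‖cross a b‖ ^ 2 =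
    inner ℝ a a * inner ℝ b b - inner ℝ a b * inner ℝ a b := by
  rw [← real_inner_self_eq_norm_sq, inner_cross_cross, real_inner_comm a b]

@[fun_prop]
theorem continuous_cross {X : Type*} [TopologicalSpace X] {f g : X → E3} (hf : Continuous f)
    (hg : Continuous g) : Continuous fun x => cross (f x) (g x) := by
  unfold cross
  refine (PiLp.continuous_toLp 2 _).comp ?_
  simp only [cross_apply]
  fun_prop

/-! ### Simplices of dimension one, two and three -/

theorem simplexVol_edge (a b : E3) : simplexVol ![a, b] = ‖b - a‖ := by
  have h := simplexVol_sq ![a, b]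
  simp [Matrix.gram] at h
  have h0 : 0 ≤ simplexVol ![a, b] := LinearMap.normDet_nonneg _
  exact (sq_eq_sq₀ h0 (norm_nonneg _)).1 h

theorem simplexVol_triangle (a b c : E3) : simplexVol ![a, b, c] = ‖cross (b - a) (c - a)‖ := by
  have h := simplexVol_sq ![a, b, c]
  simp [Matrix.gram, Matrix.det_fin_two] at h
  have h0 : 0 ≤ simplexVol ![a, b, c] := LinearMap.normDet_nonneg _
  refine (sq_eq_sq₀ h0 (norm_nonneg _)).1 ?_
  rw [h, norm_cross_sq, real_inner_self_eq_norm_sq, real_inner_self_eq_norm_sq,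
    real_inner_comm (b - a) (c - a)]

theorem simplexVol_tet (a b c d : E3) :
    simplexVol ![a, b, c, d] = |inner ℝ (cross (b - a) (c - a)) (d - a)| := by
  have h := simplexVol_sq ![a, b, c, d]
  have h0 : 0 ≤ simplexVol ![a, b, c, d] := LinearMap.normDet_nonneg _
  refine (sq_eq_sq₀ h0 (abs_nonneg _)).1 ?_
  rw [h, sq_abs, Matrix.det_fin_three]
  simp only [Matrix.gram, Matrix.of_apply]
  simp [inner_eq, -inner_self_eq_norm_sq_to_K]
  ring

theorem setIntegral_corner_one {G : Type*} [NormedAddCommGroup G] [NormedSpace ℝ G]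
    (g : (Fin 1 → ℝ) → G) : ∫ y in corner 1, g y = ∫ t in (0 : ℝ)..1, g fun _ => t := by
  have h := ((volume_preserving_funUnique (Fin 1) ℝ).symm).setIntegral_preimage_emb
    (MeasurableEquiv.measurableEmbedding _) g (corner 1)
  refine Eq.trans ?_ (h.symm.trans ?_)
  · congr!
  · have hset : (MeasurableEquiv.funUnique (Fin 1) ℝ).symm ⁻¹' corner 1 = Set.Icc (0 : ℝ) 1 := by
      ext t
      simp [corner, MeasurableEquiv.funUnique]
    rw [intervalIntegral.integral_of_le zero_le_one, ← integral_Icc_eq_integral_Ioc, hset]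
    rfl

theorem cornerInt_edge {G : Type*} [NormedAddCommGroup G] [NormedSpace ℝ G] (a b : E3)
    (φ : E3 → G) : cornerInt ![a, b] φ = ∫ t in (0 : ℝ)..1, φ (a + t • (b - a)) := by
  refine (setIntegral_corner_one fun y => φ (simplexMap ![a, b] y)).trans ?_
  simp [simplexMap]

theorem integrableOn_corner {n : ℕ} {G : Type*} [NormedAddCommGroup G] {g : (Fin n → ℝ) → G}
    (hg : Continuous g) : IntegrableOn g (corner n) :=
  hg.continuousOn.integrableOn_compact (isCompact_corner _)

/-- Only the derivative along the first coordinate has to be supplied, so moments of the corner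
follow from explicit antiderivatives such as `y 0 ^ 2 / 2`. -/
theorem setIntegral_corner_fderiv_eq {n : ℕ} {φ ψ : (Fin (n + 1) → ℝ) → ℝ} (hφ : ContDiff ℝ 1 φ)
    (h : ∀ y, HasDerivAt (fun s : ℝ => φ (y + s • Pi.single 0 1)) (ψ y) 0) :
    ∫ y in corner (n + 1), ψ y =
      ∫ y in corner n, (φ (Fin.cons (1 - ∑ i, y i) y) - φ (Fin.cons 0 y)) := by
  rw [← setIntegral_corner_fderiv hφ]
  congr 1
  ext y
  rw [← ((hφ.differentiable one_ne_zero y).hasFDerivAt.hasLineDerivAt _).lineDeriv]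
  exact (h y).deriv.symm

theorem setIntegral_corner_two_one : ∫ _ in corner 2, (1 : ℝ) = 1 / 2 := by
  rw [setIntegral_corner_fderiv_eq (φ := fun y => y 0) (by fun_prop), setIntegral_corner_one]
  · simp only [Fin.cons_zero, Finset.univ_unique, Finset.sum_const, Finset.card_singleton,
      one_smul, sub_zero]
    rw [intervalIntegral.integral_sub (by simp) (by simp)]
    norm_num
  · intro y
    simpa using (hasDerivAt_id' (0 : ℝ)).const_add (y 0)

theorem setIntegral_corner_two_eq (i : Fin 2) : ∫ y in corner 2, y i = 1 / 6 := by
  fin_cases i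
  · show ∫ y in corner 2, y 0 = 1 / 6
    rw [setIntegral_corner_fderiv_eq (φ := fun y => y 0 ^ 2 / 2) (by fun_prop),
      setIntegral_corner_one]
    · simp
      rw [intervalIntegral.integral_comp_sub_left (fun t => t ^ 2)]
      simp
      norm_num
    · intro y
      have := (((hasDerivAt_id' (0 : ℝ)).const_add (y 0)).pow 2).div_const 2
      simpa using this
  · show ∫ y in corner 2, y 1 = 1 / 6
    rw [setIntegral_corner_fderiv_eq (φ := fun y => y 0 * y 1) (by fun_prop),
      setIntegral_corner_one]
    · have : ∀ t : ℝ, (1 - t) * t = t - t ^ 2 := fun t => by ring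
      have h1 : ∀ (a : ℝ) (y : Fin 1 → ℝ), (Fin.cons a y : Fin 2 → ℝ) 1 = y 0 := fun a y => rfl
      simp only [Fin.cons_zero, h1, Finset.univ_unique, Finset.sum_const, Finset.card_singleton,
        one_smul, zero_mul, sub_zero, this]
      rw [intervalIntegral.integral_sub (by simp) (by simp)]
      norm_num
    · intro y
      have := ((hasDerivAt_id' (0 : ℝ)).const_add (y 0)).mul_const (y 1)
      simpa using this

theorem setIntegral_corner_three_one : ∫ _ in corner 3, (1 : ℝ) = 1 / 6 := by
  rw [setIntegral_corner_fderiv_eq (φ := fun y => y 0) (by fun_prop)]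
  · simp only [Fin.cons_zero, sub_zero, Fin.sum_univ_two]
    rw [integral_sub (integrableOn_corner (by fun_prop)) (integrableOn_corner (by fun_prop)),
      integral_add (integrableOn_corner (by fun_prop)) (integrableOn_corner (by fun_prop)),
      setIntegral_corner_two_one, setIntegral_corner_two_eq, setIntegral_corner_two_eq]
    norm_num
  · intro y
    simpa using (hasDerivAt_id' (0 : ℝ)).const_add (y 0)

/-- The integral of an affine function over a triangle is given by its value at the barycentre. -/
theorem cornerInt_triangle_affine (a b c : E3) (k : ℝ) (l : E3) :
    cornerInt ![a, b, c] (fun x => k + inner ℝ l x) =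
      1 / 2 * (k + inner ℝ l ((1 / 3 : ℝ) • (a + b + c))) := by
  have h : ∀ y : Fin 2 → ℝ, k + inner ℝ l (simplexMap ![a, b, c] y) =
      (k + inner ℝ l a) * 1 + y 0 * inner ℝ l (b - a) + y 1 * inner ℝ l (c - a) := by
    intro y
    simp only [simplexMap, Fin.sum_univ_two, inner_add_right, inner_smul_right]
    simp
    ring
  refine (setIntegral_congr_fun (measurableSet_corner 2) fun y _ => h y).trans ?_
  have e : ∫ y in corner 2, ((k + inner ℝ l a) * 1 + y 0 * inner ℝ l (b - a) +
      y 1 * inner ℝ l (c - a)) = (k + inner ℝ l a) * (1 / 2) + 1 / 6 * inner ℝ l (b - a) +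
      1 / 6 * inner ℝ l (c - a) := by
    rw [integral_add (integrableOn_corner (by fun_prop)) (integrableOn_corner (by fun_prop)),
      integral_add (integrableOn_corner (by fun_prop)) (integrableOn_corner (by fun_prop)),
      integral_const_mul, integral_mul_const, integral_mul_const, setIntegral_corner_two_eq,
      setIntegral_corner_two_eq, setIntegral_corner_two_one]
  refine e.trans ?_
  simp only [inner_add_right, inner_smul_right, inner_sub_right]
  ring

end QuadCurl
end

noncomputable section

namespace QuadCurl

/-! ### Partial derivatives -/

theorem matVec_apply (A : Mat3) (a : E3) (i : Fin 3) :
    matVec A a i = A i 0 * a 0 + A i 1 * a 1 + A i 2 * a 2 := by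
  simp [matVec, Matrix.mulVec, dotProduct, Fin.sum_univ_three]

theorem pd_const (j : Fin 3) (k : ℝ) (x : E3) : pd j (fun _ => k) x = 0 := by
  simp [pd]

theorem pd_coord (j i : Fin 3) (x : E3) : pd j (fun y => y i) x = if i = j then 1 else 0 := by
  unfold pd
  rw [show (fun y : E3 => y i) = (EuclideanSpace.proj i : E3 →L[ℝ] ℝ) from rfl,
    ContinuousLinearMap.fderiv]
  simp

theorem pd_add (j : Fin 3) {f g : E3 → ℝ} {x : E3} (hf : DifferentiableAt ℝ f x)
    (hg : DifferentiableAt ℝ g x) : pd j (fun y => f y + g y) x = pd j f x + pd j g x := by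
  unfold pd; rw [fderiv_fun_add hf hg]; rfl

theorem pd_sub (j : Fin 3) {f g : E3 → ℝ} {x : E3} (hf : DifferentiableAt ℝ f x)
    (hg : DifferentiableAt ℝ g x) : pd j (fun y => f y - g y) x = pd j f x - pd j g x := by
  unfold pd; rw [fderiv_fun_sub hf hg]; rfl

theorem pd_mul (j : Fin 3) {f g : E3 → ℝ} {x : E3} (hf : DifferentiableAt ℝ f x)
    (hg : DifferentiableAt ℝ g x) :
    pd j (fun y => f y * g y) x = f x * pd j g x + g x * pd j f x := by
  unfold pd; rw [fderiv_fun_mul hf hg]; rfl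

theorem pd_const_mul (j : Fin 3) (k : ℝ) {g : E3 → ℝ} {x : E3}
    (hg : DifferentiableAt ℝ g x) : pd j (fun y => k * g y) x = k * pd j g x := by
  unfold pd; rw [fderiv_const_mul hg]; rfl

theorem E3_eq_sum (v : E3) : v = v 0 • EuclideanSpace.single (0 : Fin 3) (1 : ℝ) +
    v 1 • EuclideanSpace.single (1 : Fin 3) (1 : ℝ) +
    v 2 • EuclideanSpace.single (2 : Fin 3) (1 : ℝ) := by
  apply E3_ext <;> simp

theorem fderiv_eq_pd (f : E3 → ℝ) (x v : E3) :
    fderiv ℝ f x v = v 0 * pd 0 f x + v 1 * pd 1 f x + v 2 * pd 2 f x := by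
  conv_lhs => rw [E3_eq_sum v]
  simp only [map_add, map_smul, smul_eq_mul, pd]

theorem gradient_apply (f : E3 → ℝ) (x : E3) (i : Fin 3) : gradient f x i = pd i f x := by
  have h : inner ℝ (gradient f x) (EuclideanSpace.single i (1 : ℝ)) = pd i f x := by
    rw [gradient, InnerProductSpace.toDual_symm_apply]; rfl
  rw [← h, EuclideanSpace.inner_single_right]
  simp

theorem curl_apply_zero (v : E3 → E3) (x : E3) :
    curl v x 0 = pd 1 (fun y => v y 2) x - pd 2 (fun y => v y 1) x := by simp [curl]

theorem curl_apply_one (v : E3 → E3) (x : E3) :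
    curl v x 1 = pd 2 (fun y => v y 0) x - pd 0 (fun y => v y 2) x := by simp [curl]

theorem curl_apply_two (v : E3 → E3) (x : E3) :
    curl v x 2 = pd 0 (fun y => v y 1) x - pd 1 (fun y => v y 0) x := by simp [curl]

theorem divVec_eq (v : E3 → E3) (x : E3) : divVec v x =
    pd 0 (fun y => v y 0) x + pd 1 (fun y => v y 1) x + pd 2 (fun y => v y 2) x := by
  simp [divVec, Fin.sum_univ_three]

theorem differentiableAt_coord {v : E3 → E3} {x : E3} (hv : DifferentiableAt ℝ v x) (i : Fin 3) :
    DifferentiableAt ℝ (fun y => v y i) x :=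
  (EuclideanSpace.proj i : E3 →L[ℝ] ℝ).differentiableAt.comp x hv

theorem contDiff_coord {n : WithTop ℕ∞} {v : E3 → E3} (hv : ContDiff ℝ n v) (i : Fin 3) :
    ContDiff ℝ n (fun y => v y i) :=
  (EuclideanSpace.proj i : E3 →L[ℝ] ℝ).contDiff.comp hv

theorem contDiff_of_coord {n : WithTop ℕ∞} {v : E3 → E3} (h : ∀ i, ContDiff ℝ n fun y => v y i) :
    ContDiff ℝ n v :=
  contDiff_euclidean.2 h

theorem contDiff_cross {n : WithTop ℕ∞} {u v : E3 → E3} (hu : ContDiff ℝ n u)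
    (hv : ContDiff ℝ n v) : ContDiff ℝ n fun x => cross (u x) (v x) := by
  have hu' := contDiff_coord hu
  have hv' := contDiff_coord hv
  refine contDiff_of_coord fun i => ?_
  fin_cases i
  · simpa using ((hu' 1).mul (hv' 2)).sub ((hu' 2).mul (hv' 1))
  · simpa using ((hu' 2).mul (hv' 0)).sub ((hu' 0).mul (hv' 2))
  · simpa using ((hu' 0).mul (hv' 1)).sub ((hu' 1).mul (hv' 0))

theorem contDiff_matVec {n : WithTop ℕ∞} (A : Mat3) {v : E3 → E3} (hv : ContDiff ℝ n v) :
    ContDiff ℝ n fun x => matVec A (v x) := by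
  have hv' := contDiff_coord hv
  refine contDiff_of_coord fun i => ?_
  simp only [matVec_apply]
  exact ((contDiff_const.mul (hv' 0)).add (contDiff_const.mul (hv' 1))).add
    (contDiff_const.mul (hv' 2))

theorem continuous_pd {f : E3 → ℝ} (hf : ContDiff ℝ 1 f) (j : Fin 3) : Continuous (pd j f) :=
  (hf.continuous_fderiv one_ne_zero).clm_apply continuous_const

theorem continuous_curl {v : E3 → E3} (hv : ContDiff ℝ 1 v) : Continuous (curl v) := by
  have h := fun i j => continuous_pd (contDiff_coord hv i) j
  refine (PiLp.continuous_toLp 2 _).comp (continuous_pi fun i => ?_)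
  fin_cases i
  · exact (h 2 1).sub (h 1 2)
  · exact (h 0 2).sub (h 2 0)
  · exact (h 1 0).sub (h 0 1)

/-- `div (θ × u) = u · curl θ - θ · curl u`. -/
theorem divVec_cross {θ u : E3 → E3} {x : E3} (hθ : DifferentiableAt ℝ θ x)
    (hu : DifferentiableAt ℝ u x) : divVec (fun y => cross (θ y) (u y)) x =
      inner ℝ (u x) (curl θ x) - inner ℝ (θ x) (curl u x) := by
  have h1 := differentiableAt_coord hθ
  have h2 := differentiableAt_coord hu
  rw [divVec_eq]
  simp only [cross_zero_apply, cross_one_apply, cross_two_apply]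
  rw [pd_sub _ ((h1 1).fun_mul (h2 2)) ((h1 2).fun_mul (h2 1)),
    pd_sub _ ((h1 2).fun_mul (h2 0)) ((h1 0).fun_mul (h2 2)),
    pd_sub _ ((h1 0).fun_mul (h2 1)) ((h1 1).fun_mul (h2 0)),
    pd_mul _ (h1 1) (h2 2), pd_mul _ (h1 2) (h2 1), pd_mul _ (h1 2) (h2 0),
    pd_mul _ (h1 0) (h2 2), pd_mul _ (h1 0) (h2 1), pd_mul _ (h1 1) (h2 0)]
  simp only [inner_eq, curl_apply_zero, curl_apply_one, curl_apply_two]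
  ring

/-- `div (τᵀ g) = τ : grad g` for a constant matrix `τ`. -/
theorem divVec_matVec_transpose (τ : Mat3) {g : E3 → E3} {x : E3} (hg : DifferentiableAt ℝ g x) :
    divVec (fun y => matVec τ.transpose (g y)) x = frob (gradVec g x) τ := by
  have h := differentiableAt_coord hg
  rw [divVec_eq]
  simp only [matVec_apply, Matrix.transpose_apply]
  have key : ∀ (j : Fin 3) (a b c : ℝ),
      pd j (fun y => a * g y 0 + b * g y 1 + c * g y 2) x =
        a * pd j (fun y => g y 0) x + b * pd j (fun y => g y 1) x +
          c * pd j (fun y => g y 2) x := by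
    intro j a b c
    rw [pd_add _ (((h 0).const_mul a).fun_add ((h 1).const_mul b)) ((h 2).const_mul c),
      pd_add _ ((h 0).const_mul a) ((h 1).const_mul b), pd_const_mul _ _ (h 0),
      pd_const_mul _ _ (h 1), pd_const_mul _ _ (h 2)]
  simp only [key, frob, gradVec, Fin.sum_univ_three, Matrix.of_apply]
  ring

theorem fderiv_inner_const {v : E3 → E3} {x : E3} (hv : DifferentiableAt ℝ v x) (a b : E3) :
    fderiv ℝ (fun y => inner ℝ (v y) b) x a =
      b 0 * fderiv ℝ (fun y => v y 0) x a + b 1 * fderiv ℝ (fun y => v y 1) x a +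
        b 2 * fderiv ℝ (fun y => v y 2) x a := by
  have h := differentiableAt_coord hv
  have e : (fun y => inner ℝ (v y) b) = fun y => b 0 * v y 0 + b 1 * v y 1 + b 2 * v y 2 := by
    ext y; rw [inner_eq]; ring
  rw [e, fderiv_fun_add (((h 0).const_mul _).fun_add ((h 1).const_mul _)) ((h 2).const_mul _),
    fderiv_fun_add ((h 0).const_mul _) ((h 1).const_mul _), fderiv_const_mul (h 0),
    fderiv_const_mul (h 1), fderiv_const_mul (h 2)]
  rfl

/-- `∂_a (v · b) - ∂_b (v · a) = curl v · (a × b)`. -/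
theorem inner_curl_cross {v : E3 → E3} {x : E3} (hv : DifferentiableAt ℝ v x) (a b : E3) :
    fderiv ℝ (fun y => inner ℝ (v y) b) x a - fderiv ℝ (fun y => inner ℝ (v y) a) x b =
      inner ℝ (curl v x) (cross a b) := by
  rw [fderiv_inner_const hv, fderiv_inner_const hv]
  simp only [fderiv_eq_pd, inner_eq, curl_apply_zero, curl_apply_one, curl_apply_two,
    cross_zero_apply, cross_one_apply, cross_two_apply]
  ring

/-! ### Polynomials of low degree -/

theorem IsPoly.mono {k l : ℕ} {f : E3 → ℝ} (h : IsPoly k f) (hkl : k ≤ l) : IsPoly l f := by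
  obtain ⟨p, hp, hf⟩ := h
  exact ⟨p, hp.trans hkl, hf⟩

theorem IsPoly.const (k : ℕ) (r : ℝ) : IsPoly k fun _ => r :=
  ⟨MvPolynomial.C r, by simp, by simp⟩

theorem IsPoly.coord (i : Fin 3) : IsPoly 1 fun x => x i :=
  ⟨MvPolynomial.X i, by simp, by simp⟩

theorem IsPoly.add {k : ℕ} {f g : E3 → ℝ} (hf : IsPoly k f) (hg : IsPoly k g) :
    IsPoly k fun x => f x + g x := by
  obtain ⟨p, hp, hf⟩ := hf
  obtain ⟨q, hq, hg⟩ := hg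
  exact ⟨p + q, (MvPolynomial.totalDegree_add _ _).trans (max_le hp hq), by simp [hf, hg]⟩

theorem IsPoly.mul {k l : ℕ} {f g : E3 → ℝ} (hf : IsPoly k f) (hg : IsPoly l g) :
    IsPoly (k + l) fun x => f x * g x := by
  obtain ⟨p, hp, hf⟩ := hf
  obtain ⟨q, hq, hg⟩ := hg
  exact ⟨p * q, (MvPolynomial.totalDegree_mul _ _).trans (add_le_add hp hq), by simp [hf, hg]⟩

theorem IsPoly.const_mul {k : ℕ} {f : E3 → ℝ} (hf : IsPoly k f) (r : ℝ) :
    IsPoly k fun x => r * f x := by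
  have := (IsPoly.const 0 r).mul hf
  rwa [zero_add] at this

/-- A set of functions that is closed under sums and multiples and contains the monomials of degree
at most `k` contains all polynomials of degree at most `k`. -/
theorem IsPoly.induction {k : ℕ} {P : (E3 → ℝ) → Prop} (hadd : ∀ f g, P f → P g → P (f + g))
    (hsmul : ∀ (r : ℝ) f, P f → P (r • f)) (hzero : P 0)
    (hmon : ∀ a b c : ℕ, a + b + c ≤ k → P fun x => x 0 ^ a * x 1 ^ b * x 2 ^ c)
    {f : E3 → ℝ} (hf : IsPoly k f) : P f := by
  obtain ⟨p, hp, hf⟩ := hf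
  have e : f = ∑ m ∈ p.support, p.coeff m • fun x : E3 => x 0 ^ m 0 * x 1 ^ m 1 * x 2 ^ m 2 := by
    ext x
    rw [hf, MvPolynomial.eval_eq']
    simp [Fin.prod_univ_three]
  rw [e]
  refine Finset.sum_induction _ P hadd hzero fun m hm => hsmul _ _ (hmon _ _ _ ?_)
  have h1 := (MvPolynomial.le_totalDegree hm).trans hp
  rw [Finsupp.sum_fintype _ _ (fun _ => rfl), Fin.sum_univ_three] at h1
  exact h1

/-- The explicit form in ten coefficients allows partial derivatives to be evaluated term by term.
-/
theorem IsPoly.exists_quadratic {f : E3 → ℝ} (hf : IsPoly 2 f) :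
    ∃ k b0 b1 b2 s00 s11 s22 s01 s02 s12 : ℝ, ∀ x : E3, f x = k + b0 * x 0 + b1 * x 1 + b2 * x 2 +
      s00 * (x 0 * x 0) + s11 * (x 1 * x 1) + s22 * (x 2 * x 2) + s01 * (x 0 * x 1) +
      s02 * (x 0 * x 2) + s12 * (x 1 * x 2) := by
  refine IsPoly.induction (k := 2) (P := fun f => ∃ k b0 b1 b2 s00 s11 s22 s01 s02 s12 : ℝ,
    ∀ x : E3, f x = k + b0 * x 0 + b1 * x 1 + b2 * x 2 +
      s00 * (x 0 * x 0) + s11 * (x 1 * x 1) + s22 * (x 2 * x 2) + s01 * (x 0 * x 1) +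
      s02 * (x 0 * x 2) + s12 * (x 1 * x 2)) ?_ ?_ ?_ ?_ hf
  · rintro f g ⟨k, b0, b1, b2, s00, s11, s22, s01, s02, s12, h⟩
      ⟨k', b0', b1', b2', s00', s11', s22', s01', s02', s12', h'⟩
    refine ⟨k + k', b0 + b0', b1 + b1', b2 + b2', s00 + s00', s11 + s11', s22 + s22',
      s01 + s01', s02 + s02', s12 + s12', fun x => ?_⟩
    rw [Pi.add_apply, h, h']; ring
  · rintro r f ⟨k, b0, b1, b2, s00, s11, s22, s01, s02, s12, h⟩
    refine ⟨r * k, r * b0, r * b1, r * b2, r * s00, r * s11, r * s22, r * s01, r * s02, r * s12,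
      fun x => ?_⟩
    rw [Pi.smul_apply, h, smul_eq_mul]; ring
  · exact ⟨0, 0, 0, 0, 0, 0, 0, 0, 0, 0, by simp⟩
  · intro a b c h
    have ha : a ≤ 2 := by omega
    have hb : b ≤ 2 := by omega
    have hc : c ≤ 2 := by omega
    interval_cases a <;> interval_cases b <;> interval_cases c <;> first | omega | skip
    · exact ⟨1, 0, 0, 0, 0, 0, 0, 0, 0, 0, fun x => by ring⟩
    · exact ⟨0, 0, 0, 1, 0, 0, 0, 0, 0, 0, fun x => by ring⟩
    · exact ⟨0, 0, 0, 0, 0, 0, 1, 0, 0, 0, fun x => by ring⟩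
    · exact ⟨0, 0, 1, 0, 0, 0, 0, 0, 0, 0, fun x => by ring⟩
    · exact ⟨0, 0, 0, 0, 0, 0, 0, 0, 0, 1, fun x => by ring⟩
    · exact ⟨0, 0, 0, 0, 0, 1, 0, 0, 0, 0, fun x => by ring⟩
    · exact ⟨0, 1, 0, 0, 0, 0, 0, 0, 0, 0, fun x => by ring⟩
    · exact ⟨0, 0, 0, 0, 0, 0, 0, 0, 1, 0, fun x => by ring⟩
    · exact ⟨0, 0, 0, 0, 0, 0, 0, 1, 0, 0, fun x => by ring⟩
    · exact ⟨0, 0, 0, 0, 1, 0, 0, 0, 0, 0, fun x => by ring⟩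

theorem IsPoly.exists_affine {f : E3 → ℝ} (hf : IsPoly 1 f) :
    ∃ k b0 b1 b2 : ℝ, ∀ x : E3, f x = k + b0 * x 0 + b1 * x 1 + b2 * x 2 := by
  refine IsPoly.induction (k := 1) (P := fun f => ∃ k b0 b1 b2 : ℝ,
    ∀ x : E3, f x = k + b0 * x 0 + b1 * x 1 + b2 * x 2) ?_ ?_ ?_ ?_ hf
  · rintro f g ⟨k, b0, b1, b2, h⟩ ⟨k', b0', b1', b2', h'⟩
    refine ⟨k + k', b0 + b0', b1 + b1', b2 + b2', fun x => ?_⟩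
    rw [Pi.add_apply, h, h']; ring
  · rintro r f ⟨k, b0, b1, b2, h⟩
    refine ⟨r * k, r * b0, r * b1, r * b2, fun x => ?_⟩
    rw [Pi.smul_apply, h, smul_eq_mul]; ring
  · exact ⟨0, 0, 0, 0, by simp⟩
  · intro a b c h
    have ha : a ≤ 1 := by omega
    have hb : b ≤ 1 := by omega
    have hc : c ≤ 1 := by omega
    interval_cases a <;> interval_cases b <;> interval_cases c <;> first | omega | skip
    · exact ⟨1, 0, 0, 0, fun x => by ring⟩
    · exact ⟨0, 0, 0, 1, fun x => by ring⟩
    · exact ⟨0, 0, 1, 0, fun x => by ring⟩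
    · exact ⟨0, 1, 0, 0, fun x => by ring⟩

theorem IsPoly.exists_const {f : E3 → ℝ} (hf : IsPoly 0 f) : ∃ k : ℝ, ∀ x : E3, f x = k := by
  obtain ⟨p, hp, hf⟩ := hf
  rw [Nat.le_zero, MvPolynomial.totalDegree_eq_zero_iff_eq_C] at hp
  exact ⟨p.coeff 0, fun x => by rw [hf, hp]; simp⟩

end QuadCurl
end

noncomputable section

namespace QuadCurl

/-! ### Affine fields and Nédélec shape functions -/

/-- The affine field `x ↦ α + B x`. -/
def affField (α : E3) (B : Mat3) (x : E3) : E3 := α + matVec B x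

theorem affField_apply (α : E3) (B : Mat3) (x : E3) (i : Fin 3) :
    affField α B x i = α i + (B i 0 * x 0 + B i 1 * x 1 + B i 2 * x 2) := by
  simp [affField, matVec_apply]

theorem pd_affine (j : Fin 3) (k a b c : ℝ) (x : E3) :
    pd j (fun y => k + (a * y 0 + b * y 1 + c * y 2)) x = ![a, b, c] j := by
  simp (disch := fun_prop) only [pd_add, pd_const_mul, pd_coord, pd_const]
  fin_cases j <;> simp

theorem pd_affField (α : E3) (B : Mat3) (i j : Fin 3) (x : E3) :
    pd j (fun y => affField α B y i) x = B i j := by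
  simp only [affField_apply, pd_affine]
  fin_cases j <;> rfl

theorem contDiff_affField (α : E3) (B : Mat3) : ContDiff ℝ ∞ (affField α B) :=
  contDiff_const.add (contDiff_matVec B contDiff_id)

/-- The curl of the affine field with linear part `B`. -/
def axial (B : Mat3) : E3 := !₂[B 2 1 - B 1 2, B 0 2 - B 2 0, B 1 0 - B 0 1]

theorem curl_affField (α : E3) (B : Mat3) (x : E3) : curl (affField α B) x = axial B := by
  simp [curl, pd_affField, axial]

theorem matVec_add (A : Mat3) (x y : E3) : matVec A (x + y) = matVec A x + matVec A y := by
  apply E3_ext <;> simp [matVec_apply] <;> ring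

theorem matVec_sub (A : Mat3) (x y : E3) : matVec A (x - y) = matVec A x - matVec A y := by
  apply E3_ext <;> simp [matVec_apply] <;> ring

theorem matVec_smul (A : Mat3) (r : ℝ) (x : E3) : matVec A (r • x) = r • matVec A x := by
  apply E3_ext <;> simp [matVec_apply] <;> ring

theorem add_matVec (A B : Mat3) (x : E3) : matVec (A + B) x = matVec A x + matVec B x := by
  apply E3_ext <;> simp [matVec_apply] <;> ring

theorem inner_matVec_transpose (A : Mat3) (x y : E3) :
    inner ℝ x (matVec A.transpose y) = inner ℝ (matVec A x) y := by
  simp [inner_eq, matVec_apply]; ring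

/-- The matrix of `x ↦ x × q`. -/
def crossMat (q : E3) : Mat3 := !![0, q 2, -q 1; -q 2, 0, q 0; q 1, -q 0, 0]

theorem matVec_crossMat (q x : E3) : matVec (crossMat q) x = cross x q := by
  apply E3_ext <;> simp [matVec_apply, crossMat] <;> ring

/-- The linear part is the Hessian, hence symmetric, and zero for polynomials of degree one.
Together with `exists_potential` this turns statements about gradients into linear algebra of pairs
(b, S). -/
theorem IsPoly.exists_gradient {ℓ : ℕ} (hℓ : ℓ = 0 ∨ ℓ = 1) {p : E3 → ℝ} (hp : IsPoly (ℓ + 1) p) :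
    ∃ (b : E3) (S : Mat3), S.transpose = S ∧ (ℓ = 0 → S = 0) ∧ gradient p = affField b S := by
  rcases hℓ with rfl | rfl
  · obtain ⟨k, b0, b1, b2, h⟩ := IsPoly.exists_affine hp
    refine ⟨!₂[b0, b1, b2], 0, by simp, fun _ => rfl, ?_⟩
    ext x i
    rw [gradient_apply, affField_apply, show p = _ from funext h]
    simp (disch := fun_prop) only [pd_add, pd_const_mul, pd_coord, pd_const]
    fin_cases i <;> simp
  · obtain ⟨k, b0, b1, b2, s00, s11, s22, s01, s02, s12, h⟩ := IsPoly.exists_quadratic hp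
    refine ⟨!₂[b0, b1, b2], !![2 * s00, s01, s02; s01, 2 * s11, s12; s02, s12, 2 * s22], ?_,
      fun h => absurd h one_ne_zero, ?_⟩
    · ext i j; fin_cases i <;> fin_cases j <;> rfl
    · ext x i
      rw [gradient_apply, affField_apply, show p = _ from funext h]
      simp (disch := fun_prop) only [pd_add, pd_const_mul, pd_mul, pd_coord, pd_const]
      fin_cases i <;> simp <;> ring

/-- The potential is b · x + (x · S x) / 2, written out in monomials. -/
theorem exists_potential {ℓ : ℕ} (hℓ : ℓ = 0 ∨ ℓ = 1) (b : E3) {S : Mat3} (hS : S.transpose = S)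
    (h0 : ℓ = 0 → S = 0) : ∃ p : E3 → ℝ, IsPoly (ℓ + 1) p ∧ gradient p = affField b S := by
  have hsym : ∀ i j, S i j = S j i := fun i j => congrFun (congrFun hS j) i
  have hlin : IsPoly 1 fun x => b 0 * x 0 + b 1 * x 1 + b 2 * x 2 :=
    (((IsPoly.coord 0).const_mul _).add ((IsPoly.coord 1).const_mul _)).add
      ((IsPoly.coord 2).const_mul _)
  rcases hℓ with rfl | rfl
  · refine ⟨_, hlin, ?_⟩
    ext x i
    rw [gradient_apply, affField_apply, h0 rfl]
    simp (disch := fun_prop) only [pd_add, pd_const_mul, pd_coord]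
    fin_cases i <;> simp
  · have hq : ∀ (r : ℝ) (i j : Fin 3), IsPoly 2 fun x => r * (x i * x j) := fun r i j =>
      ((IsPoly.coord i).mul (IsPoly.coord j)).const_mul r
    refine ⟨fun x => b 0 * x 0 + b 1 * x 1 + b 2 * x 2 + S 0 0 / 2 * (x 0 * x 0) +
      S 1 1 / 2 * (x 1 * x 1) + S 2 2 / 2 * (x 2 * x 2) + S 0 1 * (x 0 * x 1) +
      S 0 2 * (x 0 * x 2) + S 1 2 * (x 1 * x 2), ?_, ?_⟩
    · exact ((((((hlin.mono one_le_two).add (hq _ _ _)).add (hq _ _ _)).add (hq _ _ _)).add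
        (hq _ _ _)).add (hq _ _ _)).add (hq _ _ _)
    · ext x i
      rw [gradient_apply, affField_apply]
      simp (disch := fun_prop) only [pd_add, pd_const_mul, pd_mul, pd_coord]
      fin_cases i <;> simp [hsym 1 0, hsym 2 0, hsym 2 1] <;> ring

/-- A matrix is the sum of a symmetric part, which has a quadratic potential, and a skew part, which
is of the form x ↦ x × q. So all affine fields occur for ℓ = 1, and only those with skew linear part
for ℓ = 0. -/
theorem isNedelec_iff {ℓ : ℕ} (hℓ : ℓ = 0 ∨ ℓ = 1) {v : E3 → E3} :
    IsNedelec ℓ v ↔ ∃ (α : E3) (B : Mat3), v = affField α B ∧ (ℓ = 0 → B.transpose = -B) := by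
  constructor
  · rintro ⟨q, p, hq, hp, hv⟩
    obtain ⟨b, S, -, hS0, hg⟩ := hp.exists_gradient hℓ
    choose q0 hq0 using fun i => (hq i).exists_const
    have hq' : ∀ x, q x = WithLp.toLp 2 q0 := fun x => by ext i; exact hq0 i x
    refine ⟨b, crossMat (WithLp.toLp 2 q0) + S, ?_, ?_⟩
    · ext1 x
      rw [hv, hq', hg, affField, affField, add_matVec, matVec_crossMat]
      abel
    · intro h
      rw [hS0 h, add_zero]
      ext i j; fin_cases i <;> fin_cases j <;> simp [crossMat]
  · rintro ⟨α, B, rfl, hB⟩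
    have hS : ((1 / 2 : ℝ) • (B + B.transpose)).transpose = (1 / 2 : ℝ) • (B + B.transpose) := by
      ext i j; simp; ring
    obtain ⟨p, hp, hg⟩ := exists_potential hℓ α hS (fun h => by rw [hB h]; simp)
    -- The curl of x × q is -2 q, which gives the factor -1/2.
    refine ⟨fun _ => (-(1 / 2) : ℝ) • axial B, p, fun i => IsPoly.const 0 _, hp, fun x => ?_⟩
    rw [hg, affField, affField, add_comm (cross _ _), add_assoc]
    congr 1
    apply E3_ext <;> simp [matVec_apply, axial] <;> ring

/-- A vanishing curl makes the linear part symmetric; for ℓ = 0 it is also skew and therefore zero.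
-/
theorem exists_gradient_of_curl_eq_zero {ℓ : ℕ} (hℓ : ℓ = 0 ∨ ℓ = 1) {v : E3 → E3}
    (hv : IsNedelec ℓ v) (hc : ∀ x, curl v x = 0) :
    ∃ p : E3 → ℝ, IsPoly (ℓ + 1) p ∧ gradient p = v := by
  obtain ⟨α, B, rfl, hB⟩ := (isNedelec_iff hℓ).1 hv
  have h := hc 0
  rw [curl_affField] at h
  have h0 : B 2 1 - B 1 2 = 0 := by simpa [axial] using congrArg (fun a : E3 => a 0) h
  have h1 : B 0 2 - B 2 0 = 0 := by simpa [axial] using congrArg (fun a : E3 => a 1) h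
  have h2 : B 1 0 - B 0 1 = 0 := by simpa [axial] using congrArg (fun a : E3 => a 2) h
  have hS : B.transpose = B := by
    ext i j; fin_cases i <;> fin_cases j <;> simp <;> linarith
  refine exists_potential hℓ α hS fun h => ?_
  have := hB h
  rw [hS] at this
  ext i j
  have h3 := congrFun (congrFun this i) j
  rw [Matrix.neg_apply] at h3
  simp; linarith

theorem IsNedelec.sub {ℓ : ℕ} (hℓ : ℓ = 0 ∨ ℓ = 1) {u v : E3 → E3} (hu : IsNedelec ℓ u)
    (hv : IsNedelec ℓ v) : IsNedelec ℓ (u - v) := by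
  obtain ⟨α, B, rfl, hB⟩ := (isNedelec_iff hℓ).1 hu
  obtain ⟨β, C, rfl, hC⟩ := (isNedelec_iff hℓ).1 hv
  refine (isNedelec_iff hℓ).2 ⟨α - β, B - C, ?_, fun h => ?_⟩
  · ext x i
    simp [affField_apply]; ring
  · rw [Matrix.transpose_sub, hB h, hC h]; abel

theorem IsNedelec.contDiff {ℓ : ℕ} (hℓ : ℓ = 0 ∨ ℓ = 1) {u : E3 → E3} (hu : IsNedelec ℓ u) :
    ContDiff ℝ ∞ u := by
  obtain ⟨α, B, rfl, hB⟩ := (isNedelec_iff hℓ).1 hu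
  exact contDiff_affField α B

/-! ### The `H(grad curl)` shape functions -/

theorem IsPolyVec.exists_affField {q : E3 → E3} (hq : IsPolyVec 1 q) :
    ∃ α B, q = affField α B := by
  choose k b0 b1 b2 h using fun i => (hq i).exists_affine
  refine ⟨WithLp.toLp 2 k, Matrix.of fun i => ![b0 i, b1 i, b2 i], ?_⟩
  ext x i
  rw [h i, affField_apply]
  simp; ring

/-- The field `α + S x + (x - c) × (q + Q (x - c))`. -/
def gcField (c α : E3) (S : Mat3) (q : E3) (Q : Mat3) (x : E3) : E3 :=
  affField α S x + cross (x - c) (q + matVec Q (x - c))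

theorem contDiff_gcField (c α : E3) (S : Mat3) (q : E3) (Q : Mat3) :
    ContDiff ℝ ∞ (gcField c α S q Q) :=
  (contDiff_affField α S).add (contDiff_cross (contDiff_id.sub contDiff_const)
    (contDiff_const.add (contDiff_matVec Q (contDiff_id.sub contDiff_const))))

theorem isGradCurlShape_iff {ℓ : ℕ} (hℓ : ℓ = 0 ∨ ℓ = 1) {c : E3} {v : E3 → E3} :
    IsGradCurlShape ℓ c v ↔ ∃ (α : E3) (S : Mat3) (q : E3) (Q : Mat3),
      v = gcField c α S q Q ∧ S.transpose = S ∧ (ℓ = 0 → S = 0) := by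
  constructor
  · rintro ⟨p, q, hp, hq, hv⟩
    obtain ⟨b, S, hS, hS0, hg⟩ := hp.exists_gradient hℓ
    obtain ⟨β, Q, rfl⟩ := hq.exists_affField
    -- The factor in ℙ_1 is expanded about c instead of the origin.
    refine ⟨b, S, β + matVec Q c, Q, ?_, hS, hS0⟩
    ext1 x
    rw [hv, hg, gcField, matVec_sub, affField, affField]
    congr 2
    abel
  · rintro ⟨α, S, q, Q, rfl, hS, hS0⟩
    obtain ⟨p, hp, hg⟩ := exists_potential hℓ α hS hS0
    refine ⟨p, fun x => q + matVec Q (x - c), hp, fun i => ?_, fun x => by rw [hg]; rfl⟩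
    have h : (fun x : E3 => (q + matVec Q (x - c)) i) =
        fun x => (q - matVec Q c) i + (Q i 0 * x 0 + Q i 1 * x 1 + Q i 2 * x 2) := by
      ext x; simp [matVec_apply]; ring
    rw [h]
    exact (IsPoly.const _ _).add ((((IsPoly.coord 0).const_mul _).add
      ((IsPoly.coord 1).const_mul _)).add ((IsPoly.coord 2).const_mul _))

/-- The linear part of `curl (gcField c α S q Q)`. -/
def curlMat (Q : Mat3) : Mat3 := Q.trace • 1 - (3 : ℝ) • Q

theorem trace_curlMat (Q : Mat3) : (curlMat Q).trace = 0 := by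
  simp [curlMat, Matrix.trace_sub, Matrix.trace_smul]; ring

/-- With y = x - c, the curl of y × q is -2 q and the curl of y × Q y is (tr Q) y - 3 Q y; a
symmetric linear part contributes nothing. -/
theorem curl_gcField (c α : E3) {S : Mat3} (hS : S.transpose = S) (q : E3) (Q : Mat3) :
    curl (gcField c α S q Q) =
      affField ((-2 : ℝ) • q - matVec (curlMat Q) c) (curlMat Q) := by
  have hsym : ∀ i j, S i j = S j i := fun i j => congrFun (congrFun hS j) i
  have hc : ∀ i x, gcField c α S q Q x i = affField α S x i +
      cross (x - c) (q + matVec Q (x - c)) i := fun i x => by simp [gcField]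
  ext1 x
  apply E3_ext
  · rw [curl_apply_zero]
    simp only [hc, cross_one_apply, cross_two_apply, affField_apply, matVec_apply,
      PiLp.add_apply, PiLp.sub_apply]
    simp (disch := fun_prop) only [pd_add, pd_sub, pd_const_mul, pd_mul, pd_coord, pd_const]
    simp [curlMat, Matrix.trace, Fin.sum_univ_three, hsym 1 0, hsym 2 0, hsym 2 1]
    ring
  · rw [curl_apply_one]
    simp only [hc, cross_zero_apply, cross_two_apply, affField_apply, matVec_apply,
      PiLp.add_apply, PiLp.sub_apply]
    simp (disch := fun_prop) only [pd_add, pd_sub, pd_const_mul, pd_mul, pd_coord, pd_const]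
    simp [curlMat, Matrix.trace, Fin.sum_univ_three, hsym 2 0, hsym 2 1]
    ring
  · rw [curl_apply_two]
    simp only [hc, cross_zero_apply, cross_one_apply, affField_apply, matVec_apply,
      PiLp.add_apply, PiLp.sub_apply]
    simp (disch := fun_prop) only [pd_add, pd_sub, pd_const_mul, pd_mul, pd_coord, pd_const]
    simp [curlMat, Matrix.trace, Fin.sum_univ_three, hsym 1 0]
    ring

theorem gradVec_affField (α : E3) (B : Mat3) (x : E3) : gradVec (affField α B) x = B := by
  ext i j; simp [gradVec, pd_affField]

theorem IsGradCurlShape.contDiff {ℓ : ℕ} (hℓ : ℓ = 0 ∨ ℓ = 1) {c : E3} {v : E3 → E3}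
    (hv : IsGradCurlShape ℓ c v) : ContDiff ℝ ∞ v := by
  obtain ⟨α, S, q, Q, rfl, -⟩ := (isGradCurlShape_iff hℓ).1 hv
  exact contDiff_gcField _ _ _ _ _

theorem IsGradCurlShape.exists_curl {ℓ : ℕ} (hℓ : ℓ = 0 ∨ ℓ = 1) {c : E3} {v : E3 → E3}
    (hv : IsGradCurlShape ℓ c v) :
    ∃ (g : E3) (A : Mat3), A.trace = 0 ∧ curl v = affField g A := by
  obtain ⟨α, S, q, Q, rfl, hS, -⟩ := (isGradCurlShape_iff hℓ).1 hv
  exact ⟨_, _, trace_curlMat Q, curl_gcField c α hS q Q⟩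

theorem IsGradCurlShape.sub {ℓ : ℕ} (hℓ : ℓ = 0 ∨ ℓ = 1) {c : E3} {u v : E3 → E3}
    (hu : IsGradCurlShape ℓ c u) (hv : IsGradCurlShape ℓ c v) : IsGradCurlShape ℓ c (u - v) := by
  obtain ⟨α, S, q, Q, rfl, hS, hS0⟩ := (isGradCurlShape_iff hℓ).1 hu
  obtain ⟨α', S', q', Q', rfl, hS', hS0'⟩ := (isGradCurlShape_iff hℓ).1 hv
  refine (isGradCurlShape_iff hℓ).2 ⟨α - α', S - S', q - q', Q - Q', ?_, ?_, ?_⟩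
  · ext1 x
    apply E3_ext <;> simp [gcField, affField_apply, matVec_apply] <;> ring
  · rw [Matrix.transpose_sub, hS, hS']
  · intro h; rw [hS0 h, hS0' h, sub_zero]

/-- A curl-free shape function is a gradient, in particular a Nédélec shape function. -/
theorem IsGradCurlShape.isNedelec_of_curl_eq_zero {ℓ : ℕ} (hℓ : ℓ = 0 ∨ ℓ = 1) {c : E3}
    {v : E3 → E3} (hv : IsGradCurlShape ℓ c v) (h : ∀ x, curl v x = 0) : IsNedelec ℓ v := by
  obtain ⟨α, S, q, Q, rfl, hS, hS0⟩ := (isGradCurlShape_iff hℓ).1 hv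
  rw [curl_gcField c α hS] at h
  have hA : curlMat Q = 0 := by
    rw [← gradVec_affField ((-2 : ℝ) • q - matVec (curlMat Q) c) (curlMat Q) 0,
      show affField ((-2 : ℝ) • q - matVec (curlMat Q) c) (curlMat Q) = fun _ => 0 from funext h]
    ext i j; simp [gradVec, pd]
  -- The curl at x = c equals -2 q.
  have hq : q = 0 := by
    have := h c
    simpa [affField] using this
  -- The linear part of the curl vanishes only for multiples of the identity, and for these y × Q y
  -- = 0. What remains is the gradient part.
  have hQ : Q = (Q.trace / 3) • (1 : Mat3) := by
    have : (3 : ℝ) • Q = Q.trace • 1 := (sub_eq_zero.1 hA).symm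
    rw [div_eq_inv_mul, mul_smul, ← this, smul_smul]
    norm_num
  refine (isNedelec_iff hℓ).2 ⟨α, S, ?_, fun h => by rw [hS0 h]; simp⟩
  ext1 x
  rw [gcField, hq, zero_add, hQ]
  have : matVec ((Q.trace / 3) • (1 : Mat3)) (x - c) = (Q.trace / 3) • (x - c) := by
    apply E3_ext <;> simp [matVec_apply]
  rw [this]
  apply E3_ext <;> simp <;> ring

/-- For a given affine divergence-free field there is a shape function with this curl. -/
theorem exists_shape_of_curl (c : E3) (g : E3) {A : Mat3} (hA : A.trace = 0) :
    ∃ q Q, curl (gcField c 0 0 q Q) = affField g A := by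
  -- Since A is traceless, `curlMat` maps -A/3 to A; then q solves -2 q - A c = g.
  refine ⟨(-(1 / 2) : ℝ) • (g + matVec A c), (-(1 / 3) : ℝ) • A, ?_⟩
  have hQ : curlMat ((-(1 / 3) : ℝ) • A) = A := by
    rw [curlMat, Matrix.trace_smul, hA, smul_smul]; simp
  rw [curl_gcField c 0 (by simp), hQ, smul_smul]
  congr 1
  norm_num

end QuadCurl
end

noncomputable section

namespace QuadCurl

/-! ### Barycentric coordinates -/

section Barycentric

variable {ι : Type*} (p : AffineBasis ι ℝ E3)

/-- The gradient of the barycentric coordinate `λ_i`. -/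
def baryGrad (i : ι) : E3 :=
  (InnerProductSpace.toDual ℝ E3).symm (LinearMap.toContinuousLinearMap (p.coord i).linear)

theorem inner_baryGrad (i : ι) (x : E3) : inner ℝ (baryGrad p i) x = (p.coord i).linear x := by
  rw [baryGrad, InnerProductSpace.toDual_symm_apply]; rfl

theorem inner_baryGrad_sub (i : ι) (x y : E3) :
    inner ℝ (baryGrad p i) (x - y) = p.coord i x - p.coord i y := by
  rw [inner_baryGrad]
  exact (p.coord i).linearMap_vsub x y

theorem coord_eq (i : ι) (x : E3) : p.coord i x = p.coord i 0 + inner ℝ (baryGrad p i) x := by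
  have := inner_baryGrad_sub p i x 0
  rw [sub_zero] at this
  rw [this]; ring

variable [Fintype ι]

theorem sum_inner_baryGrad (v : E3) : ∑ i, inner ℝ (baryGrad p i) v = 0 := by
  have : ∀ i, inner ℝ (baryGrad p i) v = p.coord i v - p.coord i 0 := fun i => by
    rw [coord_eq p i v]; ring
  simp only [this, Finset.sum_sub_distrib, p.sum_coord_apply_eq_one, sub_self]

theorem sum_inner_baryGrad_smul (v : E3) : ∑ i, inner ℝ (baryGrad p i) v • p i = v := by
  have : ∀ i, inner ℝ (baryGrad p i) v = p.coord i v - p.coord i 0 := fun i => by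
    rw [coord_eq p i v]; ring
  simp only [this, sub_smul, Finset.sum_sub_distrib, p.linear_combination_coord_eq_self, sub_zero]

/-- The edges that leave one vertex span the space: w is the combination of the p j - p i with
coefficients grad λ_j · w. -/
theorem eq_zero_of_inner_sub {w : E3} {i : ι} (h : ∀ j, inner ℝ w (p j - p i) = 0) : w = 0 := by
  rw [← inner_self_eq_zero (𝕜 := ℝ)]
  have h1 : w = ∑ j, inner ℝ (baryGrad p j) w • (p j - p i) := by
    simp only [smul_sub, Finset.sum_sub_distrib, ← Finset.sum_smul, sum_inner_baryGrad,
      sum_inner_baryGrad_smul, zero_smul, sub_zero]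
  have h2 : inner ℝ w (∑ j, inner ℝ (baryGrad p j) w • (p j - p i)) = 0 := by
    rw [inner_sum]
    simp [inner_smul_right, h]
  rwa [← h1] at h2

theorem affField_sum (α : E3) (B : Mat3) {w : ι → ℝ} (hw : ∑ i, w i = 1) (q : ι → E3) :
    affField α B (∑ i, w i • q i) = ∑ i, w i • affField α B (q i) := by
  have hlin : matVec B (∑ i, w i • q i) = ∑ i, w i • matVec B (q i) := by
    have h := map_sum ({ toFun := matVec B, map_add' := matVec_add B, map_smul' := matVec_smul B } :
      E3 →ₗ[ℝ] E3) (fun i => w i • q i) Finset.univ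
    simp only [map_smul] at h
    exact h
  simp only [affField, smul_add, Finset.sum_add_distrib, ← Finset.sum_smul, hw, one_smul, hlin]

theorem affField_eq_zero {α : E3} {B : Mat3} (h : ∀ i, affField α B (p i) = 0) :
    affField α B = 0 := by
  ext1 x
  rw [← p.linear_combination_coord_eq_self x, affField_sum _ _ (p.sum_coord_apply_eq_one x)]
  simp [h]

end Barycentric

/-! ### Edge moments -/

/-- The moment `∫ (v · (b - a)) q` over the segment from `a` to `b`, in the parameter `t ∈ [0, 1]`. -/
def edgeMoment (a b : E3) (v : E3 → E3) (q : ℝ → ℝ) : ℝ :=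
  ∫ t in (0 : ℝ)..1, inner ℝ (v (a + t • (b - a))) (b - a) * q t

/-- All moments of `v` of degree at most `ℓ` over the segment from `a` to `b` vanish. -/
def EdgeVanish (ℓ : ℕ) (a b : E3) (v : E3 → E3) : Prop :=
  edgeMoment a b v (fun _ => 1) = 0 ∧ (ℓ = 1 → edgeMoment a b v (fun t => t) = 0)

theorem edgeMoment_sub (a b : E3) {u v : E3 → E3} (hu : Continuous u) (hv : Continuous v)
    {q : ℝ → ℝ} (hq : Continuous q) :
    edgeMoment a b (u - v) q = edgeMoment a b u q - edgeMoment a b v q := by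
  unfold edgeMoment
  rw [← intervalIntegral.integral_sub]
  · congr 1; ext t; simp only [Pi.sub_apply, inner_sub_left]; ring
  · exact Continuous.intervalIntegrable (by fun_prop) _ _
  · exact Continuous.intervalIntegrable (by fun_prop) _ _

theorem edgeMoment_self (a : E3) (v : E3 → E3) (q : ℝ → ℝ) : edgeMoment a a v q = 0 := by
  simp [edgeMoment]

theorem edgeMoment_swap (a b : E3) (v : E3 → E3) (q : ℝ → ℝ) :
    edgeMoment b a v q = -edgeMoment a b v (fun t => q (1 - t)) := by
  unfold edgeMoment
  rw [← intervalIntegral.integral_neg]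
  have h := intervalIntegral.integral_comp_sub_left (a := 0) (b := 1)
    (fun t : ℝ => inner ℝ (v (b + t • (a - b))) (a - b) * q t) 1
  simp only [sub_self, sub_zero] at h
  rw [← h]
  congr 1
  ext t
  have e : b + (1 - t) • (a - b) = a + t • (b - a) := by module
  rw [e, ← neg_sub b a, inner_neg_right]
  ring

theorem edgeMoment_affine_one (k l : ℝ) : ∫ t in (0 : ℝ)..1, (k + t * l) * 1 = k + l / 2 := by
  simp only [mul_one]
  rw [intervalIntegral.integral_add (by simp) (by apply Continuous.intervalIntegrable; fun_prop)]
  simp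
  ring

theorem edgeMoment_affine_id (k l : ℝ) : ∫ t in (0 : ℝ)..1, (k + t * l) * t = k / 2 + l / 3 := by
  have : ∀ t : ℝ, (k + t * l) * t = k * t + l * t ^ 2 := fun t => by ring
  simp only [this]
  rw [intervalIntegral.integral_add (by apply Continuous.intervalIntegrable; fun_prop)
    (by apply Continuous.intervalIntegrable; fun_prop), intervalIntegral.integral_const_mul,
    intervalIntegral.integral_const_mul]
  simp
  norm_num
  ring

theorem inner_affField_segment (α : E3) (B : Mat3) (a d e : E3) (t : ℝ) :
    inner ℝ (affField α B (a + t • d)) e =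
      inner ℝ (affField α B a) e + t * inner ℝ (matVec B d) e := by
  simp only [affField, matVec_add, matVec_smul, inner_add_left, inner_smul_left]
  simp; ring

theorem inner_matVec_self_of_skew {B : Mat3} (hB : B.transpose = -B) (d : E3) :
    inner ℝ (matVec B d) d = 0 := by
  have h := inner_matVec_transpose B d d
  rw [hB] at h
  have h2 : matVec (-B) d = -matVec B d := by apply E3_ext <;> simp [matVec_apply] <;> ring
  rw [h2, inner_neg_right, real_inner_comm] at h
  linarith

/-- A Nédélec shape function whose moments vanish has no tangential component on the edge. -/
theorem IsNedelec.inner_eq_zero {ℓ : ℕ} (hℓ : ℓ = 0 ∨ ℓ = 1) {v : E3 → E3} (hv : IsNedelec ℓ v)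
    {a b : E3} (h : EdgeVanish ℓ a b v) (t : ℝ) :
    inner ℝ (v (a + t • (b - a))) (b - a) = 0 := by
  obtain ⟨α, B, rfl, hB⟩ := (isNedelec_iff hℓ).1 hv
  obtain ⟨h0, h1⟩ := h
  unfold edgeMoment at h0 h1
  simp only [inner_affField_segment] at h0 h1 ⊢
  rw [edgeMoment_affine_one] at h0
  rcases hℓ with rfl | rfl
  -- For ℓ = 0 the tangential component is constant along the edge, because the linear part is skew.
  · have h2 := inner_matVec_self_of_skew (hB rfl) (b - a)
    rw [h2] at h0 ⊢
    linarith
  -- For ℓ = 1 it is k + l t with k + l/2 = 0 and k/2 + l/3 = 0, which forces k = l = 0.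
  · have h2 := h1 rfl
    rw [edgeMoment_affine_id] at h2
    have e1 : inner ℝ (matVec B (b - a)) (b - a) = 0 := by linarith
    have e2 : inner ℝ (affField α B a) (b - a) = 0 := by linarith
    rw [e1, e2]; ring

theorem IsNedelec.inner_left_eq_zero {ℓ : ℕ} (hℓ : ℓ = 0 ∨ ℓ = 1) {v : E3 → E3}
    (hv : IsNedelec ℓ v) {a b : E3} (h : EdgeVanish ℓ a b v) : inner ℝ (v a) (b - a) = 0 := by
  simpa using hv.inner_eq_zero hℓ h 0

/-- The edge moments determine a Nédélec shape function. -/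
theorem IsNedelec.eq_zero {ι : Type*} [Fintype ι] (p : AffineBasis ι ℝ E3) {ℓ : ℕ}
    (hℓ : ℓ = 0 ∨ ℓ = 1) {v : E3 → E3} (hv : IsNedelec ℓ v)
    (h : ∀ i j, EdgeVanish ℓ (p i) (p j) v) : v = 0 := by
  -- At a vertex the components along all edges that start there vanish.
  have h1 : ∀ i, v (p i) = 0 := fun i =>
    eq_zero_of_inner_sub p (i := i) fun j => hv.inner_left_eq_zero hℓ (h i j)
  obtain ⟨α, B, rfl, hB⟩ := (isNedelec_iff hℓ).1 hv
  exact affField_eq_zero p h1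

/-- The linear part of `∑ r_ij λ_i grad λ_j`. -/
def whitneyMat {ι : Type*} [Fintype ι] (p : AffineBasis ι ℝ E3) (r : ι → ι → ℝ) : Mat3 :=
  Matrix.of fun k l => ∑ i, ∑ j, r i j * (baryGrad p j k * baryGrad p i l)

/-- The constant part of `∑ r_ij λ_i grad λ_j`. -/
def whitneyConst {ι : Type*} [Fintype ι] (p : AffineBasis ι ℝ E3) (r : ι → ι → ℝ) : E3 :=
  ∑ i, ∑ j, (r i j * p.coord i 0) • baryGrad p j

theorem affField_whitney {ι : Type*} [Fintype ι] (p : AffineBasis ι ℝ E3) (r : ι → ι → ℝ)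
    (x : E3) : affField (whitneyConst p r) (whitneyMat p r) x =
      ∑ i, ∑ j, (r i j * p.coord i x) • baryGrad p j := by
  have h : matVec (whitneyMat p r) x =
      ∑ i, ∑ j, (r i j * inner ℝ (baryGrad p i) x) • baryGrad p j := by
    have h1 : ∀ k, matVec (whitneyMat p r) x k =
        (∑ i, ∑ j, (r i j * inner ℝ (baryGrad p i) x) • baryGrad p j) k := by
      intro k
      simp only [matVec_apply, whitneyMat, Matrix.of_apply, Finset.sum_mul, WithLp.ofLp_sum,
        Finset.sum_apply, PiLp.smul_apply, smul_eq_mul, inner_eq, ← Finset.sum_add_distrib]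
      refine Finset.sum_congr rfl fun i _ => Finset.sum_congr rfl fun j _ => ?_
      ring
    ext k; exact h1 k
  rw [affField, h, whitneyConst, ← Finset.sum_add_distrib]
  refine Finset.sum_congr rfl fun i _ => ?_
  rw [← Finset.sum_add_distrib]
  refine Finset.sum_congr rfl fun j _ => ?_
  rw [coord_eq p i x]
  module

/-- On the edge from p i to p j only λ_i and λ_j are nonzero, and grad λ_k · (p j - p i) is 1 for k
= j and -1 for k = i when i ≠ j. The tangential component thus interpolates between r i j at p i and
-r j i at p j, so edges can be treated independently. -/
theorem inner_affField_whitney {ι : Type*} [Fintype ι] (p : AffineBasis ι ℝ E3) {r : ι → ι → ℝ}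
    (hr : ∀ i, r i i = 0) (i j : ι) (t : ℝ) :
    inner ℝ (affField (whitneyConst p r) (whitneyMat p r) (p i + t • (p j - p i))) (p j - p i) =
      r i j + t * (-r j i - r i j) := by
  classical
  have hc : ∀ k, p.coord k (p i + t • (p j - p i)) =
      (1 - t) * (if k = i then 1 else 0) + t * (if k = j then 1 else 0) := by
    intro k
    have h1 := inner_baryGrad_sub p k (p j) (p i)
    rw [coord_eq, inner_add_right, ← add_assoc, ← coord_eq, inner_smul_right, h1, p.coord_apply,
      p.coord_apply]
    ring
  rw [affField_whitney, sum_inner]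
  simp only [sum_inner, inner_smul_left, inner_baryGrad_sub, hc, p.coord_apply]
  simp only [RCLike.conj_to_real, mul_add, mul_sub, Finset.sum_add_distrib,
    Finset.sum_sub_distrib, mul_ite, mul_one, mul_zero, zero_mul, Finset.sum_ite_eq',
    Finset.mem_univ, if_true, hr]
  ring

/-- Nédélec shape functions can be prescribed by their edge moments. -/
theorem exists_nedelec {ι : Type*} [Fintype ι] (p : AffineBasis ι ℝ E3) {ℓ : ℕ}
    (hℓ : ℓ = 0 ∨ ℓ = 1) {v : E3 → E3} (hv : Continuous v) :
    ∃ u, IsNedelec ℓ u ∧ ∀ i j, EdgeVanish ℓ (p i) (p j) (u - v) := by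
  have hsw0 : ∀ a b, edgeMoment b a v (fun _ => 1) = -edgeMoment a b v (fun _ => 1) :=
    fun a b => edgeMoment_swap a b v _
  have hsw1 : ∀ a b, edgeMoment b a v (fun t => t) =
      edgeMoment a b v (fun t => t) - edgeMoment a b v (fun _ => 1) := by
    intro a b
    rw [edgeMoment_swap]
    unfold edgeMoment
    rw [← intervalIntegral.integral_sub, ← intervalIntegral.integral_neg]
    · congr 1; ext t; ring
    · exact Continuous.intervalIntegrable (by fun_prop) _ _
    · exact Continuous.intervalIntegrable (by fun_prop) _ _
  rcases hℓ with rfl | rfl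
  -- For ℓ = 0 the coefficients are antisymmetric, which makes the linear part skew and the
  -- tangential component constant.
  · set r : ι → ι → ℝ := fun i j => edgeMoment (p i) (p j) v (fun _ => 1) with hr
    have hr0 : ∀ i, r i i = 0 := fun i => edgeMoment_self _ _ _
    refine ⟨affField (whitneyConst p r) (whitneyMat p r),
      (isNedelec_iff (Or.inl rfl)).2 ⟨_, _, rfl, fun _ => ?_⟩, fun i j => ⟨?_, fun h => by simp at h⟩⟩
    · ext k l
      simp only [whitneyMat, Matrix.transpose_apply, Matrix.of_apply, Matrix.neg_apply]
      rw [Finset.sum_comm, ← Finset.sum_neg_distrib]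
      refine Finset.sum_congr rfl fun i _ => ?_
      rw [← Finset.sum_neg_distrib]
      refine Finset.sum_congr rfl fun j _ => ?_
      simp only [hr, hsw0 (p i) (p j)]
      ring
    · rw [edgeMoment_sub _ _ (contDiff_affField _ _).continuous hv continuous_const, edgeMoment]
      simp only [inner_affField_whitney p hr0]
      rw [edgeMoment_affine_one]
      simp only [hr, hsw0 (p i) (p j)]
      ring
  -- For a tangential component k + l t with moments m0 and m1, the system k + l/2 = m0, k/2 + l/3 =
  -- m1 gives k = 4 m0 - 6 m1. The value k + l at the other end comes from the same formula for the
  -- reversed edge.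
  · set r : ι → ι → ℝ := fun i j => 4 * edgeMoment (p i) (p j) v (fun _ => 1) -
      6 * edgeMoment (p i) (p j) v (fun t => t) with hr
    have hr0 : ∀ i, r i i = 0 := fun i => by simp only [hr, edgeMoment_self]; ring
    refine ⟨affField (whitneyConst p r) (whitneyMat p r),
      (isNedelec_iff (Or.inr rfl)).2 ⟨_, _, rfl, fun h => by simp at h⟩,
      fun i j => ⟨?_, fun _ => ?_⟩⟩
    · rw [edgeMoment_sub _ _ (contDiff_affField _ _).continuous hv continuous_const]
      conv_lhs => enter [1]; rw [edgeMoment]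
      simp only [inner_affField_whitney p hr0]
      rw [edgeMoment_affine_one, hr]
      simp only [hsw0 (p i) (p j), hsw1 (p i) (p j)]
      ring
    · rw [edgeMoment_sub _ _ (contDiff_affField _ _).continuous hv continuous_id']
      conv_lhs => enter [1]; rw [edgeMoment]
      simp only [inner_affField_whitney p hr0]
      rw [edgeMoment_affine_id, hr]
      simp only [hsw0 (p i) (p j), hsw1 (p i) (p j)]
      ring

end QuadCurl
end

noncomputable section

namespace QuadCurl

/-! ### Integrals over triangles and tetrahedra -/

theorem affineIndependent_of_mem {s : Finset E3} (hs : AffineIndependent ℝ ((↑) : s → E3)) {n : ℕ}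
    {p : Fin n → E3} (hp : Function.Injective p) (hm : ∀ i, p i ∈ s) : AffineIndependent ℝ p :=
  hs.comp_embedding ⟨fun i => (⟨p i, hm i⟩ : s), fun _ _ h => hp (congrArg Subtype.val h)⟩

theorem range_three (a b c : E3) : Set.range ![a, b, c] = {a, b, c} := by
  ext x; simp [eq_comm]; tauto

theorem range_four (a b c d : E3) : Set.range ![a, b, c, d] = {a, b, c, d} := by
  ext x; simp [eq_comm]; tauto

theorem range_two (a b : E3) : Set.range ![a, b] = {a, b} := by
  ext x; simp [eq_comm]; tauto

theorem injective_three {a b c : E3} (hab : a ≠ b) (hac : a ≠ c) (hbc : b ≠ c) :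
    Function.Injective ![a, b, c] := by
  intro i j h
  fin_cases i <;> fin_cases j <;> simp_all [eq_comm]

theorem injective_four {a b c d : E3} (hab : a ≠ b) (hac : a ≠ c) (had : a ≠ d) (hbc : b ≠ c)
    (hbd : b ≠ d) (hcd : c ≠ d) : Function.Injective ![a, b, c, d] := by
  intro i j h
  fin_cases i <;> fin_cases j <;> simp_all [eq_comm]

theorem setIntegral_segment {G : Type*} [NormedAddCommGroup G] [NormedSpace ℝ G] {a b : E3}
    (h : a ≠ b) (φ : E3 → G) : ∫ x in convexHull ℝ {a, b}, φ x ∂μHE[1] =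
      ‖b - a‖ • ∫ t in (0 : ℝ)..1, φ (a + t • (b - a)) := by
  have hi : AffineIndependent ℝ ![a, b] := affineIndependent_of_ne ℝ h
  rw [← range_two, setIntegral_convexHull hi, simplexVol_edge, cornerInt_edge]

theorem setIntegral_triangle {G : Type*} [NormedAddCommGroup G] [NormedSpace ℝ G] {a b c : E3}
    (h : AffineIndependent ℝ ![a, b, c]) (φ : E3 → G) :
    ∫ x in convexHull ℝ {a, b, c}, φ x ∂μHE[2] =
      ‖cross (b - a) (c - a)‖ • cornerInt ![a, b, c] φ := by
  rw [← range_three, setIntegral_convexHull h, simplexVol_triangle]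

theorem norm_cross_pos {a b c : E3} (h : AffineIndependent ℝ ![a, b, c]) :
    0 < ‖cross (b - a) (c - a)‖ := by
  rw [← simplexVol_triangle]; exact simplexVol_pos h

theorem cornerInt_const_triangle (a b c : E3) (k : ℝ) :
    cornerInt ![a, b, c] (fun _ => k) = k / 2 := by
  have := cornerInt_triangle_affine a b c k 0
  simp only [inner_zero_left, add_zero] at this
  rw [this]; ring

theorem area_triangle {a b c : E3} (h : AffineIndependent ℝ ![a, b, c]) :
    (μHE[2] : Measure E3).real (convexHull ℝ {a, b, c}) = ‖cross (b - a) (c - a)‖ / 2 := by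
  have h1 := setIntegral_triangle h (fun _ => (1 : ℝ))
  rw [setIntegral_const, cornerInt_const_triangle] at h1
  simp only [smul_eq_mul, mul_one] at h1
  rw [h1]; ring

/-! ### Face averages and Stokes' theorem -/

/-- The average of `φ` over the triangle with vertex set `F`. -/
def faceAvg (F : Finset E3) (φ : E3 → ℝ) : ℝ := ⨍ x in convexHull ℝ (F : Set E3), φ x ∂μHE[2]

open scoped Classical in
theorem faceAvg_eq_cornerInt {a b c : E3} (h : AffineIndependent ℝ ![a, b, c]) (φ : E3 → ℝ) :
    faceAvg {a, b, c} φ = 2 * cornerInt ![a, b, c] φ := by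
  have hs : (({a, b, c} : Finset E3) : Set E3) = {a, b, c} := by simp
  rw [faceAvg, hs, setAverage_eq, area_triangle h, setIntegral_triangle h]
  have := norm_cross_pos h
  simp only [smul_eq_mul]
  field_simp

theorem affineIndependent_swap {a b c : E3} (h : AffineIndependent ℝ ![a, b, c]) :
    AffineIndependent ℝ ![a, c, b] := by
  have := h.comp_embedding (Equiv.swap (1 : Fin 3) 2).toEmbedding
  convert this using 1
  ext i : 1
  fin_cases i <;> rfl

/-- Both orders compute the same face average, and this depends only on the vertex set. -/
theorem cornerInt_swap {a b c : E3} (h : AffineIndependent ℝ ![a, b, c]) (φ : E3 → ℝ) :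
    cornerInt ![a, c, b] φ = cornerInt ![a, b, c] φ := by
  classical
  have h1 := faceAvg_eq_cornerInt h φ
  have h2 := faceAvg_eq_cornerInt (affineIndependent_swap h) φ
  have h3 : ({a, b, c} : Finset E3) = {a, c, b} := by ext; simp; tauto
  rw [h3, h2] at h1
  linarith

theorem cornerInt_sub {n : ℕ} (p : Fin (n + 1) → E3) {φ ψ : E3 → ℝ} (hφ : Continuous φ)
    (hψ : Continuous ψ) : cornerInt p (fun x => φ x - ψ x) = cornerInt p φ - cornerInt p ψ := by
  unfold cornerInt
  exact integral_sub (integrableOn_corner (hφ.comp (continuous_simplexMap p)))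
    (integrableOn_corner (hψ.comp (continuous_simplexMap p)))

theorem contDiff_inner_const {v : E3 → E3} {n : WithTop ℕ∞} (hv : ContDiff ℝ n v) (b : E3) :
    ContDiff ℝ n fun x => inner ℝ (v x) b :=
  hv.inner ℝ contDiff_const

/-- Stokes' theorem on a triangle. -/
theorem stokes_triangle {a b c : E3} (h : AffineIndependent ℝ ![a, b, c]) {v : E3 → E3}
    (hv : ContDiff ℝ 1 v) :
    cornerInt ![a, b, c] (fun x => inner ℝ (curl v x) (cross (b - a) (c - a))) =
      edgeMoment a b v (fun _ => 1) + edgeMoment b c v (fun _ => 1) +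
        edgeMoment c a v (fun _ => 1) := by
  have hd : ∀ x, DifferentiableAt ℝ v x := fun x => hv.differentiable one_ne_zero x
  -- The curl component along (b - a) × (c - a) is a difference of two directional derivatives, each
  -- along an edge that starts at a. Each is integrated along its own direction; the second needs b
  -- and c exchanged.
  have h1 := cornerInt_fderiv ![a, b, c] (contDiff_inner_const hv (c - a))
  have h2 := cornerInt_fderiv ![a, c, b] (contDiff_inner_const hv (b - a))
  have e1 : (fun i : Fin 2 => ![a, b, c] i.succ) = ![b, c] := by ext i : 1; fin_cases i <;> rfl
  have e2 : (fun i : Fin 2 => ![a, b, c] ((1 : Fin 3).succAbove i)) = ![a, c] := by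
    ext i : 1; fin_cases i <;> rfl
  have e3 : (fun i : Fin 2 => ![a, c, b] i.succ) = ![c, b] := by ext i : 1; fin_cases i <;> rfl
  have e4 : (fun i : Fin 2 => ![a, c, b] ((1 : Fin 3).succAbove i)) = ![a, b] := by
    ext i : 1; fin_cases i <;> rfl
  rw [e1, e2] at h1
  rw [e3, e4, cornerInt_swap h] at h2
  simp only [Matrix.cons_val_one, Matrix.cons_val_zero, cornerInt_edge] at h1 h2
  have hc : ∀ d e : E3, Continuous fun x => fderiv ℝ (fun y => inner ℝ (v y) d) x e := fun d e =>
    ((contDiff_inner_const hv d).continuous_fderiv one_ne_zero).clm_apply continuous_const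
  simp only [← inner_curl_cross (hd _)]
  rw [cornerInt_sub _ (hc _ _) (hc _ _), h1, h2, edgeMoment_swap a c, edgeMoment]
  have hvc := hv.continuous
  have hii : ∀ x y d : E3, IntervalIntegrable (fun t : ℝ => inner ℝ (v (x + t • (y - x))) d)
      volume 0 1 := fun x y d => Continuous.intervalIntegrable (by fun_prop) _ _
  have e5 : ∫ t in (0 : ℝ)..1, inner ℝ (v (c + t • (b - c))) (b - a) =
      ∫ t in (0 : ℝ)..1, inner ℝ (v (b + t • (c - b))) (b - a) := by
    have h := intervalIntegral.integral_comp_sub_left (a := 0) (b := 1)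
      (fun t : ℝ => inner ℝ (v (c + t • (b - c))) (b - a)) 1
    simp only [sub_self, sub_zero] at h
    rw [← h]
    congr 1; ext t
    have e : c + (1 - t) • (b - c) = b + t • (c - b) := by module
    rw [e]
  -- The two contributions on the edge bc combine because c - b = (c - a) - (b - a).
  have e6 : edgeMoment b c v (fun _ => 1) =
      (∫ t in (0 : ℝ)..1, inner ℝ (v (b + t • (c - b))) (c - a)) -
        ∫ t in (0 : ℝ)..1, inner ℝ (v (b + t • (c - b))) (b - a) := by
    rw [← intervalIntegral.integral_sub (hii _ _ _) (hii _ _ _), edgeMoment]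
    congr 1; ext t
    rw [← inner_sub_right, mul_one]
    congr 1; abel
  rw [e5, e6, edgeMoment]
  simp only [mul_one]
  ring

theorem volume_eq_euclideanHausdorff : (volume : Measure E3) = μHE[3] :=
  (EuclideanSpace.euclideanHausdorffMeasure_eq_volume 3).symm

theorem setIntegral_tet {a b c d : E3} (h : AffineIndependent ℝ ![a, b, c, d]) (φ : E3 → ℝ) :
    ∫ x in convexHull ℝ {a, b, c, d}, φ x =
      |inner ℝ (cross (b - a) (c - a)) (d - a)| * cornerInt ![a, b, c, d] φ := by
  rw [volume_eq_euclideanHausdorff, ← range_four, setIntegral_convexHull h, simplexVol_tet]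
  rfl

theorem volume_tet {a b c d : E3} (h : AffineIndependent ℝ ![a, b, c, d]) :
    (volume : Measure E3).real (convexHull ℝ {a, b, c, d}) =
      |inner ℝ (cross (b - a) (c - a)) (d - a)| / 6 := by
  have h1 := setIntegral_tet h (fun _ => (1 : ℝ))
  have h2 : cornerInt ![a, b, c, d] (fun _ => (1 : ℝ)) = 1 / 6 := setIntegral_corner_three_one
  rw [setIntegral_const, h2] at h1
  simp only [smul_eq_mul, mul_one] at h1
  rw [h1]; ring

theorem exists_four {T : Finset E3} (hT : T.card = 4) {x y : E3} (hx : x ∈ T) (hy : y ∈ T)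
    (hxy : x ≠ y) : ∃ u v, x ≠ u ∧ x ≠ v ∧ y ≠ u ∧ y ≠ v ∧ u ≠ v ∧ ∀ z, z ∈ T ↔
      z = x ∨ z = y ∨ z = u ∨ z = v := by
  classical
  have h1 : ((T.erase x).erase y).card = 2 := by
    rw [Finset.card_erase_of_mem (Finset.mem_erase.2 ⟨hxy.symm, hy⟩), Finset.card_erase_of_mem hx, hT]
  obtain ⟨u, v, huv, h2⟩ := Finset.card_eq_two.1 h1
  have hu : u ∈ (T.erase x).erase y := by rw [h2]; simp
  have hv : v ∈ (T.erase x).erase y := by rw [h2]; simp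
  simp only [Finset.mem_erase] at hu hv
  refine ⟨u, v, hu.2.1.symm, hv.2.1.symm, hu.1.symm, hv.1.symm, huv, fun z => ?_⟩
  have h3 := Finset.ext_iff.1 h2 z
  simp only [Finset.mem_erase, Finset.mem_insert, Finset.mem_singleton] at h3
  constructor
  · intro hz
    by_cases hzx : z = x
    · exact Or.inl hzx
    · by_cases hzy : z = y
      · exact Or.inr (Or.inl hzy)
      · exact Or.inr (Or.inr (h3.1 ⟨hzy, hzx, hz⟩))
  · rintro (rfl | rfl | h)
    · exact hx
    · exact hy
    · exact (h3.2 h).2.2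

/-! ### Integration over a tetrahedron and its faces -/

open scoped Classical in
/-- The integral over a tetrahedron of the derivative along the edge from `y` to `x`. -/
theorem setIntegral_fderiv_edge {T : Finset E3} (hT : T.card = 4)
    (hi : AffineIndependent ℝ ((↑) : T → E3)) {x y : E3} (hx : x ∈ T) (hy : y ∈ T) {φ : E3 → ℝ}
    (hφ : ContDiff ℝ 1 φ) :
    ∫ z in convexHull ℝ (T : Set E3), fderiv ℝ φ z (x - y) =
      3 * (volume : Measure E3).real (convexHull ℝ (T : Set E3)) *
        (faceAvg (T.erase y) φ - faceAvg (T.erase x) φ) := by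
  by_cases hxy : x = y
  · subst hxy; simp
  obtain ⟨u, v, hxu, hxv, hyu, hyv, huv, hm⟩ := exists_four hT hx hy hxy
  have hT' : (T : Set E3) = {y, x, u, v} := by
    ext z; simp only [Finset.mem_coe, hm, Set.mem_insert_iff, Set.mem_singleton_iff]; tauto
  have hTy : T.erase y = {x, u, v} := by
    ext z
    simp only [Finset.mem_erase, hm, Finset.mem_insert, Finset.mem_singleton]
    constructor
    · tauto
    · rintro (rfl | rfl | rfl) <;> simp_all [eq_comm]
  have hTx : T.erase x = {y, u, v} := by
    ext z
    simp only [Finset.mem_erase, hm, Finset.mem_insert, Finset.mem_singleton]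
    constructor
    · tauto
    · rintro (rfl | rfl | rfl) <;> simp_all [eq_comm]
  have hmx : ∀ z, z = y ∨ z = x ∨ z = u ∨ z = v → z ∈ T := fun z hz => (hm z).2 (by tauto)
  have i4 : AffineIndependent ℝ ![y, x, u, v] := affineIndependent_of_mem hi
    (injective_four (Ne.symm hxy) hyu hyv hxu hxv huv)
    (fun i => by fin_cases i <;> exact hmx _ (by simp))
  have i3 : AffineIndependent ℝ ![x, u, v] := affineIndependent_of_mem hi
    (injective_three hxu hxv huv) (fun i => by fin_cases i <;> exact hmx _ (by simp))
  have i3' : AffineIndependent ℝ ![y, u, v] := affineIndependent_of_mem hi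
    (injective_three hyu hyv huv) (fun i => by fin_cases i <;> exact hmx _ (by simp))
  -- The triple product is 6 times the volume and a face average is 2 times a corner integral, which
  -- leaves the factor 3.
  rw [hT', volume_tet i4, setIntegral_tet i4, hTy, hTx, faceAvg_eq_cornerInt i3,
    faceAvg_eq_cornerInt i3']
  have h1 := cornerInt_fderiv ![y, x, u, v] hφ
  have e1 : (fun i : Fin 3 => ![y, x, u, v] i.succ) = ![x, u, v] := by
    ext i : 1; fin_cases i <;> rfl
  have e2 : (fun i : Fin 3 => ![y, x, u, v] ((1 : Fin 4).succAbove i)) = ![y, u, v] := by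
    ext i : 1; fin_cases i <;> rfl
  rw [e1, e2] at h1
  simp only [Matrix.cons_val_one, Matrix.cons_val_zero] at h1
  rw [h1]
  ring

/-- The affine basis of `ℝ³` given by the vertices of a tetrahedron. -/
def tetBasis {T : Finset E3} (hT : T.card = 4) (hi : AffineIndependent ℝ ((↑) : T → E3)) :
    AffineBasis T ℝ E3 :=
  ⟨(↑), hi, hi.affineSpan_eq_top_iff_card_eq_finrank_add_one.2 (by simp [hT])⟩

theorem isCompact_hull (T : Finset E3) : IsCompact (convexHull ℝ (T : Set E3)) :=
  T.finite_toSet.isCompact_convexHull (𝕜 := ℝ)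

theorem integrableOn_hull (T : Finset E3) {G : Type*} [NormedAddCommGroup G] {φ : E3 → G}
    (hφ : Continuous φ) : IntegrableOn φ (convexHull ℝ (T : Set E3)) :=
  hφ.continuousOn.integrableOn_compact (isCompact_hull T)

open scoped Classical in
/-- The integral of a directional derivative over a tetrahedron. -/
theorem setIntegral_fderiv_tet {T : Finset E3} (hT : T.card = 4)
    (hi : AffineIndependent ℝ ((↑) : T → E3)) (v : E3) {φ : E3 → ℝ} (hφ : ContDiff ℝ 1 φ) :
    ∫ z in convexHull ℝ (T : Set E3), fderiv ℝ φ z v =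
      ∑ x : T, -(3 * (volume : Measure E3).real (convexHull ℝ (T : Set E3))) *
        inner ℝ (baryGrad (tetBasis hT hi) x) v * faceAvg (T.erase x) φ := by
  set p := tetBasis hT hi with hp
  obtain ⟨x₀, hx₀⟩ : T.Nonempty := Finset.card_pos.1 (by omega)
  -- The direction is decomposed along the edges from one vertex x₀. The averages over the face
  -- opposite to x₀ cancel in the end, since the barycentric gradients sum to zero.
  have hv : v = ∑ x : T, inner ℝ (baryGrad p x) v • ((x : E3) - x₀) := by
    have h1 := sum_inner_baryGrad_smul p v
    have h2 := sum_inner_baryGrad p v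
    simp only [smul_sub, Finset.sum_sub_distrib, ← Finset.sum_smul, h2, zero_smul, sub_zero]
    exact h1.symm
  have hc : ∀ d : E3, Continuous fun z => fderiv ℝ φ z d := fun d =>
    (hφ.continuous_fderiv one_ne_zero).clm_apply continuous_const
  have h1 : ∀ z, fderiv ℝ φ z v =
      ∑ x : T, inner ℝ (baryGrad p x) v * fderiv ℝ φ z ((x : E3) - x₀) := by
    intro z
    conv_lhs => rw [hv]
    rw [map_sum]
    simp
  simp only [h1]
  rw [integral_finsetSum _ fun x _ => (integrableOn_hull T (hc _)).const_mul _]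
  simp only [integral_const_mul]
  have h2 : ∀ x : T, inner ℝ (baryGrad p x) v *
      ∫ z in convexHull ℝ (T : Set E3), fderiv ℝ φ z ((x : E3) - x₀) =
      inner ℝ (baryGrad p x) v * (3 * (volume : Measure E3).real (convexHull ℝ (T : Set E3)) *
        faceAvg (T.erase x₀) φ) -
      inner ℝ (baryGrad p x) v * (3 * (volume : Measure E3).real (convexHull ℝ (T : Set E3)) *
        faceAvg (T.erase x) φ) := by
    intro x
    rw [setIntegral_fderiv_edge hT hi x.2 hx₀ hφ]; ring
  simp only [h2, Finset.sum_sub_distrib, ← Finset.sum_mul, sum_inner_baryGrad, zero_mul, zero_sub]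
  rw [← Finset.sum_neg_distrib]
  refine Finset.sum_congr rfl fun x _ => ?_
  ring

end QuadCurl
end

noncomputable section

namespace QuadCurl

namespace TetMesh

variable {Ω : Set E3} {M : TetMesh Ω}

/-! ### Cells, faces and edges -/

theorem Simp.ext {n : ℕ} {s t : M.Simp n} (h : s.1 = t.1) : s = t := Subtype.ext h

theorem Simp.indep {n : ℕ} (s : M.Simp n) : AffineIndependent ℝ ((↑) : s.1 → E3) :=
  M.cplx.indep s.2.1

/-- The vertices of a cell as an affine basis. -/
def Simp.basis (T : M.Cell) : AffineBasis T.1 ℝ E3 := tetBasis T.2.2 T.indep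

@[simp] theorem Simp.basis_apply (T : M.Cell) (x : T.1) : T.basis x = x := rfl

open scoped Classical in
/-- The face of `T` opposite to the vertex `x`. -/
def faceOpp (T : M.Cell) (x : T.1) : M.Face :=
  ⟨T.1.erase x, by
    have hc : (T.1.erase x).card = 3 := by rw [Finset.card_erase_of_mem x.2, T.2.2]
    exact ⟨M.cplx.down_closed T.2.1 (Finset.erase_subset _ _) (Finset.card_pos.1 (by omega)), hc⟩⟩

open scoped Classical in
theorem faceOpp_val (T : M.Cell) (x : T.1) : (faceOpp T x).1 = T.1.erase x := rfl

theorem faceOpp_isSub (T : M.Cell) (x : T.1) : (faceOpp T x).IsSub T := Finset.erase_subset _ _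

theorem exists_faceOpp {T : M.Cell} {F : M.Face} (h : F.IsSub T) : ∃ x, F = faceOpp T x := by
  classical
  have h1 : (T.1 \ F.1).card = 1 := by
    rw [Finset.card_sdiff_of_subset h, T.2.2, F.2.2]
  obtain ⟨x, hx⟩ := Finset.card_eq_one.1 h1
  have hx' : x ∈ T.1 \ F.1 := by rw [hx]; simp
  rw [Finset.mem_sdiff] at hx'
  refine ⟨⟨x, hx'.1⟩, Simp.ext ?_⟩
  refine Finset.eq_of_subset_of_card_le ?_ ?_
  · intro y hy
    exact Finset.mem_erase.2 ⟨fun h' => hx'.2 (Eq.mp (congrArg (· ∈ F.1) h') hy), h hy⟩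
  · rw [faceOpp_val, Finset.card_erase_of_mem hx'.1, T.2.2, F.2.2]

theorem faceOpp_injective (T : M.Cell) : Function.Injective (faceOpp T) := by
  classical
  intro x y h
  by_contra hne
  have h1 : (y : E3) ∈ (faceOpp T x).1 :=
    Finset.mem_erase.2 ⟨fun h' => hne (Subtype.ext h'.symm), y.2⟩
  rw [h] at h1
  exact (Finset.mem_erase.1 h1).1 rfl

open scoped Classical in
theorem sum_faces {G : Type*} [AddCommMonoid G] (T : M.Cell) (f : M.Face → G) :
    ∑ F : M.Face with F.IsSub T, f F = ∑ x : T.1, f (faceOpp T x) := by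
  symm
  refine Finset.sum_bij (fun x _ => faceOpp T x) (fun x _ => ?_) (fun x _ y _ h => ?_)
    (fun F hF => ?_) (fun x _ => rfl)
  · simp [faceOpp_isSub]
  · exact faceOpp_injective T h
  · obtain ⟨x, hx⟩ := exists_faceOpp (Finset.mem_filter.1 hF).2
    exact ⟨x, Finset.mem_univ _, hx.symm⟩

theorem exists_three (F : M.Face) : ∃ a b c : E3, a ∈ F.1 ∧ b ∈ F.1 ∧ c ∈ F.1 ∧
    (∀ z, z ∈ F.1 ↔ z = a ∨ z = b ∨ z = c) ∧ (F.1 : Set E3) = {a, b, c} ∧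
    AffineIndependent ℝ ![a, b, c] := by
  classical
  obtain ⟨a, b, c, hab, hac, hbc, h⟩ := Finset.card_eq_three.1 F.2.2
  have hm : ∀ z, z ∈ F.1 ↔ z = a ∨ z = b ∨ z = c := fun z => by rw [h]; simp
  refine ⟨a, b, c, by simp [hm], by simp [hm], by simp [hm], hm, by rw [h]; simp, ?_⟩
  exact affineIndependent_of_mem F.indep (injective_three hab hac hbc)
    (fun i => by fin_cases i <;> simp [hm])

/-! ### Areas, outward normals and the divergence theorem -/

/-- The area of a face. -/
def area (F : M.Face) : ℝ := (μHE[2] : Measure E3).real F.hull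

theorem area_pos (F : M.Face) : 0 < area F := by
  obtain ⟨a, b, c, -, -, -, -, h, hi⟩ := exists_three F
  rw [area, Simp.hull, h, area_triangle hi]
  have := norm_cross_pos hi
  positivity

theorem isCompact_simp_hull {n : ℕ} (s : M.Simp n) : IsCompact s.hull := isCompact_hull s.1

theorem measurableSet_hull {n : ℕ} (s : M.Simp n) : MeasurableSet s.hull :=
  (isCompact_simp_hull s).measurableSet

theorem integrableOn_face (F : M.Face) {G : Type*} [NormedAddCommGroup G]
    {φ : E3 → G} (hφ : Continuous φ) : IntegrableOn φ F.hull μHE[2] := by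
  -- An infinite measure would have real value 0, against the positivity of the area.
  have hfin : (μHE[2] : Measure E3) F.hull ≠ ⊤ := by
    intro h
    have h1 := area_pos F
    rw [area, Measure.real, h] at h1
    simp at h1
  obtain ⟨C, hC⟩ := (isCompact_simp_hull F).exists_bound_of_continuousOn hφ.continuousOn
  have : IsFiniteMeasure ((μHE[2] : Measure E3).restrict F.hull) :=
    ⟨by rw [Measure.restrict_apply_univ]; exact lt_top_iff_ne_top.2 hfin⟩
  exact ⟨hφ.continuousOn.aestronglyMeasurable_of_isCompact (isCompact_simp_hull F)
      (measurableSet_hull F),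
    HasFiniteIntegral.of_bounded ((ae_restrict_mem (measurableSet_hull F)).mono fun x hx => hC x hx)⟩

theorem faceAvg_eq (F : M.Face) (φ : E3 → ℝ) :
    faceAvg F.1 φ = (area F)⁻¹ * ∫ x in F.hull, φ x ∂μHE[2] := by
  rw [faceAvg, setAverage_eq]; rfl

theorem integral_face_eq (F : M.Face) (φ : E3 → ℝ) :
    ∫ x in F.hull, φ x ∂μHE[2] = area F * faceAvg F.1 φ := by
  rw [faceAvg_eq, mul_inv_cancel_left₀ (area_pos F).ne']

theorem nF_orth (F : M.Face) {x y : E3} (hx : x ∈ F.1) (hy : y ∈ F.1) :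
    inner ℝ (nF F) (x - y) = 0 := M.normal_orth F.1 F.2.1 F.2.2 x hx y hy

theorem norm_nF (F : M.Face) : ‖nF F‖ = 1 := M.norm_normal F.1 F.2.1 F.2.2

theorem inner_nF_self (F : M.Face) : inner ℝ (nF F) (nF F) = 1 := by
  rw [real_inner_self_eq_norm_sq, norm_nF]; norm_num

theorem cross_eq_smul_nF (F : M.Face) {a b c : E3} (ha : a ∈ F.1) (hb : b ∈ F.1) (hc : c ∈ F.1) :
    cross (b - a) (c - a) = inner ℝ (nF F) (cross (b - a) (c - a)) • nF F := by
  have h1 : cross (nF F) (cross (b - a) (c - a)) = 0 := by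
    rw [cross_cross_eq, nF_orth F hc ha, nF_orth F hb ha]; simp
  have h2 := cross_cross_eq (nF F) (nF F) (cross (b - a) (c - a))
  rw [h1, inner_nF_self, one_smul] at h2
  have h3 : cross (nF F) 0 = 0 := by apply E3_ext <;> simp
  rw [h3] at h2
  exact (sub_eq_zero.1 h2.symm).symm

/-- All vertices of T other than x lie in the plane of the face, so the case distinction in `sgn` is
decided by x alone. Hence `nOut` points away from x. -/
theorem sgn_mul_inner (T : M.Cell) (x : T.1) {a : E3} (ha : a ∈ (faceOpp T x).1) :
    sgn T (faceOpp T x) * inner ℝ (nF (faceOpp T x)) (x - a) =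
      -|inner ℝ (nF (faceOpp T x)) (x - a)| := by
  classical
  unfold sgn
  split_ifs with h
  · rw [one_mul, abs_of_nonpos (h x x.2 a ha), neg_neg]
  · have h1 : 0 < inner ℝ (nF (faceOpp T x)) (x - a) := by
      by_contra hneg
      apply h
      intro z hz y hy
      by_cases hzx : z = x
      · subst hzx
        have e : (x : E3) - y = (x - a) + (a - y) := by abel
        rw [e, inner_add_right, nF_orth _ ha hy, add_zero]
        exact not_lt.1 hneg
      · rw [nF_orth _ (Finset.mem_erase.2 ⟨hzx, hz⟩) hy]
    rw [abs_of_pos h1]; ring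

theorem sgn_mul_self (T : M.Cell) (F : M.Face) : sgn T F * sgn T F = 1 := by
  classical
  unfold sgn; split_ifs <;> norm_num

/-- The volume of a cell. -/
def vol (T : M.Cell) : ℝ := (volume : Measure E3).real T.hull

/-- The outward area vector of a face in terms of the gradient of a barycentric coordinate. -/
theorem area_smul_nOut (T : M.Cell) (x : T.1) :
    area (faceOpp T x) • nOut T (faceOpp T x) = -(3 * vol T) • baryGrad T.basis x := by
  classical
  set F := faceOpp T x with hF
  obtain ⟨a, b, c, ha, hb, hc, hm, hset, hi⟩ := exists_three F
  have hxF : (x : E3) ∉ F.1 := by rw [hF, faceOpp_val]; simp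
  have hne : ∀ z, z ∈ F.1 → z ≠ x := fun z hz h => hxF (h ▸ hz)
  have hsub : ∀ z, z ∈ F.1 → z ∈ T.1 := fun z hz => faceOpp_isSub T x hz
  have hT : (T.1 : Set E3) = {a, b, c, (x : E3)} := by
    ext z
    simp only [Finset.mem_coe, Set.mem_insert_iff, Set.mem_singleton_iff]
    constructor
    · intro hz
      by_cases h : z = x
      · simp [h]
      · have := (hm z).1 (Finset.mem_erase.2 ⟨h, hz⟩); tauto
    · rintro (rfl | rfl | rfl | rfl)
      exacts [hsub _ ha, hsub _ hb, hsub _ hc, x.2]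
  have hinj := hi.injective
  have hab : a ≠ b := fun h => by
    have := @hinj 0 1 (by simpa using h); simp at this
  have hac : a ≠ c := fun h => by
    have := @hinj 0 2 (by simpa using h); simp at this
  have hbc : b ≠ c := fun h => by
    have := @hinj 1 2 (by simpa using h); simp at this
  have i4 : AffineIndependent ℝ ![a, b, c, (x : E3)] := affineIndependent_of_mem T.indep
    (injective_four hab hac (hne a ha) hbc (hne b hb) (hne c hc))
    (fun i => by fin_cases i; exacts [hsub _ ha, hsub _ hb, hsub _ hc, x.2])
  have hV : vol T = |inner ℝ (cross (b - a) (c - a)) (x - a)| / 6 := by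
    rw [vol, Simp.hull, hT, volume_tet i4]
  have hA : area F = ‖cross (b - a) (c - a)‖ / 2 := by
    rw [area, Simp.hull, hset, area_triangle hi]
  have hC := cross_eq_smul_nF F ha hb hc
  set k := inner ℝ (nF F) (cross (b - a) (c - a)) with hk
  have hnorm : ‖cross (b - a) (c - a)‖ = |k| := by
    rw [hC, norm_smul, norm_nF, mul_one, Real.norm_eq_abs]
  have hin : |inner ℝ (cross (b - a) (c - a)) (x - a)| = |k| * |inner ℝ (nF F) (x - a)| := by
    rw [hC, inner_smul_left, abs_mul]; rfl
  rw [← sub_eq_zero]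
  have hg : ∀ y z : T.1, inner ℝ (baryGrad T.basis x) ((y : E3) - z) =
      (if x = y then 1 else 0) - (if x = z then 1 else 0) := fun y z => by
    rw [← T.basis.coord_apply, ← T.basis.coord_apply]
    exact inner_baryGrad_sub T.basis x y z
  -- Both vectors are tested against the edges from the vertex a of F. Only the edge to x gives
  -- something nonzero, and there the claim is that the volume is one third of area times height.
  refine eq_zero_of_inner_sub T.basis (i := ⟨a, hsub a ha⟩) fun j => ?_
  simp only [Simp.basis_apply, inner_sub_left, inner_smul_left]
  have hga := hg j ⟨a, hsub a ha⟩
  rw [if_neg (fun h : x = ⟨a, hsub a ha⟩ => hne a ha (congrArg Subtype.val h).symm), sub_zero] at hga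
  rw [show inner ℝ (baryGrad T.basis x) ((j : E3) - a) = _ from hga]
  by_cases hj : x = j
  · subst hj
    rw [if_pos rfl, nOut, inner_smul_left]
    have hs := sgn_mul_inner T x ha
    simp only [RCLike.conj_to_real]
    rw [hs, hA, hV, hin, hnorm]
    ring
  · rw [if_neg hj, nOut, inner_smul_left,
      nF_orth F (Finset.mem_erase.2 ⟨fun h => hj (Subtype.ext h.symm), j.2⟩) ha]
    simp

theorem faceAvg_add (F : M.Face) {φ ψ : E3 → ℝ} (hφ : Continuous φ) (hψ : Continuous ψ) :
    faceAvg F.1 (fun x => φ x + ψ x) = faceAvg F.1 φ + faceAvg F.1 ψ := by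
  simp only [faceAvg_eq]
  rw [integral_add (integrableOn_face F hφ) (integrableOn_face F hψ), mul_add]

theorem faceAvg_const_mul (F : M.Face) (k : ℝ) (φ : E3 → ℝ) :
    faceAvg F.1 (fun x => k * φ x) = k * faceAvg F.1 φ := by
  simp only [faceAvg_eq]
  rw [integral_const_mul]; ring

theorem faceAvg_inner (F : M.Face) (l : E3) {X : E3 → E3} (hX : Continuous X) :
    faceAvg F.1 (fun x => inner ℝ l (X x)) = l 0 * faceAvg F.1 (fun x => X x 0) +
      l 1 * faceAvg F.1 (fun x => X x 1) + l 2 * faceAvg F.1 (fun x => X x 2) := by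
  simp only [inner_eq]
  rw [faceAvg_add F (by fun_prop) (by fun_prop), faceAvg_add F (by fun_prop) (by fun_prop),
    faceAvg_const_mul, faceAvg_const_mul, faceAvg_const_mul]

open scoped Classical in
/-- The divergence theorem on a cell. -/
theorem integral_divVec_cell (T : M.Cell) {X : E3 → E3} (hX : ContDiff ℝ 1 X) :
    ∫ x in T.hull, divVec X x =
      ∑ F : M.Face with F.IsSub T, ∫ x in F.hull, inner ℝ (nOut T F) (X x) ∂μHE[2] := by
  have hX' := contDiff_coord hX
  have hc : ∀ i, IntegrableOn (pd i fun y => X y i) T.hull := fun i =>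
    integrableOn_hull T.1 (continuous_pd (hX' i) i)
  simp only [divVec_eq]
  rw [integral_add (f := fun x => pd 0 (fun y => X y 0) x + pd 1 (fun y => X y 1) x)
    ((hc 0).add (hc 1)) (hc 2), integral_add (hc 0) (hc 1), sum_faces]
  have h1 : ∀ i : Fin 3, ∫ x in T.hull, pd i (fun y => X y i) x =
      ∑ x : T.1, -(3 * vol T) * baryGrad T.basis x i *
        faceAvg (faceOpp T x).1 (fun y => X y i) := by
    intro i
    refine (setIntegral_fderiv_tet T.2.2 T.indep (EuclideanSpace.single i 1) (hX' i)).trans ?_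
    refine Finset.sum_congr rfl fun x _ => ?_
    rw [EuclideanSpace.inner_single_right]
    simp only [RCLike.conj_to_real, one_mul]
    rfl
  rw [h1, h1, h1, ← Finset.sum_add_distrib, ← Finset.sum_add_distrib]
  refine Finset.sum_congr rfl fun x _ => ?_
  rw [integral_face_eq, faceAvg_inner _ _ hX.continuous]
  -- The gradients of the barycentric coordinates are exchanged for outward area vectors,
  -- componentwise.
  have h2 : ∀ i, area (faceOpp T x) * nOut T (faceOpp T x) i =
      -(3 * vol T) * baryGrad T.basis x i := fun i => by
    have := congrArg (fun v : E3 => v i) (area_smul_nOut T x)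
    simpa using this
  simp only [← h2]
  ring

end TetMesh
end QuadCurl
end

noncomputable section

namespace QuadCurl

theorem curl_sub {u v : E3 → E3} (hu : Differentiable ℝ u) (hv : Differentiable ℝ v) (x : E3) :
    curl (u - v) x = curl u x - curl v x := by
  have h1 := fun i => differentiableAt_coord (hu x) i
  have h2 := fun i => differentiableAt_coord (hv x) i
  have h3 : ∀ i j, pd j (fun y => (u - v) y i) x =
      pd j (fun y => u y i) x - pd j (fun y => v y i) x := fun i j => pd_sub j (h1 i) (h2 i)
  apply E3_ext <;>
    simp only [PiLp.sub_apply, curl_apply_zero, curl_apply_one, curl_apply_two, h3] <;> ring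

namespace TetMesh

variable {Ω : Set E3} {M : TetMesh Ω}

/-! ### Edge degrees of freedom -/

/-- The chosen tangent is a nonzero multiple of b - a. The factor is the same for all fields and
weights, so it drops out of every comparison of moments. -/
theorem edgeDof_eq (e : M.Edge) {a b : E3} (hab : a ≠ b) (he : (e.1 : Set E3) = {a, b}) :
    ∃ κ : ℝ, κ ≠ 0 ∧ ∀ (v : E3 → E3) (q : E3 → ℝ),
      edgeDof e v q = κ * edgeMoment a b v (fun t => q (a + t • (b - a))) := by
  have ha : a ∈ e.1 := by rw [← Finset.mem_coe, he]; simp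
  have hb : b ∈ e.1 := by rw [← Finset.mem_coe, he]; simp
  obtain ⟨r, hr⟩ := M.tangent_parallel e.1 e.2.1 e.2.2 b hb a ha
  have hr0 : r ≠ 0 := by
    rintro rfl
    rw [zero_smul, sub_eq_zero] at hr
    exact hab hr.symm
  have ht : tE e = r⁻¹ • (b - a) := by rw [hr, smul_smul, inv_mul_cancel₀ hr0, one_smul]; rfl
  refine ⟨‖b - a‖ * r⁻¹, mul_ne_zero (norm_ne_zero_iff.2 (sub_ne_zero.2 hab.symm))
    (inv_ne_zero hr0), fun v q => ?_⟩
  have h1 := setIntegral_segment hab (fun x => inner ℝ (v x) (tE e) * q x)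
  rw [edgeDof, Simp.hull, he, h1, edgeMoment, smul_eq_mul, mul_assoc,
    ← intervalIntegral.integral_const_mul, ht]
  simp only [inner_smul_right, mul_assoc, intervalIntegral.integral_const_mul]

theorem edgeDofs_eq_iff {ℓ : ℕ} (hℓ : ℓ = 0 ∨ ℓ = 1) (e : M.Edge) {a b : E3} (hab : a ≠ b)
    (he : (e.1 : Set E3) = {a, b}) {u v : E3 → E3} (hu : Continuous u) (hv : Continuous v) :
    (∀ q, IsPoly ℓ q → edgeDof e u q = edgeDof e v q) ↔ EdgeVanish ℓ a b (u - v) := by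
  obtain ⟨κ, hκ, h⟩ := edgeDof_eq e hab he
  constructor
  · intro H
    have H' : ∀ q, Continuous q → IsPoly ℓ q →
        edgeMoment a b (u - v) (fun t => q (a + t • (b - a))) = 0 := by
      intro q hqc hq
      have h1 := H q hq
      rw [h, h] at h1
      rw [edgeMoment_sub _ _ hu hv (by fun_prop), mul_left_cancel₀ hκ h1, sub_self]
    refine ⟨H' (fun _ => 1) continuous_const (IsPoly.const ℓ 1), fun h1 => ?_⟩
    subst h1
    set d := b - a with hd
    have hn : inner ℝ d d ≠ 0 := by
      rw [ne_eq, inner_self_eq_zero]; exact sub_ne_zero.2 hab.symm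
    -- This weight is ⟨d, x - a⟩ / ⟨d, d⟩, which restricts to the parameter t on the edge.
    have hq : IsPoly 1 fun x : E3 => -(inner ℝ d d)⁻¹ * inner ℝ d a + ((inner ℝ d d)⁻¹ * d 0 * x 0 +
        (inner ℝ d d)⁻¹ * d 1 * x 1 + (inner ℝ d d)⁻¹ * d 2 * x 2) :=
      (IsPoly.const _ _).add ((((IsPoly.coord 0).const_mul _).add
        ((IsPoly.coord 1).const_mul _)).add ((IsPoly.coord 2).const_mul _))
    have h2 := H' _ (by fun_prop) hq
    convert h2 using 2
    ext t
    have e : -(inner ℝ d d)⁻¹ * inner ℝ d a + ((inner ℝ d d)⁻¹ * d 0 * (a + t • d) 0 +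
        (inner ℝ d d)⁻¹ * d 1 * (a + t • d) 1 + (inner ℝ d d)⁻¹ * d 2 * (a + t • d) 2) =
        t * ((inner ℝ d d)⁻¹ * inner ℝ d d) := by
      rw [inner_eq d a]
      nth_rewrite 6 [inner_eq d d]
      simp
      ring
    rw [e, inv_mul_cancel₀ hn, mul_one]
  · rintro ⟨h0, h1⟩ q hq
    rw [h, h]
    congr 1
    -- On the edge every admissible weight is k + l t, with l = 0 if ℓ = 0, so the moments in
    -- `EdgeVanish` generate all others.
    obtain ⟨k, l, hkl, hl⟩ : ∃ k l : ℝ, (∀ t : ℝ, q (a + t • (b - a)) = k + l * t) ∧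
        (ℓ = 0 → l = 0) := by
      rcases hℓ with rfl | rfl
      · obtain ⟨k, hk⟩ := hq.exists_const
        exact ⟨k, 0, fun t => by rw [hk]; ring, fun _ => rfl⟩
      · obtain ⟨k, b0, b1, b2, hk⟩ := hq.exists_affine
        refine ⟨k + b0 * a 0 + b1 * a 1 + b2 * a 2,
          b0 * (b 0 - a 0) + b1 * (b 1 - a 1) + b2 * (b 2 - a 2), fun t => ?_, fun h => by simp at h⟩
        rw [hk]
        simp
        ring
    simp only [hkl]
    rw [← sub_eq_zero, ← edgeMoment_sub _ _ hu hv (by fun_prop)]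
    have hc : Continuous (u - v) := hu.sub hv
    have h2 : edgeMoment a b (u - v) (fun t => k + l * t) =
        k * edgeMoment a b (u - v) (fun _ => 1) + l * edgeMoment a b (u - v) (fun t => t) := by
      unfold edgeMoment
      rw [← intervalIntegral.integral_const_mul, ← intervalIntegral.integral_const_mul,
        ← intervalIntegral.integral_add]
      · congr 1; ext t; ring
      · exact Continuous.intervalIntegrable (by fun_prop) _ _
      · exact Continuous.intervalIntegrable (by fun_prop) _ _
    rw [h2, h0]
    rcases hℓ with rfl | rfl
    · rw [hl rfl]; ring
    · rw [h1 rfl]; ring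

theorem edgeDof_zero (e : M.Edge) (q : E3 → ℝ) : edgeDof e (0 : E3 → E3) q = 0 := by
  simp [edgeDof]

theorem edgeVanish_self (ℓ : ℕ) (a : E3) (v : E3 → E3) : EdgeVanish ℓ a a v :=
  ⟨edgeMoment_self _ _ _, fun _ => edgeMoment_self _ _ _⟩

open scoped Classical in
/-- The edge between two vertices of a simplex. -/
theorem exists_edge {n : ℕ} (s : M.Simp n) {a b : E3} (ha : a ∈ s.1) (hb : b ∈ s.1) (hab : a ≠ b) :
    ∃ e : M.Edge, e.1 = {a, b} ∧ e.IsSub s := by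
  have hsub : ({a, b} : Finset E3) ⊆ s.1 := by
    intro z hz
    rcases Finset.mem_insert.1 hz with rfl | hz
    · exact ha
    · rw [Finset.mem_singleton.1 hz]; exact hb
  exact ⟨⟨{a, b}, M.cplx.down_closed s.2.1 hsub (Finset.insert_nonempty _ _),
    Finset.card_pair hab⟩, rfl, hsub⟩

/-- The number of vertices is left free because the criterion serves both for cells, where moments
determine a shape function, and for faces, where they determine the traces. -/
theorem simp_edges_iff {ℓ : ℕ} (hℓ : ℓ = 0 ∨ ℓ = 1) {n : ℕ} (s : M.Simp n) {u v : E3 → E3}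
    (hu : Continuous u) (hv : Continuous v) :
    (∀ e : M.Edge, e.IsSub s → ∀ q, IsPoly ℓ q → edgeDof e u q = edgeDof e v q) ↔
      ∀ a ∈ s.1, ∀ b ∈ s.1, EdgeVanish ℓ a b (u - v) := by
  classical
  constructor
  · intro H a ha b hb
    by_cases hab : a = b
    · subst hab; exact edgeVanish_self _ _ _
    · obtain ⟨e, he, hes⟩ := exists_edge s ha hb hab
      exact (edgeDofs_eq_iff hℓ e hab (by rw [he]; simp) hu hv).1 (H e hes)
  · intro H e hes
    obtain ⟨a, b, hab, he⟩ := Finset.card_eq_two.1 e.2.2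
    have ha : a ∈ e.1 := by rw [he]; simp
    have hb : b ∈ e.1 := by rw [he]; simp
    exact (edgeDofs_eq_iff hℓ e hab (by rw [he]; simp) hu hv).2 (H a (hes ha) b (hes hb))

/-! ### The interpolation operator -/

/-- The `epsilon` in `interp` is meaningful because `exists_nedelec` supplies a candidate; by
`nedelec_unique` it is the only one. -/
theorem interp_spec {ℓ : ℕ} (hℓ : ℓ = 0 ∨ ℓ = 1) (v : M.Broken E3) (T : M.Cell)
    (hv : Continuous (v T)) : IsNedelec ℓ (interp ℓ v T) ∧ ∀ e : M.Edge, e.IsSub T →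
      ∀ q, IsPoly ℓ q → edgeDof e (interp ℓ v T) q = edgeDof e (v T) q := by
  obtain ⟨u, hu, h⟩ := exists_nedelec T.basis hℓ hv
  exact Classical.epsilon_spec (p := fun u : E3 → E3 => IsNedelec ℓ u ∧
    ∀ e : M.Edge, e.IsSub T → ∀ q, IsPoly ℓ q → edgeDof e u q = edgeDof e (v T) q)
    ⟨u, hu, (simp_edges_iff hℓ T (hu.contDiff hℓ).continuous hv).2
      fun a ha b hb => h ⟨a, ha⟩ ⟨b, hb⟩⟩

theorem nedelec_unique {ℓ : ℕ} (hℓ : ℓ = 0 ∨ ℓ = 1) (T : M.Cell) {u v : E3 → E3}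
    (hu : IsNedelec ℓ u) (hv : IsNedelec ℓ v) (h : ∀ e : M.Edge, e.IsSub T → ∀ q, IsPoly ℓ q →
      edgeDof e u q = edgeDof e v q) : u = v := by
  have h1 := (simp_edges_iff hℓ T (hu.contDiff hℓ).continuous (hv.contDiff hℓ).continuous).1 h
  exact sub_eq_zero.1 ((hu.sub hℓ hv).eq_zero T.basis hℓ fun i j => h1 _ i.2 _ j.2)

/-! ### Traces on faces -/

theorem eq_of_cross_nF (F : M.Face) (a : E3) :
    a = inner ℝ (nF F) a • nF F - cross (nF F) (cross (nF F) a) := by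
  rw [cross_cross_eq, inner_nF_self, one_smul]; abel

/-- The tangential trace on a face of a Nédélec function is determined by the edges of the face. -/
theorem IsNedelec.cross_eq_zero {ℓ : ℕ} (hℓ : ℓ = 0 ∨ ℓ = 1) {v : E3 → E3} (hv : IsNedelec ℓ v)
    (F : M.Face) (h : ∀ a ∈ F.1, ∀ b ∈ F.1, EdgeVanish ℓ a b v) {x : E3} (hx : x ∈ F.hull) :
    cross (v x) (nF F) = 0 := by
  obtain ⟨a, b, c, ha, hb, hc, hm, hset, hi⟩ := exists_three F
  have hv' : ∀ z ∈ F.1, ∀ y ∈ F.1, inner ℝ (v z) (y - z) = 0 := fun z hz y hy =>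
    hv.inner_left_eq_zero hℓ (h z hz y hy)
  -- The field is normal to F at the vertices; as it is affine, this persists on their convex hull.
  have hperp : ∀ y ∈ F.1, inner ℝ (v x) (y - a) = 0 := by
    intro y hy
    obtain ⟨α, B, rfl, -⟩ := (isNedelec_iff hℓ).1 hv
    have hconv : Convex ℝ {z | inner ℝ (affField α B z) (y - a) = 0} := by
      intro z₁ h₁ z₂ h₂ s t hs ht hst
      simp only [Set.mem_ofPred_eq, affField, matVec_add, matVec_smul, inner_add_left,
        inner_smul_left, RCLike.conj_to_real] at h₁ h₂ ⊢
      have : t = 1 - s := by linarith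
      subst this
      linear_combination s * h₁ + (1 - s) * h₂
    refine convexHull_min ?_ hconv hx
    intro z hz
    have e : y - a = (y - z) - (a - z) := by abel
    rw [Set.mem_ofPred_eq, e, inner_sub_right, hv' z hz y hy, hv' z hz a ha, sub_zero]
  -- By the double cross product, v x × ((b - a) × (c - a)) = 0, and the inner product vector is a
  -- nonzero multiple of n_F.
  have h1 := cross_cross_eq (v x) (b - a) (c - a)
  rw [hperp b hb, hperp c hc, zero_smul, zero_smul, sub_zero, cross_eq_smul_nF F ha hb hc] at h1
  set k := inner ℝ (nF F) (cross (b - a) (c - a)) with hk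
  have hk0 : k ≠ 0 := by
    intro h0
    have h2 := norm_cross_pos hi
    rw [cross_eq_smul_nF F ha hb hc, ← hk, h0] at h2
    simp at h2
  have h2 : cross (v x) (k • nF F) = k • cross (v x) (nF F) := by
    apply E3_ext <;> simp <;> ring
  rw [h2] at h1
  exact (smul_eq_zero.1 h1).resolve_left hk0

/-- The mean of the normal component of the curl vanishes with the edge moments. -/
theorem faceAvg_inner_curl_eq_zero {ℓ : ℕ} (F : M.Face) {v : E3 → E3} (hv : ContDiff ℝ 1 v)
    (h : ∀ a ∈ F.1, ∀ b ∈ F.1, EdgeVanish ℓ a b v) :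
    faceAvg F.1 (fun x => inner ℝ (nF F) (curl v x)) = 0 := by
  classical
  obtain ⟨a, b, c, ha, hb, hc, hm, hset, hi⟩ := exists_three F
  have h1 := stokes_triangle hi hv
  rw [(h a ha b hb).1, (h b hb c hc).1, (h c hc a ha).1, cross_eq_smul_nF F ha hb hc] at h1
  set k := inner ℝ (nF F) (cross (b - a) (c - a)) with hk
  have hk0 : k ≠ 0 := by
    intro h0
    have h2 := norm_cross_pos hi
    rw [cross_eq_smul_nF F ha hb hc, ← hk, h0] at h2
    simp at h2
  have hF : F.1 = {a, b, c} := by ext z; rw [hm]; simp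
  have h2 : k * faceAvg F.1 (fun x => inner ℝ (nF F) (curl v x)) = 0 := by
    rw [← faceAvg_const_mul, hF, faceAvg_eq_cornerInt hi]
    have e : (fun x => k * inner ℝ (nF F) (curl v x)) =
        fun x => inner ℝ (curl v x) (k • nF F) := by
      ext x; rw [inner_smul_right, real_inner_comm]
    rw [e, h1]; simp
  exact (mul_eq_zero.1 h2).resolve_left hk0

/-! ### Affine fields and the barycentres of faces -/

/-- The barycentre of a face. -/
def bary (F : M.Face) : E3 := (1 / 3 : ℝ) • ∑ y ∈ F.1, y

/-- The affine part averages to its value at the centroid of the triangle. Face means of the curl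
thereby become point values. -/
theorem faceAvg_affField (F : M.Face) (l g : E3) (A : Mat3) :
    faceAvg F.1 (fun x => inner ℝ l (affField g A x)) = inner ℝ l (affField g A (bary F)) := by
  classical
  obtain ⟨a, b, c, ha, hb, hc, hm, hset, hi⟩ := exists_three F
  have hinj := hi.injective
  have hab : a ≠ b := fun h => by
    have := @hinj 0 1 (by simpa using h); simp at this
  have hac : a ≠ c := fun h => by
    have := @hinj 0 2 (by simpa using h); simp at this
  have hbc : b ≠ c := fun h => by
    have := @hinj 1 2 (by simpa using h); simp at this
  have hF : F.1 = {a, b, c} := by ext z; rw [hm]; simp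
  have hb' : bary F = (1 / 3 : ℝ) • (a + b + c) := by
    rw [bary, hF, Finset.sum_insert (by simp [hab, hac]), Finset.sum_pair hbc, add_assoc]
  have h1 : ∀ x, inner ℝ l (affField g A x) = inner ℝ l g + inner ℝ (matVec A.transpose l) x := by
    intro x
    rw [affField, inner_add_right, ← inner_matVec_transpose, Matrix.transpose_transpose]
  simp only [h1]
  rw [hF, faceAvg_eq_cornerInt hi, cornerInt_triangle_affine, hb']
  ring

theorem sum_cell_vertices (T : M.Cell) (x : T.1) :
    ∑ y : T.1, (y : E3) = x + (3 : ℝ) • bary (faceOpp T x) := by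
  classical
  rw [bary, smul_smul, faceOpp_val, show (3 : ℝ) * (1 / 3) = 1 by norm_num, one_smul,
    Finset.sum_coe_sort T.1 (fun y => y)]
  exact (Finset.add_sum_erase _ (fun y => y) x.2).symm

/-- Affine fields are determined by their values at the barycentres of the faces. -/
theorem affField_eq_sum_bary (T : M.Cell) (g : E3) (A : Mat3) (y : E3) : affField g A y =
    ∑ x : T.1, (1 - 3 * T.basis.coord x y) • affField g A (bary (faceOpp T x)) := by
  have hs := T.basis.sum_coord_apply_eq_one y
  -- The functions 1 - 3 λ_x are the Crouzeix–Raviart basis functions: dual to the face barycentres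
  -- and, with four vertices, of sum 4 - 3 = 1.
  have hw : ∑ x : T.1, (1 - 3 * T.basis.coord x y) = 1 := by
    rw [Finset.sum_sub_distrib, ← Finset.mul_sum, hs]
    have hcard := T.2.2
    simp only [Finset.sum_const, Finset.card_univ, Fintype.card_coe, hcard]
    norm_num
  rw [← affField_sum g A hw]
  congr 1
  set S := ∑ z : T.1, (z : E3) with hS
  have hb : ∀ x : T.1, bary (faceOpp T x) = (1 / 3 : ℝ) • (S - x) := by
    intro x
    rw [hS, sum_cell_vertices T x, add_sub_cancel_left, smul_smul]; norm_num
  have h1 : ∀ x : T.1, (1 - 3 * T.basis.coord x y) • bary (faceOpp T x) =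
      (1 / 3 : ℝ) • ((1 - 3 * T.basis.coord x y) • S) -
        (1 / 3 : ℝ) • (x : E3) + T.basis.coord x y • (x : E3) := by
    intro x
    rw [hb]; module
  simp only [h1, Finset.sum_add_distrib, Finset.sum_sub_distrib, ← Finset.smul_sum,
    ← Finset.sum_smul, hw, one_smul]
  have h2 := T.basis.linear_combination_coord_eq_self y
  simp only [Simp.basis_apply] at h2
  rw [h2, ← hS]
  abel

theorem coord_bary (T : M.Cell) (x z : T.1) [Decidable (x = z)] :
    T.basis.coord z (bary (faceOpp T x)) = if x = z then 0 else 1 / 3 := by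
  classical
  have h1 := sum_cell_vertices T x
  have h2 : (3 : ℝ) • (bary (faceOpp T x) - x) = ∑ y : T.1, ((y : E3) - x) := by
    rw [Finset.sum_sub_distrib, h1]
    have hcard := T.2.2
    simp only [Finset.sum_const, Finset.card_univ, Fintype.card_coe, hcard]
    module
  have h3 := congrArg (inner ℝ (baryGrad T.basis z)) h2
  rw [inner_smul_right, inner_baryGrad_sub, inner_sum] at h3
  have h4 : ∀ y : T.1, inner ℝ (baryGrad T.basis z) ((y : E3) - x) =
      (if z = y then 1 else 0) - (if z = x then 1 else 0) := fun y => by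
    rw [← T.basis.coord_apply, ← T.basis.coord_apply]
    exact inner_baryGrad_sub T.basis z y x
  have h5 : T.basis.coord z x = if z = x then 1 else 0 := T.basis.coord_apply z x
  simp only [h4, h5] at h3
  have hcard := T.2.2
  simp only [Finset.sum_sub_distrib, Finset.sum_ite_eq, Finset.mem_univ, if_true,
    Finset.sum_const, Finset.card_univ, Fintype.card_coe, hcard] at h3
  by_cases h : x = z
  · subst h
    simp only [if_true] at h3 ⊢
    norm_num at h3
    linarith
  · rw [if_neg (Ne.symm h)] at h3
    rw [if_neg h]
    norm_num at h3
    linarith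

/-- Divergence-free affine fields with prescribed values at the barycentres of the faces. -/
theorem exists_affField_bary (T : M.Cell) (G : T.1 → E3)
    (hG : ∑ x, inner ℝ (baryGrad T.basis x) (G x) = 0) :
    ∃ g A, Matrix.trace A = 0 ∧ ∀ x, affField g A (bary (faceOpp T x)) = G x := by
  classical
  -- The Crouzeix–Raviart interpolant of the values G. Its linear part has trace -3 ∑ grad λ_x · G
  -- x, so `hG` is the condition that the trace vanishes.
  have key : ∀ y, affField (∑ x, (1 - 3 * T.basis.coord x 0) • G x)
      (Matrix.of fun i j => ∑ x : T.1, -3 * (G x i * baryGrad T.basis x j)) y =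
      ∑ x, (1 - 3 * T.basis.coord x y) • G x := by
    intro y
    have h1 : ∀ i, affField (∑ x, (1 - 3 * T.basis.coord x 0) • G x)
      (Matrix.of fun i j => ∑ x : T.1, -3 * (G x i * baryGrad T.basis x j)) y i =
      (∑ x, (1 - 3 * T.basis.coord x y) • G x) i := by
      intro i
      simp only [affField_apply, Matrix.of_apply, WithLp.ofLp_sum, Finset.sum_apply,
        PiLp.smul_apply, smul_eq_mul, Finset.sum_mul, ← Finset.sum_add_distrib]
      refine Finset.sum_congr rfl fun x _ => ?_
      rw [coord_eq T.basis x y, inner_eq]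
      ring
    ext i; exact h1 i
  refine ⟨_, _, ?_, fun x => (key _).trans ?_⟩
  · simp only [Matrix.trace, Matrix.diag, Matrix.of_apply, Fin.sum_univ_three,
      ← Finset.sum_add_distrib]
    have h2 : ∀ x : T.1, -3 * (G x 0 * baryGrad T.basis x 0) + -3 * (G x 1 * baryGrad T.basis x 1) +
        -3 * (G x 2 * baryGrad T.basis x 2) = -3 * inner ℝ (baryGrad T.basis x) (G x) := fun x => by
      rw [inner_eq]; ring
    simp only [h2, ← Finset.mul_sum, hG, mul_zero]
  · simp only [coord_bary]
    rw [Finset.sum_eq_single x]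
    · simp
    · intro z _ hz
      rw [if_neg (Ne.symm hz)]; norm_num
    · simp

theorem inner_integral_face (F : M.Face) (l : E3) {g : E3 → E3} (hg : Continuous g) :
    inner ℝ l (∫ x in F.hull, g x ∂μHE[2]) = ∫ x in F.hull, inner ℝ l (g x) ∂μHE[2] :=
  (integral_inner (integrableOn_face F hg) l).symm

theorem projF_eq (F : M.Face) (g : E3 → E3) :
    projF F g = (area F)⁻¹ • ∫ x in F.hull, g x ∂μHE[2] := by
  rw [projF, setAverage_eq]; rfl

theorem inner_projF (F : M.Face) (l : E3) {g : E3 → E3} (hg : Continuous g) :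
    inner ℝ l (projF F g) = faceAvg F.1 (fun x => inner ℝ l (g x)) := by
  rw [projF_eq, inner_smul_right, inner_integral_face F l hg, faceAvg_eq]

theorem cross_neg_swap (a b : E3) : cross a b = -cross b a := by
  apply E3_ext <;> simp <;> ring

/-- The factor converts between the face moment and the multiplier, which have opposite orders of
the cross product. It is nonzero, so single-valuedness and vanishing pass from one to the other. -/
theorem faceDof_eq (F : M.Face) (v : E3 → E3) :
    faceDof F v = -(area F) • projF F (fun x => cross (nF F) (curl v x)) := by
  rw [projF_eq, smul_smul, neg_mul, mul_inv_cancel₀ (area_pos F).ne', neg_one_smul, faceDof,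
    ← integral_neg]
  simp only [← cross_neg_swap]

theorem continuous_affField (g : E3) (A : Mat3) : Continuous (affField g A) :=
  (contDiff_affField g A).continuous

theorem projF_cross_affField (F : M.Face) (g : E3) (A : Mat3) :
    projF F (fun x => cross (nF F) (affField g A x)) = cross (nF F) (affField g A (bary F)) := by
  refine ext_inner_left ℝ fun l => ?_
  have hc := continuous_affField g A
  rw [inner_projF F l (by fun_prop)]
  have h : ∀ a : E3, inner ℝ l (cross (nF F) a) = inner ℝ (cross l (nF F)) a := fun a => by
    simp [inner_eq]; ring
  simp only [h, faceAvg_affField]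

/-! ### Unisolvence of the `H(grad curl)` element -/

theorem vol_pos (T : M.Cell) : 0 < vol T := by
  have h1 : 0 ≤ vol T := measureReal_nonneg
  refine lt_of_le_of_ne h1 (Ne.symm fun h => ?_)
  obtain ⟨x, hx⟩ : T.1.Nonempty := Finset.card_pos.1 (by rw [T.2.2]; norm_num)
  -- A zero volume would annihilate the area vector of a face, although the area is positive and the
  -- sign is ±1.
  have h2 := area_smul_nOut T ⟨x, hx⟩
  rw [h] at h2
  have h3 := congrArg norm h2
  have h4 := sgn_mul_self T (faceOpp T ⟨x, hx⟩)
  have h5 := area_pos (faceOpp T ⟨x, hx⟩)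
  simp only [nOut, norm_smul, norm_nF, mul_zero, neg_zero, zero_smul, norm_zero, mul_one,
    mul_eq_zero, norm_eq_zero] at h3
  rcases h3 with h3 | h3
  · exact h5.ne' h3
  · rw [h3] at h4; norm_num at h4

theorem exists_baryGrad_eq (T : M.Cell) (x : T.1) :
    ∃ r : ℝ, baryGrad T.basis x = r • nF (faceOpp T x) := by
  refine ⟨(-(3 * vol T))⁻¹ * (area (faceOpp T x) * sgn T (faceOpp T x)), ?_⟩
  have h := area_smul_nOut T x
  rw [nOut, smul_smul] at h
  have hv := vol_pos T
  rw [mul_smul, h, smul_smul, inv_mul_cancel₀ (by linarith), one_smul]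

theorem eq_zero_of_inner_nF (T : M.Cell) {k : E3}
    (h : ∀ x : T.1, inner ℝ (nF (faceOpp T x)) k = 0) : k = 0 := by
  rw [← sum_inner_baryGrad_smul T.basis k]
  refine Finset.sum_eq_zero fun x _ => ?_
  obtain ⟨r, hr⟩ := exists_baryGrad_eq T x
  rw [hr, inner_smul_left, h, mul_zero, zero_smul]

/-- The affine curl vanishes at every face barycentre: its normal part by Stokes and the edge
moments, its tangential part by the face moments. So the field is curl-free, hence of Nédélec type,
and the edge moments finish the argument. -/
theorem gradCurlShape_eq_zero {ℓ : ℕ} (hℓ : ℓ = 0 ∨ ℓ = 1) (T : M.Cell) {c : E3} {v : E3 → E3}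
    (hv : IsGradCurlShape ℓ c v) (he : ∀ a ∈ T.1, ∀ b ∈ T.1, EdgeVanish ℓ a b v)
    (hf : ∀ F : M.Face, F.IsSub T → projF F (fun x => cross (nF F) (curl v x)) = 0) : v = 0 := by
  obtain ⟨g, A, -, hg⟩ := hv.exists_curl hℓ
  have hsm : ContDiff ℝ 1 v := (hv.contDiff hℓ).of_le (by exact_mod_cast le_top)
  have hb : ∀ x : T.1, affField g A (bary (faceOpp T x)) = 0 := by
    intro x
    have hsub := faceOpp_isSub T x
    have h1 := hf _ hsub
    rw [hg, projF_cross_affField] at h1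
    have h2 := faceAvg_inner_curl_eq_zero (ℓ := ℓ) (faceOpp T x) hsm
      fun a ha b hb => he a (hsub ha) b (hsub hb)
    rw [hg, faceAvg_affField] at h2
    rw [eq_of_cross_nF (faceOpp T x) (affField g A _), h1, h2]
    apply E3_ext <;> simp
  have hc : ∀ x, curl v x = 0 := by
    intro x
    rw [hg, affField_eq_sum_bary T]
    simp [hb]
  exact (hv.isNedelec_of_curl_eq_zero hℓ hc).eq_zero T.basis hℓ fun i j => he _ i.2 _ j.2

/-- A field w₀ with the right curl is built first. Its edge moments are then corrected by a
gradient, which leaves the curl unchanged. -/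
theorem exists_gradCurlShape {ℓ : ℕ} (hℓ : ℓ = 0 ∨ ℓ = 1) (T : M.Cell) (c : E3) {u : E3 → E3}
    (hu : IsNedelec ℓ u) (μ : M.Face → E3)
    (hμ : ∀ F : M.Face, F.IsSub T → inner ℝ (μ F) (nF F) = 0) :
    ∃ w, IsGradCurlShape ℓ c w ∧ (∀ a ∈ T.1, ∀ b ∈ T.1, EdgeVanish ℓ a b (u - w)) ∧
      ∀ F : M.Face, F.IsSub T → projF F (fun x => cross (nF F) (curl w x)) = μ F := by
  have hone : (1 : WithTop ℕ∞) ≤ ∞ := by exact_mod_cast le_top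
  obtain ⟨α, B, huB, -⟩ := (isNedelec_iff hℓ).1 hu
  have hcu : ∀ x, curl u x = axial B := fun x => by rw [huB, curl_affField]
  -- The values that curl w must take at the face barycentres: the normal part comes from curl u,
  -- and the tangential part is μ × n because n × (μ × n) = μ for tangential μ.
  set G : T.1 → E3 := fun x => inner ℝ (nF (faceOpp T x)) (axial B) • nF (faceOpp T x) +
    cross (μ (faceOpp T x)) (nF (faceOpp T x)) with hG
  have hGn : ∀ x, inner ℝ (nF (faceOpp T x)) (G x) = inner ℝ (nF (faceOpp T x)) (axial B) := by
    intro x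
    rw [hG, inner_add_right, inner_smul_right, inner_nF_self, real_inner_comm, real_inner_comm,
      real_inner_comm (cross _ _), inner_cross_right, real_inner_comm]
    ring
  -- Since grad λ_x is normal to the opposite face, only the normal parts of G enter. They are those
  -- of a constant field, whose total flux is zero.
  have hGsum : ∑ x, inner ℝ (baryGrad T.basis x) (G x) = 0 := by
    rw [← sum_inner_baryGrad T.basis (axial B)]
    refine Finset.sum_congr rfl fun x _ => ?_
    obtain ⟨r, hr⟩ := exists_baryGrad_eq T x
    rw [hr, inner_smul_left, inner_smul_left, hGn]
  obtain ⟨g, A, hA, hgA⟩ := exists_affField_bary T G hGsum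
  obtain ⟨q, Q, hqQ⟩ := exists_shape_of_curl c g hA
  set w₀ := gcField c 0 0 q Q with hw₀
  have hw₀s : ContDiff ℝ ∞ w₀ := contDiff_gcField _ _ _ _ _
  obtain ⟨u₀, hu₀, hu₀e⟩ := exists_nedelec T.basis hℓ hw₀s.continuous
  -- Both curls are constant. Their normal components agree on each face: that of u₀ is the mean for
  -- w₀ by Stokes, and that mean was prescribed from u. The four normals span, so u - u₀ is
  -- curl-free.
  have hzero : ∀ x, curl (u - u₀) x = 0 := by
    obtain ⟨α₀, B₀, hB₀, -⟩ := (isNedelec_iff hℓ).1 hu₀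
    have hcu₀ : ∀ x, curl u₀ x = axial B₀ := fun x => by rw [hB₀, curl_affField]
    have hus := (hu.contDiff hℓ).differentiable (by simp)
    have hu₀s := (hu₀.contDiff hℓ).differentiable (by simp)
    intro x
    rw [curl_sub hus hu₀s, hcu, hcu₀]
    refine eq_zero_of_inner_nF T fun y => ?_
    have hsub := faceOpp_isSub T y
    have h1 := faceAvg_inner_curl_eq_zero (ℓ := ℓ) (faceOpp T y) (v := u₀ - w₀)
      (((hu₀.contDiff hℓ).sub hw₀s).of_le hone)
      fun a ha b hb => hu₀e ⟨a, hsub ha⟩ ⟨b, hsub hb⟩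
    have h2 : curl (u₀ - w₀) = affField (axial B₀ - g) (-A) := by
      ext1 z
      rw [curl_sub hu₀s (hw₀s.differentiable (by simp)), hcu₀, hqQ]
      apply E3_ext <;> simp [affField_apply] <;> ring
    rw [h2, faceAvg_affField] at h1
    have h3 : affField (axial B₀ - g) (-A) (bary (faceOpp T y)) = axial B₀ - G y := by
      rw [← hgA]
      apply E3_ext <;> simp [affField_apply] <;> ring
    rw [h3, inner_sub_right, hGn] at h1
    rw [inner_sub_right]
    linarith
  obtain ⟨p, hp, hpz⟩ := exists_gradient_of_curl_eq_zero hℓ (hu.sub hℓ hu₀) hzero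
  obtain ⟨β, S, hS, hS0, hgrad⟩ := hp.exists_gradient hℓ
  have hw : gcField c β S q Q = (u - u₀) + w₀ := by
    rw [← hpz, hgrad]
    ext1 x
    rw [Pi.add_apply, hw₀, gcField, gcField]
    congr 1
    have : affField 0 0 x = 0 := by apply E3_ext <;> simp [affField_apply]
    rw [this, zero_add]
  refine ⟨gcField c β S q Q, (isGradCurlShape_iff hℓ).2 ⟨β, S, q, Q, rfl, hS, hS0⟩, ?_, ?_⟩
  · intro a ha b hb
    have : u - gcField c β S q Q = u₀ - w₀ := by rw [hw]; abel
    rw [this]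
    exact hu₀e ⟨a, ha⟩ ⟨b, hb⟩
  · intro F hF
    obtain ⟨x, rfl⟩ := exists_faceOpp hF
    have h1 : curl (gcField c β S q Q) = affField g A := by
      rw [← hqQ, hw₀, curl_gcField c β hS, curl_gcField c 0 (by simp)]
    rw [h1, projF_cross_affField, hgA, hG]
    have h2 := hμ _ hF
    have h3 : ∀ n m : E3, ∀ r : ℝ, cross n (r • n + cross m n) = inner ℝ n n • m - inner ℝ m n • n := by
      intro n m r
      rw [inner_eq n n, inner_eq m n]
      apply E3_ext <;> simp <;> ring
    rw [h3, h2, inner_nF_self]; simp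

end TetMesh
end QuadCurl
end

noncomputable section

namespace QuadCurl

namespace TetMesh

variable {Ω : Set E3} {M : TetMesh Ω}

/-! ### Position of the cells -/

theorem range_basis (T : M.Cell) : Set.range T.basis = (T.1 : Set E3) := by
  ext y
  constructor
  · rintro ⟨x, rfl⟩; exact x.2
  · intro hy; exact ⟨⟨y, hy⟩, rfl⟩

theorem mem_hull_iff {T : M.Cell} {y : E3} : y ∈ T.hull ↔ ∀ x, 0 ≤ T.basis.coord x y := by
  rw [Simp.hull, ← range_basis, AffineBasis.convexHull_eq_nonneg_coord, Set.mem_ofPred_eq]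

theorem mem_interior_hull_iff {T : M.Cell} {y : E3} :
    y ∈ interior T.hull ↔ ∀ x, 0 < T.basis.coord x y := by
  rw [Simp.hull, ← range_basis, AffineBasis.interior_convexHull, Set.mem_ofPred_eq]

theorem coord_eq_zero_of_mem_convexHull {ι : Type*} (p : AffineBasis ι ℝ E3) {S : Set E3}
    (hS : S ⊆ Set.range p) {i : ι} (hi : p i ∉ S) {y : E3} (hy : y ∈ convexHull ℝ S) :
    p.coord i y = 0 := by
  have hc : Convex ℝ (p.coord i ⁻¹' {0}) := (convex_singleton 0).affine_preimage _
  refine convexHull_min (fun z hz => ?_) hc hy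
  obtain ⟨j, rfl⟩ := hS hz
  exact p.coord_apply_ne fun h => hi (by rw [h]; exact hz)

theorem coord_eq_zero (T : M.Cell) {S : Set E3} (hS : S ⊆ (T.1 : Set E3)) {x : T.1}
    (hx : (x : E3) ∉ S) {y : E3} (hy : y ∈ convexHull ℝ S) : T.basis.coord x y = 0 :=
  coord_eq_zero_of_mem_convexHull T.basis (by rw [range_basis]; exact hS) hx hy

/-- By conformity two cells meet in the hull of their common vertices, where the coordinate of any
other vertex is zero. -/
theorem mem_of_coord_pos {T T' : M.Cell} {y : E3} (h : y ∈ T.hull) (h' : y ∈ T'.hull) {x : T.1}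
    (hx : 0 < T.basis.coord x y) : (x : E3) ∈ T'.1 := by
  by_contra hn
  have h1 : y ∈ convexHull ℝ ((T.1 : Set E3) ∩ T'.1) :=
    M.cplx.inter_subset_convexHull T.2.1 T'.2.1 ⟨h, h'⟩
  exact hx.ne' (coord_eq_zero T Set.inter_subset_left (fun h2 => hn h2.2) h1)

theorem eq_of_mem_interior {T T' : M.Cell} {y : E3} (h : y ∈ interior T.hull) (h' : y ∈ T'.hull) :
    T = T' := by
  refine Simp.ext (Finset.eq_of_subset_of_card_le (fun x hx => ?_) (by rw [T.2.2, T'.2.2]))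
  exact mem_of_coord_pos (interior_subset h) h' (mem_interior_hull_iff.1 h ⟨x, hx⟩)

theorem hull_mono {m n : ℕ} {s : M.Simp m} {t : M.Simp n} (h : s.IsSub t) : s.hull ⊆ t.hull :=
  convexHull_mono (Finset.coe_subset.2 h)

theorem glue_eq {X : Type} [AddCommMonoid X] (v : M.Broken X) {T : M.Cell} {y : E3}
    (hy : y ∈ interior T.hull) : glue v y = v T y := by
  classical
  rw [glue, Finset.sum_eq_single T]
  · exact Set.indicator_of_mem hy _
  · intro T' _ hne
    exact Set.indicator_of_notMem (fun h => hne (eq_of_mem_interior h (interior_subset hy))) _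
  · simp

theorem bary_mem_hull (F : M.Face) : bary F ∈ F.hull := by
  have h : bary F = ∑ y ∈ F.1, (1 / 3 : ℝ) • y := by rw [bary, Finset.smul_sum]
  rw [h]
  refine (convex_convexHull ℝ _).sum_mem (fun _ _ => by norm_num) ?_
    fun y hy => subset_convexHull ℝ _ hy
  have := F.2.2
  simp [this]

theorem sgn_eq_or (T : M.Cell) (F : M.Face) : sgn T F = 1 ∨ sgn T F = -1 := by
  classical
  unfold sgn; split_ifs <;> simp

/-- Two cells that share a face lie on opposite sides of it. -/
theorem sgn_eq_neg {T T' : M.Cell} (hne : T ≠ T') {F : M.Face} (h : F.IsSub T) (h' : F.IsSub T') :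
    sgn T F = -sgn T' F := by
  classical
  by_contra hs
  have hs' : sgn T F = sgn T' F := by
    rcases sgn_eq_or T F with h1 | h1 <;> rcases sgn_eq_or T' F with h2 | h2 <;>
      rw [h1, h2] at hs ⊢ <;> norm_num at hs
  obtain ⟨x, hx⟩ := exists_faceOpp h
  obtain ⟨x', hx'⟩ := exists_faceOpp h'
  obtain ⟨a, -, -, ha, -⟩ := exists_three F
  obtain ⟨r, hr⟩ := exists_baryGrad_eq T x
  obtain ⟨r', hr'⟩ := exists_baryGrad_eq T' x'
  have e1 := sgn_mul_inner T x (a := a) (by rw [← hx]; exact ha)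
  have e2 := sgn_mul_inner T' x' (a := a) (by rw [← hx']; exact ha)
  rw [← hx] at e1 hr
  rw [← hx'] at e2 hr'
  have hxF : (x : E3) ∉ F.1 := by rw [hx, faceOpp_val]; simp
  have hxF' : (x' : E3) ∉ F.1 := by rw [hx', faceOpp_val]; simp
  have c1 : T.basis.coord x a = 0 :=
    coord_eq_zero T (Finset.coe_subset.2 h) hxF (subset_convexHull ℝ _ ha)
  have c1' : T'.basis.coord x' a = 0 :=
    coord_eq_zero T' (Finset.coe_subset.2 h') hxF' (subset_convexHull ℝ _ ha)
  have f1 := inner_baryGrad_sub T.basis x x a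
  have f2 := inner_baryGrad_sub T.basis x x' a
  have f3 := inner_baryGrad_sub T'.basis x' x' a
  have g1 : T.basis.coord x x = 1 := T.basis.coord_apply_eq x
  have g3 : T'.basis.coord x' x' = 1 := T'.basis.coord_apply_eq x'
  rw [g1, c1, hr, inner_smul_left] at f1
  rw [c1, hr, inner_smul_left] at f2
  rw [g3, c1', hr', inner_smul_left] at f3
  simp only [conj_trivial, sub_zero] at f1 f2 f3
  set α : ℝ := inner ℝ (nF F) ((x : E3) - a)
  set β : ℝ := inner ℝ (nF F) ((x' : E3) - a)
  have hα : α ≠ 0 := fun h0 => by rw [h0] at f1; simp at f1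
  have hβ : β ≠ 0 := fun h0 => by rw [h0] at f3; simp at f3
  -- Equal signs put both opposite vertices strictly on the same side of F, so λ_x is positive at
  -- x'.
  have hαβ : 0 < α * β := by
    have := mul_pos (abs_pos.2 hα) (abs_pos.2 hβ)
    have e3 : (sgn T F * α) * (sgn T' F * β) = |α| * |β| := by rw [e1, e2]; ring
    have e4 : (sgn T F * α) * (sgn T' F * β) = α * β := by
      rw [hs']
      linear_combination α * β * sgn_mul_self T' F
    rw [← e4, e3]; exact this
  have hpos : 0 < T.basis.coord x x' := by
    rw [← f2]
    have h5 : r * β = α * β * r ^ 2 := by linear_combination (-(r * β)) * f1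
    rw [h5]
    have hr0 : r ≠ 0 := fun h0 => by rw [h0] at f1; simp at f1
    positivity
  have hb : ∀ z : T.1, z ≠ x → T.basis.coord z (bary F) = 1 / 3 := fun z hz => by
    have := coord_bary T x z
    rw [if_neg (Ne.symm hz)] at this
    rwa [← hx] at this
  have hb0 : T.basis.coord x (bary F) = 0 :=
    coord_eq_zero T (Finset.coe_subset.2 h) hxF (bary_mem_hull F)
  -- A short move from the barycentre of F towards x' enters the interior of T but stays in T',
  -- which is impossible for distinct cells.
  have hev : ∀ᶠ t : ℝ in nhdsWithin 0 (Set.Ioo 0 1),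
      ∀ z : T.1, 0 < T.basis.coord z (AffineMap.lineMap (bary F) (x' : E3) t) := by
    rw [Filter.eventually_all]
    intro z
    by_cases hz : z = x
    · filter_upwards [self_mem_nhdsWithin] with t ht
      rw [hz, AffineMap.apply_lineMap, hb0, AffineMap.lineMap_apply]
      simp only [vsub_eq_sub, sub_zero, smul_eq_mul, vadd_eq_add, add_zero]
      exact mul_pos ht.1 hpos
    · refine Filter.Eventually.filter_mono nhdsWithin_le_nhds ?_
      have hc : Continuous fun t : ℝ => T.basis.coord z (AffineMap.lineMap (bary F) (x' : E3) t) :=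
        (continuous_barycentric_coord T.basis z).comp AffineMap.lineMap_continuous
      have h0 : T.basis.coord z (AffineMap.lineMap (bary F) (x' : E3) (0 : ℝ)) = 1 / 3 :=
        (congrArg _ (AffineMap.lineMap_apply_zero _ _)).trans (hb z hz)
      exact hc.continuousAt.eventually (lt_mem_nhds (lt_of_lt_of_eq (by norm_num) h0.symm))
  have hne' : (nhdsWithin (0 : ℝ) (Set.Ioo 0 1)).NeBot := by
    rw [← mem_closure_iff_nhdsWithin_neBot, closure_Ioo (by norm_num)]
    exact ⟨le_rfl, zero_le_one⟩
  obtain ⟨t, ht, ht'⟩ := (hev.and self_mem_nhdsWithin).exists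
  refine hne (eq_of_mem_interior (mem_interior_hull_iff.2 ht) ?_)
  exact (convex_convexHull ℝ _).lineMap_mem (hull_mono h' (bary_mem_hull F))
    (subset_convexHull ℝ _ x'.2) ⟨ht'.1.le, ht'.2.le⟩

theorem exists_cell {n : ℕ} (s : M.Simp n) : ∃ T : M.Cell, s.IsSub T := by
  obtain ⟨t, ht, hst, hc⟩ := M.pure s.1 s.2.1
  exact ⟨⟨t, ht, hc⟩, hst⟩

open scoped Classical in
-- Cells at F have pairwise opposite signs, so there are at most two of them, and a face that is not
-- on the boundary has at least two.
theorem sum_sgn_eq_zero {F : M.Face} (hF : ¬ IsBdryFace F) :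
    ∑ T : M.Cell with F.IsSub T, sgn T F = 0 := by
  obtain ⟨T, hT⟩ := exists_cell F
  obtain ⟨T', hT', hne⟩ : ∃ T' : M.Cell, F.IsSub T' ∧ T' ≠ T := by
    by_contra hno
    push Not at hno
    exact hF ⟨T, hT, hno⟩
  have hset : (Finset.univ.filter fun T : M.Cell => F.IsSub T) = {T, T'} := by
    ext S
    simp only [Finset.mem_filter, Finset.mem_univ, true_and, Finset.mem_insert,
      Finset.mem_singleton]
    constructor
    · intro hS
      by_contra hno
      push Not at hno
      have h1 := sgn_eq_neg hno.1 hS hT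
      have h2 := sgn_eq_neg hno.2 hS hT'
      have h3 := sgn_eq_neg hne hT' hT
      rcases sgn_eq_or S F with h | h <;> linarith
    · rintro (rfl | rfl) <;> assumption
  rw [hset, Finset.sum_pair hne.symm, sgn_eq_neg hne hT' hT, add_neg_cancel]

/-- Near a point of the relative interior of a boundary face there is no other cell and no other
face of the cell. -/
theorem exists_nhds_bdry {F : M.Face} (hF : IsBdryFace F) {T : M.Cell} (hT : F.IsSub T) {x₀ : E3}
    (hx₀ : x₀ ∈ F.hull) (hpos : ∀ z : T.1, (z : E3) ∈ F.1 → 0 < T.basis.coord z x₀) :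
    ∃ V : Set E3, IsOpen V ∧ x₀ ∈ V ∧ (∀ T' : M.Cell, T' ≠ T → ∀ y ∈ V, y ∉ T'.hull) ∧
      ∀ F' : M.Face, F'.IsSub T → F' ≠ F → ∀ y ∈ V, y ∉ F'.hull := by
  classical
  refine ⟨(⋂ T' : M.Cell, {y | T' ≠ T → y ∉ T'.hull}) ∩
    ⋂ F' : M.Face, {y | F'.IsSub T → F' ≠ F → y ∉ F'.hull}, ?_, ?_, ?_, ?_⟩
  · refine (isOpen_iInter_of_finite fun T' => ?_).inter (isOpen_iInter_of_finite fun F' => ?_)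
    · by_cases h : T' ≠ T
      · have e : {y | T' ≠ T → y ∉ T'.hull} = T'.hullᶜ := by
          ext y; exact ⟨fun hy => hy h, fun hy _ => hy⟩
        rw [e]; exact (isCompact_simp_hull T').isClosed.isOpen_compl
      · have e : {y | T' ≠ T → y ∉ T'.hull} = Set.univ := by
          ext y; simp only [Set.mem_ofPred_eq, Set.mem_univ, iff_true]; tauto
        rw [e]; exact isOpen_univ
    · by_cases h : F'.IsSub T ∧ F' ≠ F
      · have e : {y | F'.IsSub T → F' ≠ F → y ∉ F'.hull} = F'.hullᶜ := by
          ext y; exact ⟨fun hy => hy h.1 h.2, fun hy _ _ => hy⟩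
        rw [e]; exact (isCompact_simp_hull F').isClosed.isOpen_compl
      · have : {y | F'.IsSub T → F' ≠ F → y ∉ F'.hull} = Set.univ := by
          ext y; simp only [Set.mem_ofPred_eq, Set.mem_univ, iff_true]; tauto
        rw [this]; exact isOpen_univ
  -- All vertices of F have positive coordinates at x₀, so any cell, or any face of T, that contains
  -- x₀ contains all of them.
  · refine ⟨Set.mem_iInter.2 fun T' hne h => hne ?_, Set.mem_iInter.2 fun F' hs hne h => hne ?_⟩
    · refine hF.unique (fun z hz => ?_) hT
      exact mem_of_coord_pos (hull_mono hT hx₀) h (hpos ⟨z, hT hz⟩ hz)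
    · refine (Simp.ext (Finset.eq_of_subset_of_card_le (fun z hz => ?_)
        (by rw [F'.2.2, F.2.2]))).symm
      by_contra hn
      exact (hpos ⟨z, hT hz⟩ hz).ne' (coord_eq_zero T (Finset.coe_subset.2 hs) hn h)
  · exact fun T' hne y hy => Set.mem_iInter.1 hy.1 T' hne
  · exact fun F' hs hne y hy => Set.mem_iInter.1 hy.2 F' hs hne

/-! ### Integrals over the domain -/

theorem interior_hull_ae_eq (T : M.Cell) :
    (interior T.hull : Set E3) =ᵐ[volume] T.hull :=
  interior_ae_eq_of_null_frontier ((convex_convexHull ℝ _).addHaar_frontier volume)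

theorem interior_hull_subset (T : M.Cell) : interior T.hull ⊆ Ω := by
  have h := interior_mono (M.cplx.convexHull_subset_space T.2.1)
  rwa [M.interior_space] at h

/-- Every simplex lies in a cell, and cells are convex, so their frontiers are null sets. -/
theorem omega_ae_eq : Ω =ᵐ[volume] (⋃ T : M.Cell, interior T.hull : Set E3) := by
  refine Filter.EventuallyLE.antisymm ?_ (Set.iUnion_subset interior_hull_subset).eventuallyLE
  have h1 : Ω ⊆ ⋃ T : M.Cell, T.hull := by
    intro x hx
    have hx' : x ∈ M.cplx.space := by rw [M.space_eq]; exact subset_closure hx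
    obtain ⟨s, hs, hxs⟩ := Geometry.SimplicialComplex.mem_space_iff.1 hx'
    obtain ⟨t, ht, hst, hc⟩ := M.pure s hs
    exact Set.mem_iUnion.2 ⟨⟨t, ht, hc⟩, convexHull_mono (Finset.coe_subset.2 hst) hxs⟩
  refine h1.eventuallyLE.trans ?_
  exact (Filter.EventuallyEq.countable_iUnion fun T => (interior_hull_ae_eq T).symm).le

theorem pairwise_disjoint_interior :
    Pairwise (Function.onFun Disjoint fun T : M.Cell => interior T.hull) := fun _ _ hne =>
  Set.disjoint_left.2 fun _ h h' => hne (eq_of_mem_interior h (interior_subset h'))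

/-- Integrals over the domain are sums of integrals over the cells. -/
theorem setIntegral_omega (K : M.Broken ℝ) (hK : ∀ T, Continuous (K T)) {H : E3 → ℝ}
    (h : ∀ T, ∀ x ∈ interior T.hull, H x = K T x) :
    ∫ x in Ω, H x = ∑ T : M.Cell, ∫ x in T.hull, K T x := by
  rw [setIntegral_congr_set (omega_ae_eq (M := M)), integral_iUnion_fintype
    (fun T => isOpen_interior.measurableSet) pairwise_disjoint_interior]
  · refine Finset.sum_congr rfl fun T _ => ?_
    rw [setIntegral_congr_fun isOpen_interior.measurableSet (h T),
      setIntegral_congr_set (interior_hull_ae_eq T)]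
  · intro T
    exact ((integrableOn_hull T.1 (hK T)).mono_set interior_subset).congr_fun
      (fun x hx => (h T x hx).symm) isOpen_interior.measurableSet

theorem memLp_glue (v : M.Broken E3) (hv : ∀ T, Continuous (v T)) :
    MemLp (glue v) 2 (volume.restrict Ω) := by
  refine MemLp.restrict Ω ?_
  refine memLp_finsetSum _ fun T _ => ?_
  rw [memLp_indicator_iff_restrict isOpen_interior.measurableSet]
  have hc := isCompact_simp_hull T
  refine MemLp.mono_measure (Measure.restrict_mono interior_subset le_rfl) ?_
  obtain ⟨C, hC⟩ := hc.exists_bound_of_continuousOn (hv T).continuousOn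
  have : IsFiniteMeasure ((volume : Measure E3).restrict T.hull) :=
    ⟨by rw [Measure.restrict_apply_univ]; exact hc.measure_lt_top⟩
  exact MemLp.of_bound (hv T).aestronglyMeasurable C
    ((ae_restrict_mem (measurableSet_hull T)).mono fun x hx => hC x hx)

/-- A nonnegative continuous function that is positive somewhere on a face has a positive integral
over the face. -/
theorem setIntegral_face_pos (F : M.Face) {φ : E3 → ℝ} (hφ : Continuous φ)
    (h0 : ∀ x ∈ F.hull, 0 ≤ φ x) {x₀ : E3} (hx₀ : x₀ ∈ F.hull) (hpos : 0 < φ x₀) : 0 < ∫ x in F.hull, φ x ∂μHE[2] := by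
  obtain ⟨a, b, c, -, -, -, -, hset, hi⟩ := exists_three F
  have hF : F.hull = simplexMap ![a, b, c] '' corner 2 := by
    rw [simplexMap_image, range_three, Simp.hull, hset]
  have hF' : F.hull = convexHull ℝ {a, b, c} := by rw [Simp.hull, hset]
  rw [hF', setIntegral_triangle hi, smul_eq_mul]
  refine mul_pos (norm_cross_pos hi) ?_
  have hs : Continuous (simplexMap ![a, b, c]) := by unfold simplexMap; fun_prop
  rw [hF] at hx₀ h0
  obtain ⟨y₀, hy₀, rfl⟩ := hx₀
  have hconv : Convex ℝ (corner 2) := convex_corner 2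
  have hne : (interior (corner 2)).Nonempty := by
    refine ⟨fun _ => 1 / 3, mem_interior.2 ⟨{y | (∀ i, 0 < y i) ∧ ∑ i, y i < 1}, ?_, ?_, ?_⟩⟩
    · exact fun y hy => ⟨fun i => (hy.1 i).le, hy.2.le⟩
    · have e : {y : Fin 2 → ℝ | (∀ i, 0 < y i) ∧ ∑ i, y i < 1} =
          (⋂ i, {y | 0 < y i}) ∩ {y | ∑ i, y i < 1} := by ext y; simp
      rw [e]
      refine (isOpen_iInter_of_finite fun i => ?_).inter ?_
      · exact isOpen_lt continuous_const (continuous_apply i)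
      · exact isOpen_lt (by fun_prop) continuous_const
    · constructor
      · intro i; norm_num
      · simp; norm_num
  rw [cornerInt, setIntegral_pos_iff_support_of_nonneg_ae
    ((ae_restrict_mem (isClosed_corner 2).measurableSet).mono fun y hy => h0 _ ⟨y, hy, rfl⟩)
    (integrableOn_corner (hφ.comp hs))]
  have hopen : IsOpen (Function.support fun y => φ (simplexMap ![a, b, c] y)) :=
    (hφ.comp hs).isOpen_support
  -- The given point may lie on the rim of the face. As the corner is convex with nonempty interior,
  -- the open support of the integrand still meets the interior.
  have hcl : y₀ ∈ closure (interior (corner 2)) := by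
    rw [hconv.closure_interior_eq_closure_of_nonempty_interior hne]
    exact subset_closure hy₀
  have hne2 := mem_closure_iff.1 hcl _ hopen hpos.ne'
  refine lt_of_lt_of_le ((hopen.inter isOpen_interior).measure_pos volume hne2) (measure_mono ?_)
  exact Set.inter_subset_inter_right _ interior_subset

end TetMesh

end QuadCurl

end

noncomputable section

namespace QuadCurl

namespace TetMesh

variable {Ω : Set E3} {M : TetMesh Ω}

/-! ### Green's formula and tangential continuity -/

open scoped Classical in
/-- The sum over the cells of the boundary terms in Green's formula for the curl. -/
def bdryTerm (u : M.Broken E3) (θ : E3 → E3) : ℝ :=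
  ∑ T : M.Cell, ∑ F : M.Face with F.IsSub T,
    ∫ x in F.hull, inner ℝ (nOut T F) (cross (θ x) (u T x)) ∂μHE[2]

/-- The divergence theorem is applied on each cell to θ × u, whose divergence is u · curl θ - θ ·
curl u. -/
theorem green_omega {u : M.Broken E3} (hu : ∀ T, ContDiff ℝ 1 (u T)) {θ : E3 → E3}
    (hθ : ContDiff ℝ 1 θ) : ∫ x in Ω, inner ℝ (glue u x) (curl θ x) =
      (∫ x in Ω, inner ℝ (glue (curlH u) x) (θ x)) + bdryTerm u θ := by
  have hcθ : Continuous (curl θ) := continuous_curl hθ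
  have hcu : ∀ T, Continuous (curl (u T)) := fun T => continuous_curl (hu T)
  have hθc := hθ.continuous
  have huc := fun T => (hu T).continuous
  have h1 : ∀ T, Continuous fun x => inner ℝ (u T x) (curl θ x) := fun T =>
    (huc T).inner hcθ
  have h2 : ∀ T, Continuous fun x => inner ℝ (curl (u T) x) (θ x) := fun T =>
    (hcu T).inner hθc
  rw [setIntegral_omega (M := M) (fun T x => inner ℝ (u T x) (curl θ x)) h1
      (fun T x hx => by rw [glue_eq u hx]),
    setIntegral_omega (M := M) (fun T x => inner ℝ (curl (u T) x) (θ x)) h2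
      (fun T x hx => by rw [glue_eq (curlH u) hx]; rfl), bdryTerm, ← Finset.sum_add_distrib]
  refine Finset.sum_congr rfl fun T _ => ?_
  rw [← integral_divVec_cell T (contDiff_cross hθ (hu T)), add_comm, ← sub_eq_iff_eq_add,
    ← integral_sub (μ := volume.restrict T.hull) (integrableOn_hull T.1 (h1 T))
      (integrableOn_hull T.1 (h2 T))]
  refine integral_congr_ae (Filter.Eventually.of_forall fun x => ?_)
  have := divVec_cross (hθ.differentiable (by norm_num) x) ((hu T).differentiable (by norm_num) x)
  simp only [this, real_inner_comm (θ x)]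

open scoped Classical in
theorem sum_cells_faces {G : Type*} [AddCommMonoid G] (f : M.Cell → M.Face → G) :
    ∑ T : M.Cell, ∑ F : M.Face with F.IsSub T, f T F =
      ∑ F : M.Face, ∑ T : M.Cell with F.IsSub T, f T F :=
  Finset.sum_comm' (by simp)

theorem inner_nOut_cross (T : M.Cell) (F : M.Face) (a b : E3) :
    inner ℝ (nOut T F) (cross a b) = sgn T F * inner ℝ a (cross b (nF F)) := by
  rw [nOut, inner_smul_left, conj_trivial]
  congr 1
  simp [inner_eq]; ring

theorem isBdryEdge_of_isSub {F : M.Face} (hF : IsBdryFace F) {e : M.Edge} (he : e.IsSub F) :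
    IsBdryEdge e := ⟨F, hF, he⟩

theorem isSub_trans {l m n : ℕ} {r : M.Simp l} {s : M.Simp m} {t : M.Simp n} (h : r.IsSub s)
    (h' : s.IsSub t) : r.IsSub t := fun _ hx => h' (h hx)

theorem edgeVanish_of_isBdryFace {ℓ : ℕ} (hℓ : ℓ = 0 ∨ ℓ = 1) {u : E3 → E3} (hu : Continuous u)
    {F : M.Face} (h : ∀ e : M.Edge, e.IsSub F → ∀ q, IsPoly ℓ q → edgeDof e u q = 0) :
    ∀ a ∈ F.1, ∀ b ∈ F.1, EdgeVanish ℓ a b u := by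
  have h1 := (simp_edges_iff hℓ F hu (v := 0) continuous_const).1 fun e he q hq => by
    rw [h e he q hq, edgeDof_zero]
  simpa using h1

/-- Only tangential traces enter. On boundary faces they vanish with the edge moments; on interior
faces they agree from both sides and the outward signs cancel. -/
theorem bdryTerm_eq_zero {ℓ : ℕ} (hℓ : ℓ = 0 ∨ ℓ = 1) {u : M.Broken E3}
    (hu : ∀ T, IsNedelec ℓ (u T)) (hs : EdgeDofsSingleValued ℓ u)
    (hb : ∀ (e : M.Edge) (T : M.Cell), IsBdryEdge e → e.IsSub T →
      ∀ q, IsPoly ℓ q → edgeDof e (u T) q = 0) (θ : E3 → E3) : bdryTerm u θ = 0 := by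
  classical
  have huc := fun T => ((hu T).contDiff hℓ).continuous
  rw [bdryTerm, sum_cells_faces]
  refine Finset.sum_eq_zero fun F _ => ?_
  simp only [inner_nOut_cross]
  by_cases hF : IsBdryFace F
  · refine Finset.sum_eq_zero fun T hT => ?_
    have hT' : F.IsSub T := (Finset.mem_filter.1 hT).2
    have h1 := edgeVanish_of_isBdryFace hℓ (huc T) fun e he q hq =>
      hb e T (isBdryEdge_of_isSub hF he) (isSub_trans he hT') q hq
    refine setIntegral_eq_zero_of_forall_eq_zero fun x hx => ?_
    rw [IsNedelec.cross_eq_zero hℓ (hu T) F h1 hx]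
    simp
  · obtain ⟨T₀, hT₀⟩ := exists_cell F
    have h1 : ∀ T ∈ (Finset.univ.filter fun T : M.Cell => F.IsSub T),
        ∫ x in F.hull, sgn T F * inner ℝ (θ x) (cross (u T x) (nF F)) ∂μHE[2] =
          sgn T F * ∫ x in F.hull, inner ℝ (θ x) (cross (u T₀ x) (nF F)) ∂μHE[2] := by
      intro T hT
      have hT' : F.IsSub T := (Finset.mem_filter.1 hT).2
      have h2 := (simp_edges_iff hℓ F (huc T) (huc T₀)).1 fun e he q hq =>
        hs e T T₀ (isSub_trans he hT') (isSub_trans he hT₀) q hq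
      rw [← integral_const_mul]
      refine setIntegral_congr_fun (measurableSet_hull F) fun x hx => ?_
      have h3 := IsNedelec.cross_eq_zero hℓ ((hu T).sub hℓ (hu T₀)) F h2 hx
      have h4 : cross (u T x) (nF F) = cross (u T₀ x) (nF F) := by
        rw [← sub_eq_zero, ← h3]
        apply E3_ext <;> simp <;> ring
      simp only [h4]
    rw [Finset.sum_congr rfl h1, ← Finset.sum_mul, sum_sgn_eq_zero hF, zero_mul]

/-- The weak curl of a piecewise smooth function is its elementwise curl, and therefore the boundary
terms in Green's formula cancel. -/
theorem bdryTerm_eq_zero_of_memH0Curl {u : M.Broken E3} (hu : ∀ T, ContDiff ℝ 1 (u T))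
    (h : MemH0Curl Ω (glue u)) {θ : E3 → E3} (hθ : ContDiff ℝ ∞ θ) (hθc : HasCompactSupport θ) :
    bdryTerm u θ = 0 := by
  classical
  obtain ⟨-, g, hg, hgθ⟩ := h
  set k := glue (curlH u) with hk
  have hkL : MemLp k 2 (volume.restrict Ω) := memLp_glue _ fun T => continuous_curl (hu T)
  have hone : (1 : WithTop ℕ∞) ≤ ∞ := by exact_mod_cast le_top
  have hΩ : IsOpen Ω := M.interior_space ▸ isOpen_interior
  have hΩfin : IsFiniteMeasure ((volume : Measure E3).restrict Ω) := by
    refine ⟨?_⟩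
    rw [Measure.restrict_apply_univ, measure_congr (omega_ae_eq (M := M))]
    refine (measure_iUnion_fintype_le _ _).trans_lt (ENNReal.sum_lt_top.2 fun T _ => ?_)
    exact (measure_mono interior_subset).trans_lt (isCompact_simp_hull T).measure_lt_top
  have hfint : ∀ f : E3 → E3, MemLp f 2 (volume.restrict Ω) → ∀ η : E3 → E3, Continuous η →
      HasCompactSupport η → IntegrableOn (fun x => inner ℝ (f x) (η x)) Ω := by
    intro f hf η hη hηc
    obtain ⟨C, hC⟩ := hηc.exists_bound_of_continuous hη
    have hf1 : Integrable f (volume.restrict Ω) := hf.integrable (by norm_num)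
    refine (hf1.norm.mul_const C).mono'
      (hf1.aestronglyMeasurable.inner hη.aestronglyMeasurable) (Filter.Eventually.of_forall
        fun x => (norm_inner_le_norm _ _).trans ?_)
    exact mul_le_mul_of_nonneg_left (hC x) (norm_nonneg _)
  -- The boundary term measures the difference between the weak curl g and the elementwise curl k.
  have hkey : ∀ η : E3 → E3, ContDiff ℝ ∞ η → HasCompactSupport η →
      ∫ x in Ω, inner ℝ (g x - k x) (η x) = bdryTerm u η := by
    intro η hη hηc
    simp only [inner_sub_left]
    rw [integral_sub (hfint g hg η hη.continuous hηc) (hfint k hkL η hη.continuous hηc),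
      ← hgθ η hη hηc, green_omega hu (hη.of_le hone)]
    ring
  have hU : IsOpen (⋃ T : M.Cell, interior T.hull : Set E3) :=
    isOpen_iUnion fun T => isOpen_interior
  have hUΩ : (⋃ T : M.Cell, interior T.hull : Set E3) ⊆ Ω := Set.iUnion_subset interior_hull_subset
  have hd : Integrable (fun x => g x - k x) (volume.restrict Ω) :=
    (hg.sub hkL).integrable (by norm_num)
  -- Test fields supported inside the cells do not see any face, so g = k almost everywhere. Then
  -- `hkey` makes the boundary term vanish for all test fields.
  have hae : ∀ᵐ x : E3, x ∈ (⋃ T : M.Cell, interior T.hull : Set E3) → g x - k x = 0 := by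
    refine hU.ae_eq_zero_of_integral_contDiff_smul_eq_zero
      ((IntegrableOn.mono_set hd hUΩ).locallyIntegrableOn) ?_
    intro ψ hψ hψc hψU
    refine ext_inner_left ℝ fun a => ?_
    have hψb : ∀ x, x ∉ (⋃ T : M.Cell, interior T.hull : Set E3) → ψ x = 0 := fun x hx =>
      image_eq_zero_of_notMem_tsupport fun h' => hx (hψU h')
    have e1 : ∫ x, ψ x • (g x - k x) = ∫ x in Ω, ψ x • (g x - k x) := by
      refine (setIntegral_eq_integral_of_forall_compl_eq_zero fun x hx => ?_).symm
      rw [hψb x fun h' => hx (hUΩ h'), zero_smul]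
    have hψa : ContDiff ℝ ∞ fun x => ψ x • a := hψ.smul contDiff_const
    have hψac : HasCompactSupport fun x => ψ x • a := hψc.smul_right
    obtain ⟨C, hC⟩ := hψc.exists_bound_of_continuous hψ.continuous
    have hi : Integrable (fun x => ψ x • (g x - k x)) (volume.restrict Ω) :=
      hd.bdd_smul C hψ.continuous.aestronglyMeasurable (Filter.Eventually.of_forall hC)
    rw [e1, inner_zero_right, ← integral_inner hi]
    have e2 : ∀ x, inner ℝ a (ψ x • (g x - k x)) = inner ℝ (g x - k x) (ψ x • a) := fun x => by
      rw [inner_smul_right, inner_smul_right, real_inner_comm]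
    simp only [e2]
    rw [hkey _ hψa hψac, bdryTerm]
    refine Finset.sum_eq_zero fun T _ => Finset.sum_eq_zero fun F hF => ?_
    have hF' : F.IsSub T := (Finset.mem_filter.1 hF).2
    refine setIntegral_eq_zero_of_forall_eq_zero fun x hx => ?_
    have h0 : ψ x = 0 := by
      refine hψb x fun hxU => ?_
      obtain ⟨T', hT'⟩ := Set.mem_iUnion.1 hxU
      have hTT := eq_of_mem_interior hT' (hull_mono hF' hx)
      subst hTT
      obtain ⟨z, rfl⟩ := exists_faceOpp hF'
      refine (mem_interior_hull_iff.1 hT' z).ne' (coord_eq_zero T' (Finset.coe_subset.2 hF') ?_ hx)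
      rw [faceOpp_val]; simp
    have h1 : cross (0 : E3) (u T x) = 0 := by apply E3_ext <;> simp
    rw [h0, zero_smul, h1, inner_zero_right]
  rw [← hkey θ hθ hθc]
  refine integral_eq_zero_of_ae ?_
  have h1 : ∀ᵐ x ∂((volume : Measure E3).restrict Ω), g x - k x = 0 := by
    rw [Measure.restrict_congr_set (omega_ae_eq (M := M)),
      ae_restrict_iff' hU.measurableSet]
    exact hae
  filter_upwards [h1] with x hx
  simp [hx]

/-- For a nonzero trace a at x₀, take θ = η a with a bump η supported where no other relevant face
is near and where the trace has positive product with a. The boundary term then reduces to one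
integral over F, which is positive up to sign. -/
theorem cross_nF_eq_zero_of_pos {u : M.Broken E3} (hu : ∀ T, ContDiff ℝ 1 (u T))
    (h : MemH0Curl Ω (glue u)) {F : M.Face} (hF : IsBdryFace F) {T : M.Cell} (hT : F.IsSub T)
    {x₀ : E3} (hx₀ : x₀ ∈ F.hull) (hpos : ∀ z : T.1, (z : E3) ∈ F.1 → 0 < T.basis.coord z x₀) :
    cross (u T x₀) (nF F) = 0 := by
  classical
  by_contra hne
  set a := cross (u T x₀) (nF F) with ha
  obtain ⟨V, hV, hxV, hV1, hV2⟩ := exists_nhds_bdry hF hT hx₀ hpos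
  have huc := (hu T).continuous
  have hc : Continuous fun x => inner ℝ a (cross (u T x) (nF F)) := by fun_prop
  have hO : IsOpen (V ∩ {x | 0 < inner ℝ a (cross (u T x) (nF F))}) :=
    hV.inter (isOpen_lt continuous_const hc)
  have hxO : x₀ ∈ V ∩ {x | 0 < inner ℝ a (cross (u T x) (nF F))} :=
    ⟨hxV, by
      change 0 < inner ℝ a (cross (u T x₀) (nF F))
      rw [← ha]; exact real_inner_self_pos.2 hne⟩
  obtain ⟨η, hηs, hηc, hη, hηr, hη1⟩ := exists_contDiff_tsupport_subset (n := ⊤) (hO.mem_nhds hxO)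
  have hη0 : ∀ x, x ∉ V ∩ {x | 0 < inner ℝ a (cross (u T x) (nF F))} → η x = 0 := fun x hx =>
    image_eq_zero_of_notMem_tsupport fun h' => hx (hηs h')
  have hηn : ∀ x, 0 ≤ η x := fun x => (hηr ⟨x, rfl⟩).1
  have hz := bdryTerm_eq_zero_of_memH0Curl hu h (θ := fun x => η x • a)
    (hη.smul contDiff_const) hηc.smul_right
  have hc0 : ∀ b : E3, cross (0 : E3) b = 0 := fun b => by apply E3_ext <;> simp
  rw [bdryTerm, Finset.sum_eq_single T, Finset.sum_eq_single F] at hz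
  · simp only [inner_nOut_cross, inner_smul_left, conj_trivial] at hz
    rw [integral_const_mul] at hz
    have hp : 0 < ∫ x in F.hull, η x * inner ℝ a (cross (u T x) (nF F)) ∂μHE[2] := by
      refine setIntegral_face_pos F (hη.continuous.mul hc) (fun x _ => ?_) hx₀ ?_
      · by_cases hx : x ∈ V ∩ {x | 0 < inner ℝ a (cross (u T x) (nF F))}
        · exact mul_nonneg (hηn x) hx.2.le
        · rw [hη0 x hx, zero_mul]
      · rw [hη1, one_mul]; exact hxO.2
    rcases mul_eq_zero.1 hz with h1 | h1
    · rcases sgn_eq_or T F with h2 | h2 <;> rw [h2] at h1 <;> norm_num at h1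
    · exact hp.ne' h1
  · intro F' hF' hne'
    refine setIntegral_eq_zero_of_forall_eq_zero fun x hx => ?_
    rw [hη0 x fun h' => hV2 F' (Finset.mem_filter.1 hF').2 hne' x h'.1 hx, zero_smul, hc0,
      inner_zero_right]
  · intro h'; exact absurd (Finset.mem_filter.2 ⟨Finset.mem_univ F, hT⟩) h'
  · intro T' _ hne'
    refine Finset.sum_eq_zero fun F' hF' => setIntegral_eq_zero_of_forall_eq_zero fun x hx => ?_
    rw [hη0 x fun h' => hV1 T' hne' x h'.1 (hull_mono (Finset.mem_filter.1 hF').2 hx), zero_smul,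
      hc0, inner_zero_right]
  · simp

/-- Points on the way from the barycentre to x are in the relative interior of F, and x is reached
by continuity. -/
theorem cross_nF_eq_zero {u : M.Broken E3} (hu : ∀ T, ContDiff ℝ 1 (u T))
    (h : MemH0Curl Ω (glue u)) {F : M.Face} (hF : IsBdryFace F) {T : M.Cell} (hT : F.IsSub T)
    {x : E3} (hx : x ∈ F.hull) : cross (u T x) (nF F) = 0 := by
  classical
  have huc := (hu T).continuous
  have hc : Continuous fun t : ℝ => cross (u T (AffineMap.lineMap (bary F) x t)) (nF F) := by
    have : Continuous fun t : ℝ => (AffineMap.lineMap (bary F) x t : E3) :=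
      AffineMap.lineMap_continuous
    fun_prop
  have h1 : ∀ t ∈ Set.Ico (0 : ℝ) 1, cross (u T (AffineMap.lineMap (bary F) x t)) (nF F) = 0 := by
    intro t ht
    have hxT := mem_hull_iff.1 (hull_mono hT hx)
    refine cross_nF_eq_zero_of_pos hu h hF hT
      ((convex_convexHull ℝ _).lineMap_mem (bary_mem_hull F) hx ⟨ht.1, ht.2.le⟩) fun z hz => ?_
    obtain ⟨y, rfl⟩ := exists_faceOpp hT
    have hb := coord_bary T y z
    have hyz : y ≠ z := fun h' => by
      rw [h', faceOpp_val] at hz; simp at hz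
    rw [if_neg hyz] at hb
    have e : T.basis.coord z (AffineMap.lineMap (bary (faceOpp T y)) x t) =
        t * (T.basis.coord z x - 1 / 3) + 1 / 3 := by
      refine (AffineMap.apply_lineMap (T.basis.coord z) _ _ _).trans ?_
      rw [hb, AffineMap.lineMap_apply]; rfl
    refine lt_of_lt_of_eq ?_ e.symm
    have h2 := hxT z
    have h3 := mul_nonneg ht.1 h2
    have h4 := ht.2
    nlinarith
  have h2 : Set.EqOn (fun t : ℝ => cross (u T (AffineMap.lineMap (bary F) x t)) (nF F))
      (fun _ => 0) (closure (Set.Ico 0 1)) :=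
    Set.EqOn.closure (fun t ht => h1 t ht) hc continuous_const
  have h3 := h2 (x := 1) (by rw [closure_Ico (by norm_num)]; exact ⟨zero_le_one, le_rfl⟩)
  simpa using h3

/-- Nédélec functions in `H₀(curl)` are those whose edge moments are single-valued and vanish on the
boundary. -/
theorem mem_nedelec0_iff {ℓ : ℕ} (hℓ : ℓ = 0 ∨ ℓ = 1) {u : M.Broken E3} :
    u ∈ nedelec0 (M := M) ℓ ↔ (∀ T, IsNedelec ℓ (u T)) ∧ EdgeDofsSingleValued ℓ u ∧
      ∀ (e : M.Edge) (T : M.Cell), IsBdryEdge e → e.IsSub T →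
        ∀ q, IsPoly ℓ q → edgeDof e (u T) q = 0 := by
  have hone : (1 : WithTop ℕ∞) ≤ ∞ := by exact_mod_cast le_top
  constructor
  · rintro ⟨hu, hs, hm⟩
    refine ⟨hu, hs, ?_⟩
    rintro e T ⟨F, hF, heF⟩ heT q hq
    obtain ⟨T', hT'⟩ := exists_cell F
    -- The trace is known from the cell T' at the boundary face; single-valuedness carries the
    -- moment over to T.
    rw [hs e T T' heT (isSub_trans heF hT') q hq]
    refine setIntegral_eq_zero_of_forall_eq_zero fun x hx => ?_
    have h1 := cross_nF_eq_zero (fun T => ((hu T).contDiff hℓ).of_le hone) hm hF hT'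
      (hull_mono heF hx)
    -- Without tangential trace the field is normal to F, hence orthogonal to the tangent of e.
    have h2 : u T' x = inner ℝ (nF F) (u T' x) • nF F := by
      have h3 := eq_of_cross_nF F (u T' x)
      have h4 : cross (nF F) (0 : E3) = 0 := by apply E3_ext <;> simp
      rwa [cross_neg_swap (nF F) (u T' x), h1, neg_zero, h4, sub_zero] at h3
    obtain ⟨a, ha, b, hb, hab⟩ := Finset.one_lt_card.1 (by rw [e.2.2]; norm_num : 1 < e.1.card)
    obtain ⟨r, hr⟩ := M.tangent_parallel e.1 e.2.1 e.2.2 b hb a ha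
    have hr0 : r ≠ 0 := fun h0 => hab (by rw [h0, zero_smul, sub_eq_zero] at hr; exact hr.symm)
    have h5 := nF_orth F (heF hb) (heF ha)
    rw [hr, inner_smul_right] at h5
    have h6 : inner ℝ (nF F) (tE e) = 0 := (mul_eq_zero.1 h5).resolve_left hr0
    rw [h2, inner_smul_left, h6, mul_zero, zero_mul]
  · rintro ⟨hu, hs, hb⟩
    have hsm := fun T => ((hu T).contDiff hℓ).of_le hone
    refine ⟨hu, hs, memLp_glue _ fun T => (hsm T).continuous, glue (curlH u),
      memLp_glue _ fun T => continuous_curl (hsm T), fun θ hθ _ => ?_⟩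
    rw [green_omega hsm (hθ.of_le hone), bdryTerm_eq_zero hℓ hu hs hb, add_zero]

end TetMesh

end QuadCurl

end

noncomputable section

namespace QuadCurl

namespace TetMesh

variable {Ω : Set E3} {M : TetMesh Ω} {ℓ : ℕ} {c : M.Cell → E3}

/-! ### The discrete spaces -/

theorem one_le_infty : (1 : WithTop ℕ∞) ≤ ∞ := by exact_mod_cast le_top

theorem interp_mem_nedelec0 (hℓ : ℓ = 0 ∨ ℓ = 1) {w : M.Broken E3} (hw : w ∈ wSpace ℓ c) :
    interp ℓ w ∈ nedelec0 (M := M) ℓ := by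
  obtain ⟨h1, h2, -, h4, -⟩ := hw
  have hs := fun T => interp_spec hℓ w T ((h1 T).contDiff hℓ).continuous
  refine (mem_nedelec0_iff hℓ).2 ⟨fun T => (hs T).1, ?_, ?_⟩
  · intro e T T' hT hT' q hq
    rw [(hs T).2 e hT q hq, (hs T').2 e hT' q hq, h2 e T T' hT hT' q hq]
  · intro e T he hT q hq
    rw [(hs T).2 e hT q hq, h4 e T he hT q hq]

theorem inner_projF_cross_nF (F : M.Face) {g : E3 → E3} (hg : Continuous g) :
    inner ℝ (projF F fun x => cross (nF F) (g x)) (nF F) = 0 := by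
  rw [real_inner_comm, inner_projF F _ (by fun_prop)]
  have h : ∀ x, inner ℝ (nF F) (cross (nF F) (g x)) = 0 := fun x => by
    rw [real_inner_comm, inner_cross_left]
  simp [h, faceAvg]

/-- Up to the nonzero factor in `faceDof_eq` the projection is the face moment, which is
single-valued and vanishes on the boundary; any adjacent cell may be used. -/
theorem exists_isProjNCurl (hℓ : ℓ = 0 ∨ ℓ = 1) {w : M.Broken E3} (hw : w ∈ wSpace ℓ c) :
    ∃ μ ∈ lambda0 (M := M), IsProjNCurl w μ := by
  obtain ⟨h1, -, h3, -, h5⟩ := hw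
  choose S hS using fun F : M.Face => exists_cell F
  refine ⟨fun F => projF F (fun x => cross (nF F) (curl (w (S F)) x)), ⟨fun F _ => ?_,
    fun F hF => ?_⟩, fun F T hT => ?_⟩
  · exact inner_projF_cross_nF F
      (continuous_curl (((h1 _).contDiff hℓ).of_le one_le_infty))
  · have h := h5 F (S F) hF (hS F)
    rw [faceDof_eq] at h
    exact (smul_eq_zero.1 h).resolve_left (neg_ne_zero.2 (area_pos F).ne')
  · have h := h3 F (S F) T (hS F) hT
    rw [faceDof_eq, faceDof_eq] at h
    exact smul_right_injective E3 (neg_ne_zero.2 (area_pos F).ne') h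

theorem IsProjNCurl.unique {w : M.Broken E3} {μ μ' : M.Face → E3} (h : IsProjNCurl w μ)
    (h' : IsProjNCurl w μ') : μ = μ' := by
  funext F
  obtain ⟨T, hT⟩ := exists_cell F
  rw [h F T hT, h' F T hT]

theorem mem_sigma0_iff {τ : M.Broken Mat3} : τ ∈ sigma0 (M := M) ↔
    ∃ t : M.Cell → Mat3, τ = (fun T _ => t T) ∧ ∀ T, (t T).trace = 0 := by
  constructor
  · intro h
    choose t ht using fun T i j => ((h T).1 i j).exists_const
    refine ⟨fun T => Matrix.of (t T), ?_, fun T => ?_⟩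
    · funext T x; ext i j; exact ht T i j x
    · have h2 := (h T).2 0
      have h3 : τ T 0 = Matrix.of (t T) := by ext i j; exact ht T i j 0
      rwa [h3] at h2
  · rintro ⟨t, rfl, ht⟩ T
    exact ⟨fun i j => IsPoly.const _ _, fun _ => ht T⟩

theorem gradCurl_mem_sigma0 (hℓ : ℓ = 0 ∨ ℓ = 1) {w : M.Broken E3} (hw : w ∈ wSpace ℓ c) :
    gradVecH (curlH w) ∈ sigma0 (M := M) := by
  choose g A hA hg using fun T => (hw.1 T).exists_curl hℓ
  refine mem_sigma0_iff.2 ⟨A, ?_, hA⟩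
  funext T x
  change gradVec (curl (w T)) x = A T
  rw [hg T, gradVec_affField]

theorem zero_mem_lagrange0 : (0 : M.Broken ℝ) ∈ lagrange0 (M := M) ℓ := by
  have h : glue (0 : M.Broken ℝ) = 0 := by
    funext x; simp [glue]
  refine ⟨fun T => IsPoly.const _ _, ?_⟩
  rw [h]
  refine ⟨MemLp.zero, 0, MemLp.zero, fun θ _ _ => ?_⟩
  simp

theorem zero_mem_sigma0 : (0 : M.Broken Mat3) ∈ sigma0 (M := M) :=
  mem_sigma0_iff.2 ⟨0, rfl, fun _ => Matrix.trace_zero _ _⟩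

theorem ipVec_comm (u v : M.Broken E3) : ipVec u v = ipVec v u := by
  simp only [ipVec, real_inner_comm]

theorem frob_comm (A B : Mat3) : frob A B = frob B A := by
  simp only [frob, mul_comm]

theorem ipMat_comm (σ τ : M.Broken Mat3) : ipMat σ τ = ipMat τ σ := by
  simp only [ipMat, frob_comm]

theorem ipVec_gradH_zero (u : M.Broken E3) : ipVec (gradH (0 : M.Broken ℝ)) u = 0 := by
  have h : ∀ (T : M.Cell) (x : E3), gradH (0 : M.Broken ℝ) T x = 0 := fun T x => by
    change gradient (fun _ => (0 : ℝ)) x = 0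
    exact gradient_fun_const _ _
  simp [ipVec, h]

theorem ipMat_zero (σ : M.Broken Mat3) : ipMat σ 0 = 0 := by
  simp [ipMat, frob]

theorem ipMat_const (s t : M.Cell → Mat3) :
    ipMat (M := M) (fun T _ => s T) (fun T _ => t T) = ∑ T, vol T * frob (s T) (t T) := by
  simp [ipMat, vol]

/-! ### Integration by parts on the nonconforming space -/

/-- By Stokes the flux of the curl through F depends only on edge moments, and interpolation keeps
these. This lets I_h w replace w in the normal-normal term. -/
theorem setIntegral_inner_curl_interp (hℓ : ℓ = 0 ∨ ℓ = 1) {w : M.Broken E3}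
    (hw : w ∈ wSpace ℓ c) {T : M.Cell} {F : M.Face} (hF : F.IsSub T) :
    ∫ x in F.hull, inner ℝ (nF F) (curl (w T) x) ∂μHE[2] =
      ∫ x in F.hull, inner ℝ (nF F) (curl (interp ℓ w T) x) ∂μHE[2] := by
  have hwc := (hw.1 T).contDiff hℓ
  have hs := interp_spec hℓ w T hwc.continuous
  have hu := hs.1.contDiff hℓ
  have h1 := (simp_edges_iff hℓ F hwc.continuous hu.continuous).1 fun e he q hq =>
    (hs.2 e (isSub_trans he hF) q hq).symm
  have h2 := faceAvg_inner_curl_eq_zero F (v := w T - interp ℓ w T) ((hwc.sub hu).of_le one_le_infty) h1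
  have c1 := continuous_curl (hwc.of_le one_le_infty)
  have c2 := continuous_curl (hu.of_le one_le_infty)
  have h3 : ∫ x in F.hull, inner ℝ (nF F) (curl (w T - interp ℓ w T) x) ∂μHE[2] = 0 := by
    rw [integral_face_eq, h2, mul_zero]
  have h4 : ∀ x, inner ℝ (nF F) (curl (w T - interp ℓ w T) x) =
      inner ℝ (nF F) (curl (w T) x) - inner ℝ (nF F) (curl (interp ℓ w T) x) := fun x => by
    rw [curl_sub (hwc.differentiable (by simp)) (hu.differentiable (by simp)),
      inner_sub_right]
  simp only [h4] at h3
  rw [integral_sub (integrableOn_face F (by fun_prop)) (integrableOn_face F (by fun_prop))] at h3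
  exact sub_eq_zero.1 h3

theorem inner_matVec_nF (F : M.Face) (t : Mat3) (a : E3) :
    inner ℝ (matVec t (nF F)) a = inner ℝ (nF F) (matVec t (nF F)) * inner ℝ (nF F) a +
      inner ℝ (cross (nF F) (matVec t (nF F))) (cross (nF F) a) := by
  rw [inner_cross_cross, inner_nF_self, real_inner_comm (nF F) (matVec t (nF F))]
  ring

open scoped Classical in
/-- The integral of `grad curl w` against a constant matrix in terms of face integrals. -/
theorem setIntegral_gradCurl (hℓ : ℓ = 0 ∨ ℓ = 1) {w : M.Broken E3} (hw : w ∈ wSpace ℓ c)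
    {μ : M.Face → E3} (hμ : IsProjNCurl w μ) (T : M.Cell) (t : Mat3) :
    ∫ x in T.hull, frob (gradVec (curl (w T)) x) t = ∑ F : M.Face with F.IsSub T,
      ((∫ x in F.hull, sgn T F * inner ℝ (nOut T F) (matVec t (nOut T F)) *
          inner ℝ (nF F) (curl (interp ℓ w T) x) ∂μHE[2]) +
        ∫ _x in F.hull, inner ℝ (cross (nOut T F) (matVec t (nF F))) (μ F) ∂μHE[2]) := by
  obtain ⟨g, A, -, hg⟩ := (hw.1 T).exists_curl hℓ
  have hgs : ContDiff ℝ 1 (curl (w T)) := by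
    rw [hg]; exact (contDiff_affField g A).of_le one_le_infty
  have hgc := hgs.continuous
  have h1 : ∀ x, frob (gradVec (curl (w T)) x) t =
      divVec (fun y => matVec t.transpose (curl (w T) y)) x := fun x =>
    (divVec_matVec_transpose t (hgs.differentiable (by norm_num) x)).symm
  simp only [h1]
  rw [integral_divVec_cell T (contDiff_matVec _ hgs)]
  refine Finset.sum_congr rfl fun F hF => ?_
  have hF' : F.IsSub T := (Finset.mem_filter.1 hF).2
  set n := nF F with hn
  set s := sgn T F with hs
  have hsgn : s * s = 1 := sgn_mul_self T F
  have h2 : ∀ x, inner ℝ (nOut T F) (matVec t.transpose (curl (w T) x)) =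
      s * inner ℝ n (matVec t n) * inner ℝ n (curl (w T) x) +
        s * inner ℝ (cross n (matVec t n)) (cross n (curl (w T) x)) := fun x => by
    rw [inner_matVec_transpose, nOut, matVec_smul, inner_smul_left, conj_trivial,
      inner_matVec_nF F t]
    ring
  -- The jump term carries the orientation sign three times, and s * s = 1.
  have h3 : s * inner ℝ (nOut T F) (matVec t (nOut T F)) = s * inner ℝ n (matVec t n) := by
    rw [nOut, matVec_smul, inner_smul_left, inner_smul_right, conj_trivial]
    linear_combination s * inner ℝ n (matVec t n) * hsgn
  have h4 : inner ℝ (cross (nOut T F) (matVec t n)) (μ F) =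
      s * inner ℝ (cross n (matVec t n)) (μ F) := by
    rw [nOut, show cross (sgn T F • nF F) (matVec t n) = s • cross n (matVec t n) by
      apply E3_ext <;> simp <;> ring, inner_smul_left, conj_trivial]
  simp only [h2, h3, h4]
  rw [integral_add (integrableOn_face F (by fun_prop)) (integrableOn_face F (by fun_prop)),
    integral_const_mul, integral_const_mul, integral_const_mul,
    setIntegral_inner_curl_interp hℓ hw hF']
  congr 1
  -- The factor n × t n is constant on F, so n × curl w may be replaced by its mean μ F.
  rw [setIntegral_const, hμ F T hF', inner_projF F _ (by fun_prop), integral_face_eq]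
  change _ = area F * _
  ring

/-- Integration by parts on the nonconforming space. -/
theorem ipMat_gradCurl (hℓ : ℓ = 0 ∨ ℓ = 1) {w : M.Broken E3} (hw : w ∈ wSpace ℓ c)
    {μ : M.Face → E3} (hμ : IsProjNCurl w μ) {τ : M.Broken Mat3} (hτ : τ ∈ sigma0 (M := M)) :
    ipMat (gradVecH (curlH w)) τ = -curlDivW τ (interp ℓ w) - cForm τ μ := by
  classical
  obtain ⟨t, rfl, -⟩ := mem_sigma0_iff.1 hτ
  -- The volume term of `curlDivW` disappears, since τ is constant on each cell.
  have hd : ∀ (T : M.Cell) (x : E3), divMat (fun _ => t T) x = 0 := fun T x => by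
    ext i; simp [divMat, pd]
  have h1 : ipMat (gradVecH (curlH w)) (fun T _ => t T) =
      ∑ T : M.Cell, ∫ x in T.hull, frob (gradVec (curl (w T)) x) (t T) := rfl
  rw [h1, Finset.sum_congr rfl fun T _ => setIntegral_gradCurl hℓ hw hμ T (t T)]
  simp only [Finset.sum_add_distrib, curlDivW, cForm, hd, inner_zero_left, integral_zero,
    Finset.sum_const_zero, zero_sub, neg_neg, sub_neg_eq_add]
  congr 1
  rw [sum_cells_faces]
  -- The jump sum runs over interior faces only. Boundary faces add nothing: the edge moments of I_h
  -- w vanish there, and with them the flux of its curl.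
  refine (Finset.sum_subset (Finset.filter_subset _ _) fun F _ hF => ?_).symm
  have hF' : IsBdryFace F := by
    by_contra hn
    exact hF (Finset.mem_filter.2 ⟨Finset.mem_univ _, hn⟩)
  refine Finset.sum_eq_zero fun T hT => ?_
  have hT' : F.IsSub T := (Finset.mem_filter.1 hT).2
  obtain ⟨hu, -, hb⟩ := (mem_nedelec0_iff hℓ).1 (interp_mem_nedelec0 hℓ hw)
  have huc := (hu T).contDiff hℓ
  have h2 := edgeVanish_of_isBdryFace hℓ huc.continuous fun e he q hq =>
    hb e T (isBdryEdge_of_isSub hF' he) (isSub_trans he hT') q hq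
  rw [integral_const_mul, integral_face_eq,
    faceAvg_inner_curl_eq_zero F (huc.of_le one_le_infty) h2, mul_zero, mul_zero]

/-! ### Degrees of freedom of the nonconforming space -/

/-- The local problems on the cells are independent. Their solutions fit together because the
prescribed edge moments and multipliers are shared by adjacent cells. -/
theorem exists_mem_wSpace (hℓ : ℓ = 0 ∨ ℓ = 1) (c : M.Cell → E3) {u : M.Broken E3}
    (hu : u ∈ nedelec0 (M := M) ℓ) {μ : M.Face → E3} (hμ : μ ∈ lambda0 (M := M)) :
    ∃ w ∈ wSpace ℓ c, interp ℓ w = u ∧ IsProjNCurl w μ := by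
  obtain ⟨hu1, hu2, hu3⟩ := (mem_nedelec0_iff hℓ).1 hu
  have hμt : ∀ F : M.Face, inner ℝ (μ F) (nF F) = 0 := fun F => by
    by_cases hF : IsBdryFace F
    · rw [hμ.2 F hF, inner_zero_left]
    · exact hμ.1 F hF
  choose w hw1 hw2 hw3 using fun T =>
    exists_gradCurlShape hℓ T (c T) (hu1 T) μ fun F _ => hμt F
  have hwc := fun T => ((hw1 T).contDiff hℓ).continuous
  have he : ∀ (T : M.Cell) (e : M.Edge), e.IsSub T → ∀ q, IsPoly ℓ q →
      edgeDof e (u T) q = edgeDof e (w T) q := fun T =>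
    (simp_edges_iff hℓ T ((hu1 T).contDiff hℓ).continuous (hwc T)).2 (hw2 T)
  have hf : ∀ (T : M.Cell) (F : M.Face), F.IsSub T → faceDof F (w T) = -(area F) • μ F :=
    fun T F hF => by rw [faceDof_eq, hw3 T F hF]
  refine ⟨w, ⟨hw1, ?_, ?_, ?_, ?_⟩, ?_, fun F T hF => (hw3 T F hF).symm⟩
  · intro e T T' hT hT' q hq
    rw [← he T e hT q hq, ← he T' e hT' q hq, hu2 e T T' hT hT' q hq]
  · intro F T T' hT hT'
    rw [hf T F hT, hf T' F hT']
  · intro e T hb hT q hq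
    rw [← he T e hT q hq, hu3 e T hb hT q hq]
  · intro F T hF hT
    rw [hf T F hT, hμ.2 F hF, smul_zero]
  · funext T
    have hs := interp_spec hℓ w T (hwc T)
    exact nedelec_unique hℓ T hs.1 (hu1 T) fun e hT q hq => by
      rw [hs.2 e hT q hq, he T e hT q hq]

theorem wSpace_unique (hℓ : ℓ = 0 ∨ ℓ = 1) {w w' : M.Broken E3} (hw : w ∈ wSpace ℓ c)
    (hw' : w' ∈ wSpace ℓ c) (hi : interp ℓ w = interp ℓ w') {μ : M.Face → E3}
    (hμ : IsProjNCurl w μ) (hμ' : IsProjNCurl w' μ) : w = w' := by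
  funext T
  have hc := (hw.1 T).contDiff hℓ
  have hc' := (hw'.1 T).contDiff hℓ
  refine sub_eq_zero.1 (gradCurlShape_eq_zero hℓ T ((hw.1 T).sub hℓ (hw'.1 T)) ?_ ?_)
  · refine (simp_edges_iff hℓ T hc.continuous hc'.continuous).1 fun e hT q hq => ?_
    rw [← (interp_spec hℓ w T hc.continuous).2 e hT q hq, hi,
      (interp_spec hℓ w' T hc'.continuous).2 e hT q hq]
  · intro F hF
    have k1 := continuous_curl (hc.of_le one_le_infty)
    have k2 := continuous_curl (hc'.of_le one_le_infty)
    have h1 : ∀ x, cross (nF F) (curl (w T - w' T) x) =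
        cross (nF F) (curl (w T) x) - cross (nF F) (curl (w' T) x) := fun x => by
      rw [curl_sub (hc.differentiable (by simp)) (hc'.differentiable (by simp))]
      apply E3_ext <;> simp <;> ring
    have h2 := (hμ F T hF).symm.trans (hμ' F T hF)
    simp only [h1]
    rw [projF_eq, projF_eq] at h2
    rw [projF_eq, integral_sub (integrableOn_face F (by fun_prop))
      (integrableOn_face F (by fun_prop)), smul_sub, h2, sub_self]

/-! ### Equivalence of the two methods -/

/-- The difference is itself an admissible test function, and the cell volumes are positive. -/
theorem eq_of_ipMat_eq {σ σ' : M.Broken Mat3} (hσ : σ ∈ sigma0 (M := M))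
    (hσ' : σ' ∈ sigma0 (M := M)) (h : ∀ τ ∈ sigma0 (M := M), ipMat σ τ = ipMat σ' τ) : σ = σ' := by
  obtain ⟨s, rfl, hs⟩ := mem_sigma0_iff.1 hσ
  obtain ⟨t, rfl, ht⟩ := mem_sigma0_iff.1 hσ'
  have h1 := h (fun T _ => s T - t T)
    (mem_sigma0_iff.2 ⟨fun T => s T - t T, rfl, fun T => by
      rw [Matrix.trace_sub, hs, ht, sub_zero]⟩)
  rw [ipMat_const, ipMat_const t, ← sub_eq_zero, ← Finset.sum_sub_distrib] at h1
  have h2 : ∀ T : M.Cell, vol T * frob (s T) (s T - t T) - vol T * frob (t T) (s T - t T) =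
      vol T * ∑ i, ∑ j, (s T i j - t T i j) ^ 2 := fun T => by
    rw [← mul_sub]
    simp only [frob, ← Finset.sum_sub_distrib, Matrix.sub_apply]
    congr 1
    refine Finset.sum_congr rfl fun i _ => Finset.sum_congr rfl fun j _ => ?_
    ring
  simp only [h2] at h1
  have hnn : ∀ T : M.Cell, 0 ≤ ∑ i, ∑ j, (s T i j - t T i j) ^ 2 := fun T =>
    Finset.sum_nonneg fun i _ => Finset.sum_nonneg fun j _ => sq_nonneg _
  rw [Finset.sum_eq_zero_iff_of_nonneg fun T _ => mul_nonneg (vol_pos T).le (hnn T)] at h1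
  funext T x
  ext i j
  have h3 := (mul_eq_zero.1 (h1 T (Finset.mem_univ _))).resolve_left (vol_pos T).ne'
  rw [Finset.sum_eq_zero_iff_of_nonneg fun i _ => Finset.sum_nonneg fun j _ => sq_nonneg _] at h3
  have h4 := h3 i (Finset.mem_univ _)
  rw [Finset.sum_eq_zero_iff_of_nonneg fun j _ => sq_nonneg _] at h4
  exact sub_eq_zero.1 (pow_eq_zero_iff two_ne_zero |>.1 (h4 j (Finset.mem_univ _)))

/-- Once u and μ are expressed through w, integration by parts turns each hybrid equation into its
nonconforming counterpart. -/
theorem isHybridSol_iff (hℓ : ℓ = 0 ∨ ℓ = 1) {f : M.Broken E3 →ₗ[ℝ] ℝ} {w : M.Broken E3}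
    (hw : w ∈ wSpace ℓ c) {μ : M.Face → E3} (hμ : μ ∈ lambda0 (M := M)) (hwμ : IsProjNCurl w μ)
    {σ : M.Broken Mat3} {φ : M.Broken ℝ} :
    IsHybridSol ℓ f σ (interp ℓ w) φ μ ↔
      IsNonconformingSol ℓ c f w φ ∧ σ = gradVecH (curlH w) := by
  have hgc := gradCurl_mem_sigma0 hℓ hw
  constructor
  · rintro ⟨hσ, -, hφ, -, h1, h2⟩
    have hσw : σ = gradVecH (curlH w) := by
      refine eq_of_ipMat_eq hσ hgc fun τ hτ => ?_
      -- With ψ = 0 the first hybrid equation gives σ the same products as grad curl w.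
      have h3 := h1 τ hτ 0 zero_mem_lagrange0
      have h4 := ipMat_gradCurl hℓ hw hwμ hτ
      rw [bForm, ipVec_gradH_zero] at h3
      linarith
    refine ⟨⟨hw, hφ, fun v hv => ?_, fun ψ hψ => ?_⟩, hσw⟩
    -- A test function v of `W_h` is matched by the pair (I_h v, Q(n_F × curl v)).
    · obtain ⟨η, hη, hvη⟩ := exists_isProjNCurl hℓ hv
      have h3 := h2 _ (interp_mem_nedelec0 hℓ hv) η hη
      have h4 := ipMat_gradCurl hℓ hv hvη hgc
      rw [bForm, hσw, ipVec_comm] at h3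
      rw [ipMat_comm]
      linarith
    · have h3 := h1 0 zero_mem_sigma0 ψ hψ
      have h4 := ipMat_gradCurl hℓ hw hwμ zero_mem_sigma0
      rw [ipMat_zero] at h3 h4
      rw [bForm, ipVec_comm] at h3
      linarith
  · rintro ⟨⟨-, hφ, h1, h2⟩, rfl⟩
    refine ⟨hgc, interp_mem_nedelec0 hℓ hw, hφ, hμ, fun τ hτ ψ hψ => ?_, fun v hv η hη => ?_⟩
    · have h3 := ipMat_gradCurl hℓ hw hwμ hτ
      have h4 := h2 ψ hψ
      rw [bForm, ipVec_comm]
      linarith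
    -- Surjectivity enters here: every pair of hybrid test functions comes from some v' in `W_h`.
    · obtain ⟨v', hv', rfl, hvη⟩ := exists_mem_wSpace hℓ c hv hη
      have h3 := ipMat_gradCurl hℓ hv' hvη hgc
      have h4 := h1 v' hv'
      rw [ipMat_comm] at h4
      rw [bForm, ipVec_comm]
      linarith

end TetMesh

end QuadCurl

end

/-! ### The equivalence theorem -/

open QuadCurl QuadCurl.TetMesh in
theorem mainTheorem8 (Ω : Set E3) (M : TetMesh Ω) (ℓ : ℕ) (hℓ : ℓ = 0 ∨ ℓ = 1)
    (c : M.Cell → E3) (f : M.Broken E3 →ₗ[ℝ] ℝ) :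
    (∀ (w : M.Broken E3) (φ : M.Broken ℝ), IsNonconformingSol ℓ c f w φ →
      ∃ μ : M.Face → E3, IsProjNCurl w μ ∧
        IsHybridSol ℓ f (gradVecH (curlH w)) (interp ℓ w) φ μ) ∧
    (∀ (σ : M.Broken Mat3) (u : M.Broken E3) (φ : M.Broken ℝ) (μ : M.Face → E3),
      IsHybridSol ℓ f σ u φ μ →
        ∃! w : M.Broken E3, IsNonconformingSol ℓ c f w φ ∧
          σ = gradVecH (curlH w) ∧ u = interp ℓ w ∧ IsProjNCurl w μ) ∧
    ((∃! p : M.Broken E3 × M.Broken ℝ, IsNonconformingSol ℓ c f p.1 p.2) ↔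
      ∃! z : M.Broken Mat3 × M.Broken E3 × M.Broken ℝ × (M.Face → E3),
        IsHybridSol ℓ f z.1 z.2.1 z.2.2.1 z.2.2.2) := by
  have A : ∀ (w : M.Broken E3) (φ : M.Broken ℝ), IsNonconformingSol ℓ c f w φ →
      ∃ μ : M.Face → E3, IsProjNCurl w μ ∧
        IsHybridSol ℓ f (gradVecH (curlH w)) (interp ℓ w) φ μ := by
    intro w φ h
    obtain ⟨μ, hμ, hwμ⟩ := exists_isProjNCurl hℓ h.1
    exact ⟨μ, hwμ, (isHybridSol_iff hℓ h.1 hμ hwμ).2 ⟨h, rfl⟩⟩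
  have B : ∀ (σ : M.Broken Mat3) (u : M.Broken E3) (φ : M.Broken ℝ) (μ : M.Face → E3),
      IsHybridSol ℓ f σ u φ μ →
        ∃! w : M.Broken E3, IsNonconformingSol ℓ c f w φ ∧
          σ = gradVecH (curlH w) ∧ u = interp ℓ w ∧ IsProjNCurl w μ := by
    intro σ u φ μ h
    obtain ⟨w, hw, rfl, hwμ⟩ := exists_mem_wSpace hℓ c h.2.1 h.2.2.2.1
    obtain ⟨h1, h2⟩ := (isHybridSol_iff hℓ hw h.2.2.2.1 hwμ).1 h
    refine ⟨w, ⟨h1, h2, rfl, hwμ⟩, ?_⟩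
    rintro w' ⟨h1', -, h3', h4'⟩
    exact wSpace_unique hℓ h1'.1 hw h3'.symm h4' hwμ
  refine ⟨A, B, ?_, ?_⟩
  · rintro ⟨⟨w, φ⟩, hs, huniq⟩
    obtain ⟨μ, hwμ, hh⟩ := A w φ hs
    refine ⟨(gradVecH (curlH w), interp ℓ w, φ, μ), hh, ?_⟩
    rintro ⟨σ', u', φ', μ'⟩ h'
    obtain ⟨w', ⟨h1, h2, h3, h4⟩, -⟩ := B σ' u' φ' μ' h'
    -- Once w and φ are identified, the components σ, u and μ are functions of w.
    obtain ⟨rfl, rfl⟩ := Prod.mk.inj (huniq (w', φ') h1)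
    rw [h2, h3, h4.unique hwμ]
  · rintro ⟨⟨σ, u, φ, μ⟩, hs, huniq⟩
    obtain ⟨w, ⟨h1, -, h3, h4⟩, -⟩ := B σ u φ μ hs
    refine ⟨(w, φ), h1, ?_⟩
    rintro ⟨w', φ'⟩ h'
    obtain ⟨μ', hwμ', hh⟩ := A w' φ' h'
    -- Uniqueness on the hybrid side fixes φ, the interpolant and the multiplier, and the last two
    -- determine w'.
    have e := huniq (gradVecH (curlH w'), interp ℓ w', φ', μ') hh
    simp only [Prod.mk.injEq] at e
    obtain ⟨-, e2, rfl, rfl⟩ := e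
    exact Prod.ext (wSpace_unique hℓ h'.1 h1.1 (e2.trans h3) hwμ' h4) rfl
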